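/- **Theorem (rate of FastQuartic).** There are universal constants $C>0$ and $c\in\mathbb N$ such that the following holds. Let $d\in\mathbb N$, let $\mathbf B\in\mathbb R^{d\times d}$ be symmetric positive definite, $\|v\|_{\mathbf B}=\sqrt{v^\top\mathbf Bv}$, $L_3>0$, and let $f:\mathbb R^d\to\mathbb R$ be convex and $L_3$-smooth of degree $3$ with respect to $\|\cdot\|_{\mathbf B}$: $f$ is three times differentiable and $\max_{\|h\|_{\mathbf B}\le1}|\nabla^3f(y)[h]^3-\nabla^3f(x)[h]^3|\le L_3\|y-x\|_{\mathbf B}$ for all $x,y$. Let $x_0\in\mathbb R^d$, let $x^*$ be a minimizer of $f$, and assume that the set of minimizers is bounded (for instance $x^*$ is unique). Then there is a problem-dependent $\mathcal Z>0$ (depending on $f,\mathbf B,L_3,x_0,x^*$ but not on $\varepsilon$) such that for every $\varepsilon>0$ there is an initialization $\rho^-\in(0,\frac12)$ with $2L_3\mathcal P\rho^-\le\varepsilon$, $\tilde\epsilon\in(0,\frac12)$, $K,J,N\in\mathbb N$, $M\ge1$, with which the method FastQuartic below outputs a point $x$ with $f(x)-f(x^*)\le\varepsilon$, carries out at most $$C\Bigl(1+\Bigl(\frac{L_3\|x_0-x^*\|_{\mathbf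 B}^4}{\varepsilon}\Bigr)^{1/5}\Bigr)$$ iterations, and makes in each iteration at most $C\log^{c}(2+\mathcal Z/\varepsilon)$ calls to a gradient oracle and a linear system solver, in total. *Oracles.* Computing one of $\nabla f(y)$, $\nabla^2f(y)h$, $\nabla^3f(y)[h]^2$ is one gradient-oracle call; solving one linear system with matrix $\mathbf B$ or $\nabla^2f(y)+\mu\mathbf B$ is one solver call. Arithmetic is exact. *Quantities.* $\mathcal K=\{x:\|x-x_0\|_{\mathbf B}^2\le4\|x_0-x^*\|_{\mathbf B}^2\}$, $\mathcal F=\max_{\mathcal K}f$, $\mathcal L=\{f\le\mathcal F\}$, $\mathcal P=\max_{x,y\in\mathcal L}\|x-y\|_{\mathbf B}^2$, $\mathcal G=\max_{x\in\mathcal L}\|\nabla f(x)\|_{\mathbf B^{-1}}^2$, $\mathcal Q=6\mathcal P^{1/2}L_3^{-1/4}+5L_3^{-1/2}$, $\tilde\delta=6(\tilde\epsilon/L_3)^{1/4}\mathcal P^{1/2}+(12\tilde\epsilon/L_3)^{1/2}$, and $\tilde\epsilon_{fs}=\min\{3L_3^2\mathcal P\rho^- /(32\mathcal G),\frac12\}$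 (with $t/0=0$). For $A\ge0$, $\rho>0$ put $a(A,\rho)=\frac{1+\sqrt{1+4L_3A\rho}}{2L_3\rho}$ and $y(\rho)=(1-\tau)x_k+\tau v_k$ with $\tau=a(A_k,\rho)/(A_k+a(A_k,\rho))$. *ApproxAuxMin$(y)$.* Put $\Gamma(h)=\langle\nabla f(y),h\rangle+\frac12h^\top\nabla^2f(y)h+\frac16\nabla^3f(y)[h]^3+\frac{L_3}4\|h\|_{\mathbf B}^4$, $\varrho(h)=\frac12h^\top\nabla^2f(y)h+\frac{L_3}4\|h\|_{\mathbf B}^4$, $\kappa=1+\frac1{\sqrt2}$. Start from $h_0=0$, make $K$ steps $$h_{t+1}\approx\arg\min_h\bigl\{\langle\nabla\Gamma(h_t),h-h_t\rangle+\kappa\bigl(\varrho(h)-\varrho(h_t)-\langle\nabla\varrho(h_t),h-h_t\rangle\bigr)\bigr\},$$ and return $y+h_K$. With $b=\kappa^{-1}\nabla\Gamma(h_t)-\nabla\varrho(h_t)$, the step is $h_{t+1}=-(\nabla^2f(y)+\mu\mathbf B)^{-1}b$, where $\mu$ is the upper end of the interval left by $J$ bisection steps, started on $[0,(L_3\|b\|_{\mathbf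 B^{-1}}^2)^{1/3}]$, on the sign of the derivative $\mu/L_3-\|(\nabla^2f(y)+\mu\mathbf B)^{-1}b\|_{\mathbf B}^2$ of the convex function $w(\mu)=\frac{\mu^2}{2L_3}+\langle(\nabla^2f(y)+\mu\mathbf B)^{-1}b,b\rangle$. *RhoSearch.* Start with $[\rho_1,\rho_2]=[\rho^-,\mathcal P]$. At most $M$ times: let $\hat\rho=\frac{\rho_1+\rho_2}2$, $\hat a=a(A_k,\hat\rho)$, $\hat y=y(\hat\rho)$, $\hat x=\mathrm{ApproxAuxMin}(\hat y)$, $\hat\zeta=\|\hat x-\hat y\|_{\mathbf B}^2$; if $\hat\rho>\hat\zeta+\tilde\delta$ set $\rho_2=\hat\rho$, else if $\hat\rho<\hat\zeta-\tilde\delta$ set $\rho_1=\hat\rho$, else stop. Return the last $(\hat x,\hat a)$. *FastQuartic.* Let $A_0=0$ and $\psi_0(x)=\frac12\|x-x_0\|_{\mathbf B}^2$. For $k=0,\dots,N$: let $v_k=\arg\min\psi_k$, $y_k^-=y(\rho^-)$, $x_{k+1}^-=\mathrm{ApproxAuxMin}(y_k^-)$, $r=\|x_{k+1}^--y_k^-\|_{\mathbf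 B}^2$. If $\rho^->(1+\tilde\epsilon_{fs})r$ or $\rho^->r-\mathcal Q\tilde\epsilon^{1/4}$, stop and output $x_{k+1}^-$. Otherwise obtain $(x_{k+1},a_{k+1})$ from RhoSearch, and set $A_{k+1}=A_k+a_{k+1}$ and $\psi_{k+1}(x)=\psi_k(x)+a_{k+1}[f(x_{k+1})+\langle\nabla f(x_{k+1}),x-x_{k+1}\rangle]$. If the loop ends, output $x_{N+1}$. -/

import Mathlib

open Set Matrix

noncomputable section

namespace FastQuartic

/-! ### Norms, derivatives, smoothness.
Vectors are coordinate vectors `Fin d → ℝ`; the norms used are those induced by a positive definite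
matrix `B` (the sup norm carried by the type enters only through its topology). -/

/-- `‖v‖_B = √(vᵀ B v)`. -/
def bNorm {d : ℕ} (B : Matrix (Fin d) (Fin d) ℝ) (v : Fin d → ℝ) : ℝ :=
  Real.sqrt (v ⬝ᵥ (B *ᵥ v))

/-- The gradient `∇f(x)`. -/
def grad {d : ℕ} (f : (Fin d → ℝ) → ℝ) (x : Fin d → ℝ) : Fin d → ℝ :=
  fun i => fderiv ℝ f x (Pi.single i 1)

/-- The Hessian matrix `∇²f(x)`. -/
def hess {d : ℕ} (f : (Fin d → ℝ) → ℝ) (x : Fin d → ℝ) : Matrix (Fin d) (Fin d) ℝ :=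
  Matrix.of fun i j => iteratedFDeriv ℝ 2 f x ![Pi.single i 1, Pi.single j 1]

/-- The vector `∇³f(x)[h]²`, i.e. `∇³f(x)[·, h, h]`. -/
def third {d : ℕ} (f : (Fin d → ℝ) → ℝ) (x h : Fin d → ℝ) : Fin d → ℝ :=
  fun i => iteratedFDeriv ℝ 3 f x ![Pi.single i 1, h, h]

/-- `f` is `L`-smooth of degree `p` with respect to `‖·‖_B`:
`max_{‖h‖_B ≤ 1} |∇ᵖf(y)[h]ᵖ - ∇ᵖf(x)[h]ᵖ| ≤ L ‖y - x‖_B` for all `x, y`.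
(For a `p` times differentiable function this Lipschitz bound makes `∇ᵖf` continuous, so asking for
`C^p` is the same as asking for `p` times differentiable.) -/
def IsSmoothOfDegree {d : ℕ} (p : ℕ) (L : ℝ) (B : Matrix (Fin d) (Fin d) ℝ)
    (f : (Fin d → ℝ) → ℝ) : Prop :=
  ContDiff ℝ p f ∧ ∀ x y h : Fin d → ℝ, bNorm B h ≤ 1 →
    |iteratedFDeriv ℝ p f y (fun _ => h) - iteratedFDeriv ℝ p f x (fun _ => h)|
      ≤ L * bNorm B (y - x)

/-! ### Problem data and the problem-dependent quantities used by the method -/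

/-- The data of a problem: the objective `f`, the matrix `B`, the smoothness constant `L` (`= L₃`),
the starting point `x0`, and a minimizer `xs` (`= x*`). The minimizer is not known to the method; it
enters only through the scalars `P`, `G` below. -/
structure Problem (d : ℕ) where
  f : (Fin d → ℝ) → ℝ
  B : Matrix (Fin d) (Fin d) ℝ
  L : ℝ
  x0 : Fin d → ℝ
  xs : Fin d → ℝ

namespace Problem

variable {d : ℕ} (q : Problem d)

/-- `𝒦 = {x : ‖x - x₀‖_B² ≤ 4 ‖x₀ - x*‖_B²}`. -/
def ball : Set (Fin d → ℝ) :=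
  {x | bNorm q.B (x - q.x0) ^ 2 ≤ 4 * bNorm q.B (q.x0 - q.xs) ^ 2}

/-- `ℱ = max_{x ∈ 𝒦} f(x)`. -/
def F : ℝ := sSup (q.f '' q.ball)

/-- `ℒ = {x : f(x) ≤ ℱ}`. -/
def level : Set (Fin d → ℝ) := {x | q.f x ≤ q.F}

/-- `𝒫 = max_{x, y ∈ ℒ} ‖x - y‖_B²`. -/
def P : ℝ := sSup {r | ∃ x ∈ q.level, ∃ y ∈ q.level, r = bNorm q.B (x - y) ^ 2}

/-- `𝒢 = max_{x ∈ ℒ} ‖∇f(x)‖²` in the dual norm `‖·‖_{B⁻¹}`. -/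
def G : ℝ := sSup ((fun x => bNorm (q.B⁻¹) (grad q.f x) ^ 2) '' q.level)

/-- `𝒬 = 6 𝒫^{1/2} / L₃^{1/4} + 5 / L₃^{1/2}`. -/
def Q : ℝ := 6 * q.P ^ (1 / 2 : ℝ) / q.L ^ (1 / 4 : ℝ) + 5 / q.L ^ (1 / 2 : ℝ)

end Problem

/-! ### Computations that count oracle calls -/

/-- A value together with the number of gradient-oracle calls and of linear-solver calls that were
made to compute it. -/
structure Counted (α : Type) where
  val : α
  gradCalls : ℕ
  solveCalls : ℕ

instance : Monad Counted where
  pure a := ⟨a, 0, 0⟩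
  bind m k :=
    ⟨(k m.val).val, m.gradCalls + (k m.val).gradCalls, m.solveCalls + (k m.val).solveCalls⟩

/-- Gradient oracle: `∇f(x)`. -/
def callGrad {d : ℕ} (f : (Fin d → ℝ) → ℝ) (x : Fin d → ℝ) : Counted (Fin d → ℝ) :=
  ⟨grad f x, 1, 0⟩

/-- Gradient oracle, first-order term of `∇f` at `x` in direction `h`: `∇²f(x) h`;
charged as one call. -/
def callHess {d : ℕ} (f : (Fin d → ℝ) → ℝ) (x h : Fin d → ℝ) : Counted (Fin d → ℝ) :=
  ⟨hess f x *ᵥ h, 1, 0⟩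

/-- Gradient oracle, second-order term of `∇f` at `x` in direction `h`: `∇³f(x)[h]²`;
charged as one call. -/
def callThird {d : ℕ} (f : (Fin d → ℝ) → ℝ) (x h : Fin d → ℝ) : Counted (Fin d → ℝ) :=
  ⟨third f x h, 1, 0⟩

/-- Linear system solver: the solution `s` of `A s = b`. -/
def callSolve {d : ℕ} (A : Matrix (Fin d) (Fin d) ℝ) (b : Fin d → ℝ) : Counted (Fin d → ℝ) :=
  ⟨A⁻¹ *ᵥ b, 0, 1⟩

/-! ### The method -/

/-- The inputs of the method ("initialization"): the lower bound `rho = ρ_init⁻`, the accuracy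
`eps = ε̃_aam`, the numbers `K`, `M`, `N` of iterations of `ApproxAuxMin`, `RhoSearch` and
`FastQuartic`, and the number `J` of iterations of the one-dimensional search inside
`ApproxAuxMin`. -/
structure Init where
  rho : ℝ
  eps : ℝ
  K : ℕ
  J : ℕ
  M : ℕ
  N : ℕ

section Method

variable {d : ℕ} (q : Problem d) (p : Init)

/-- Bisection for the minimizer over `μ ≥ 0` of the convex function
`w(μ) = μ² / (2 L₃) + ⟨(∇²f(y) + μ B)⁻¹ b, b⟩`,
whose derivative is `w'(μ) = μ / L₃ - ‖(∇²f(y) + μ B)⁻¹ b‖_B²`. -/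
def dualSearch (y b : Fin d → ℝ) : ℕ → ℝ → ℝ → Counted ℝ
  | 0, _, hi => pure hi
  | n + 1, lo, hi => do
    let μ := (lo + hi) / 2
    let s ← callSolve (hess q.f y + μ • q.B) b
    if 0 ≤ μ / q.L - bNorm q.B s ^ 2 then dualSearch y b n lo μ else dualSearch y b n μ hi

/-- Minimizes `⟨b, h⟩ + ½ hᵀ ∇²f(y) h + (L₃/4) ‖h‖_B⁴` over `h`. The minimizer is
`h = -(∇²f(y) + μ B)⁻¹ b`, where `μ = L₃ ‖h‖_B²` is the minimizer of `w`; it lies between `0` and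
`(L₃ ‖b‖²)^{1/3}` (dual norm) and is found by `p.J` steps of bisection. -/
def quarticStep (y b : Fin d → ℝ) : Counted (Fin d → ℝ) := do
  let t ← callSolve q.B b
  let μ ← dualSearch q y b p.J 0 ((q.L * (b ⬝ᵥ t)) ^ (1 / 3 : ℝ))
  let s ← callSolve (hess q.f y + μ • q.B) b
  pure (-s)

/-- One iteration of `ApproxAuxMin`. With
`Γ(h) = ⟨∇f(y), h⟩ + ½ hᵀ ∇²f(y) h + (1/6) ∇³f(y)[h]³ + (L₃/4) ‖h‖_B⁴` and
`ϱ(h) = ½ hᵀ ∇²f(y) h + (L₃/4) ‖h‖_B⁴`, it is the relative gradient step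
`h⁺ = argmin_u ⟨∇Γ(h), u - h⟩ + κ (ϱ(u) - ϱ(h) - ⟨∇ϱ(h), u - h⟩)`, where `κ = 1 + 1/√2` is the
smoothness constant of `Γ` relative to `ϱ`. -/
def auxStep (y h : Fin d → ℝ) : Counted (Fin d → ℝ) := do
  let g₁ ← callGrad q.f y
  let g₂ ← callHess q.f y h
  let g₃ ← callThird q.f y h
  let r := (q.L * bNorm q.B h ^ 2) • (q.B *ᵥ h)
  let c := g₁ + g₂ + (1 / 2 : ℝ) • g₃ + r
  quarticStep q p y ((1 + 1 / Real.sqrt 2)⁻¹ • c - (g₂ + r))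

/-- `n` iterations of `ApproxAuxMin` from `h`. -/
def auxLoop (y : Fin d → ℝ) : ℕ → (Fin d → ℝ) → Counted (Fin d → ℝ)
  | 0, h => pure h
  | n + 1, h => do
    let h' ← auxStep q p y h
    auxLoop y n h'

/-- `ApproxAuxMin`: approximate minimizer of the model
`Ω_y(x) = Φ_y(x) + (L₃/4) ‖x - y‖_B⁴ = f(y) + Γ(x - y)`, with `Φ_y` the third-order Taylor
polynomial of `f` at `y`. -/
def approxAuxMin (y : Fin d → ℝ) : Counted (Fin d → ℝ) := do
  let h ← auxLoop q p y p.K 0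
  pure (y + h)

/-- `a = (1 + √(1 + 4 L₃ A ρ)) / (2 L₃ ρ)`, the positive root of `L₃ ρ a² = A + a`. -/
def stepSize (A rho : ℝ) : ℝ :=
  (1 + Real.sqrt (1 + 4 * q.L * A * rho)) / (2 * q.L * rho)

/-- `y = (1 - τ) x + τ v` with `τ = a / (A + a)`. -/
def mixPoint (x v : Fin d → ℝ) (A a : ℝ) : Fin d → ℝ :=
  (1 - a / (A + a)) • x + (a / (A + a)) • v

/-- `δ̃ = 6 (ε̃_aam / L₃)^{1/4} 𝒫^{1/2} + (12 ε̃_aam / L₃)^{1/2}`. -/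
def delta : ℝ :=
  6 * (p.eps / q.L) ^ (1 / 4 : ℝ) * q.P ^ (1 / 2 : ℝ) + (12 * p.eps / q.L) ^ (1 / 2 : ℝ)

/-- The loop of `RhoSearch`, with the remaining number of iterations, the current bounds `ρ⁻`, `ρ⁺`,
and the latest candidate pair `(x̂, â)`. It returns `(ρ, x̂, â)`. -/
def rhoLoop (x v : Fin d → ℝ) (A : ℝ) :
    ℕ → ℝ → ℝ → (Fin d → ℝ) × ℝ → Counted (ℝ × (Fin d → ℝ) × ℝ)
  | 0, lo, _, last => pure (lo, last)
  | n + 1, lo, hi, _ => do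
    let ρ := (lo + hi) / 2
    let a := stepSize q A ρ
    let y := mixPoint x v A a
    let x' ← approxAuxMin q p y
    let ζ := bNorm q.B (x' - y) ^ 2
    if ζ + delta q p < ρ then rhoLoop x v A n lo ρ (x', a)
    else if ρ < ζ - delta q p then rhoLoop x v A n ρ hi (x', a)
    else pure (ρ, x', a)

/-- `RhoSearch`, started from the bounds `ρ_init⁻` and `ρ_init⁺ = 𝒫`. -/
def rhoSearch (x v : Fin d → ℝ) (A : ℝ) : Counted (ℝ × (Fin d → ℝ) × ℝ) :=
  rhoLoop q p x v A p.M p.rho q.P (x, 0)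

/-- `ε̃_fs = min {3 L₃² 𝒫 ρ_init⁻ / (32 𝒢), 1/2}`. -/
def epsFs : ℝ := min (3 * q.L ^ 2 * q.P * p.rho / (32 * q.G)) (1 / 2)

/-- The state of the method before iteration `k`: `x_k`, `A_k` and `S_k = ∑_{i ≤ k} a_i ∇f(x_i)`. -/
structure State (d : ℕ) where
  x : Fin d → ℝ
  A : ℝ
  S : Fin d → ℝ

/-- One iteration of `FastQuartic`: either it stops with an output point (`Sum.inl`), or it goes on
with the next state (`Sum.inr`). The minimizer of the estimate function
`ψ_k(x) = ½ ‖x - x₀‖_B² + ∑_{i ≤ k} a_i (f(x_i) + ⟨∇f(x_i), x - x_i⟩)` is `v_k = x₀ - B⁻¹ S_k`. -/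
def iteration (s : State d) : Counted ((Fin d → ℝ) ⊕ State d) := do
  let u ← callSolve q.B s.S
  let v := q.x0 - u
  let y := mixPoint s.x v s.A (stepSize q s.A p.rho)
  let x' ← approxAuxMin q p y
  if (1 + epsFs q p) * bNorm q.B (x' - y) ^ 2 < p.rho then pure (Sum.inl x')
  else if bNorm q.B (x' - y) ^ 2 - q.Q * p.eps ^ (1 / 4 : ℝ) < p.rho then pure (Sum.inl x')
  else do
    let r ← rhoSearch q p s.x v s.A
    let g ← callGrad q.f r.2.1
    pure (Sum.inr ⟨r.2.1, s.A + r.2.2, s.S + r.2.2 • g⟩)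

/-- The outcome of a run: the output point, and for every iteration of `FastQuartic` that was carried
out the numbers of gradient-oracle calls and of linear-solver calls made during it. -/
structure Run (d : ℕ) where
  output : Fin d → ℝ
  calls : List (ℕ × ℕ)

/-- At most `n` iterations of `FastQuartic` from the state `s`. -/
def mainLoop : ℕ → State d → Run d
  | 0, s => ⟨s.x, []⟩
  | n + 1, s =>
    let m := iteration q p s
    match m.val with
    | Sum.inl x => ⟨x, [(m.gradCalls, m.solveCalls)]⟩
    | Sum.inr s' =>
      let r := mainLoop n s'
      ⟨r.output, (m.gradCalls, m.solveCalls) :: r.calls⟩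

end Method

/-- `FastQuartic`: the iterations `k = 0, …, N`, from `x_0`, `A_0 = 0` and `ψ_0 = ½ ‖· - x_0‖_B²`. -/
def fastQuartic {d : ℕ} (q : Problem d) (p : Init) : Run d :=
  mainLoop q p (p.N + 1) ⟨q.x0, 0, 0⟩

end FastQuartic

end

noncomputable section

/-! Write `D` for the `B`-distance from the starting point to the minimizer. The method is an
inexact accelerated proximal scheme. At an almost critical point `h` of the quartic model at `y`,
Taylor's formula gives `B⁻¹∇f(y + h) = -L‖h‖² h` up to an error `L‖h‖³/6` plus the residual of the
model (`abs_der1_add_le`). If moreover `‖h‖²` is close to `ρ`, this is a proximal step with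
parameter `Lρ`, up to a relative error below one half. Since `Lρa² = A + a`, such a step raises the
estimate-sequence potential by at least `A'Lρ²/4`, where `A' = A + a` (`Cert.step`). Hence `A_k
(f(x_k) - f*) + E_k ≤ D²/2` with `E_k = ∑ A_i L ρ_i² / 4` (`Cert.bound`).

The rate follows by playing two facts against each other: large `ρ_i` use up the budget `E_k ≤
D²/2`, while small `ρ_i` make `√A` grow by at least `½(Lρ_i)^{-1/2}`. Hölder's inequality turns them
into `∑ A_i^{1/5} ≤ (64 L E_k A_k²)^{1/5}`, a recursion forcing `A_k ≥ k⁵ / (1024 L D²)` (`Grows`),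
and so a gap of at most `512 L D⁴ / k⁵`.

The model is solved at a linear rate free of any condition number. Nonnegativity of the Hessian at a
shifted point bounds the cubic term by the quadratic and quartic ones (`cubicBound_der3`), so the
model is smooth and strongly convex relative to the reference function with constants `1 ± √2/2`;
each relative gradient step contracts the Bregman distance by `0.83` (`refBreg_step_le`). The
smoothness hypothesis controls only the diagonal of the third derivative; the polarization theorem
`IsSymm3.abs_apply_le` extends it to `T(h,u,u)` without loss. Each step reduces to a one-dimensional
equation in `μ`, whose bisection error is controlled by monotonicity of `μ‖h(μ)‖`
(`resolvent_residual`).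

The search for `ρ` succeeds because the step depends Hölder-continuously on its center
(`nm_sub_pow_three_le`) and the center depends Lipschitz-continuously on `ρ`: a very short bracket
with opposite test results cannot exist (`Tuned.no_gap`). If the method stops early, the step is
short, so the gradient is small and the gap is at most the working scale (`stop_gap_le`). Iterates
stay in the compact level set, which supplies all constants.

All parameters are powers of `e = 2⁻ⁿ` with `K`, `J`, `M` linear in `n`, so an iteration costs
`O(n³)` calls. Constants of the problem are absorbed by requiring `n ≥ n0`. For `ε` below the
initial gap the factor `2^n0` in `𝒵` pays for this; for larger `ε` no inner iterations are run and
the starting point is returned. -/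

namespace FastQuartic

/-! ### Seminorms of bilinear forms and symmetric cubic forms. -/

section Forms

variable {V : Type*} [AddCommGroup V] [Module ℝ V]

/-- A symmetric positive semidefinite bilinear form. -/
structure IsPSD (b : V →ₗ[ℝ] V →ₗ[ℝ] ℝ) : Prop where
  symm : ∀ u v, b u v = b v u
  nonneg : ∀ u, 0 ≤ b u u

/-- The seminorm of a positive semidefinite form. -/
def nm (b : V →ₗ[ℝ] V →ₗ[ℝ] ℝ) (u : V) : ℝ := Real.sqrt (b u u)

/-- A symmetric trilinear form. -/
structure IsSymm3 (T : V →ₗ[ℝ] V →ₗ[ℝ] V →ₗ[ℝ] ℝ) : Prop where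
  left : ∀ u v w, T u v w = T v u w
  right : ∀ u v w, T u v w = T u w v

variable {b : V →ₗ[ℝ] V →ₗ[ℝ] ℝ}

lemma nm_nonneg (u : V) : 0 ≤ nm b u := Real.sqrt_nonneg _

lemma IsPSD.nm_sq (hb : IsPSD b) (u : V) : nm b u ^ 2 = b u u := Real.sq_sqrt (hb.nonneg u)

lemma IsPSD.apply_sq_le (hb : IsPSD b) (u v : V) : b u v ^ 2 ≤ b u u * b v v := by
  have key : ∀ t : ℝ, 0 ≤ b u u * (t * t) + (2 * b u v) * t + b v v := fun t => by
    have h := hb.nonneg (t • u + v)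
    simp only [map_add, map_smul, LinearMap.add_apply, LinearMap.smul_apply, smul_eq_mul,
      hb.symm v u] at h
    linarith
  have := discrim_le_zero key
  rw [discrim] at this
  linarith

lemma IsPSD.abs_apply_le (hb : IsPSD b) (u v : V) : |b u v| ≤ nm b u * nm b v := by
  rw [nm, nm, ← Real.sqrt_mul (hb.nonneg u)]
  exact Real.abs_le_sqrt (hb.apply_sq_le u v)

lemma nm_smul (t : ℝ) (u : V) : nm b (t • u) = |t| * nm b u := by
  simp only [nm, map_smul, LinearMap.smul_apply, smul_eq_mul]
  rw [← mul_assoc, Real.sqrt_mul (mul_self_nonneg t), Real.sqrt_mul_self_eq_abs]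

lemma nm_neg (u : V) : nm b (-u) = nm b u := by simp [nm]

lemma nm_zero : nm b (0 : V) = 0 := by simp [nm]

lemma IsPSD.nm_add_le (hb : IsPSD b) (u v : V) : nm b (u + v) ≤ nm b u + nm b v := by
  refine Real.sqrt_le_iff.2 ⟨add_nonneg (nm_nonneg u) (nm_nonneg v), ?_⟩
  have h1 := hb.nm_sq u
  have h2 := hb.nm_sq v
  have h3 := (abs_le.1 (hb.abs_apply_le u v)).2
  simp only [map_add, LinearMap.add_apply, hb.symm v u]
  nlinarith

lemma nm_sub_comm (u v : V) : nm b (u - v) = nm b (v - u) := by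
  rw [← neg_sub, nm_neg]

lemma IsPSD.nm_sub_le (hb : IsPSD b) (u v : V) : nm b (u - v) ≤ nm b u + nm b v := by
  rw [sub_eq_add_neg, ← nm_neg v]; exact hb.nm_add_le u (-v)

lemma IsPSD.nm_le_add_sub (hb : IsPSD b) (u v : V) : nm b u ≤ nm b v + nm b (u - v) := by
  simpa using hb.nm_add_le v (u - v)

lemma IsPSD.abs_nm_sub_le (hb : IsPSD b) (u v : V) : |nm b u - nm b v| ≤ nm b (u - v) := by
  rw [abs_le]
  have h1 := hb.nm_le_add_sub u v
  have h2 := hb.nm_le_add_sub v u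
  rw [nm_sub_comm v u] at h2
  constructor <;> linarith

/-- A symmetric cubic form evaluated at `p u + q w`. -/
lemma IsSymm3.apply_combo {T : V →ₗ[ℝ] V →ₗ[ℝ] V →ₗ[ℝ] ℝ} (hT : IsSymm3 T) (u w : V) (p q : ℝ) :
    T (p • u + q • w) (p • u + q • w) (p • u + q • w) =
      p ^ 3 * T u u u + 3 * p ^ 2 * q * T w u u + 3 * p * q ^ 2 * T w w u + q ^ 3 * T w w w := by
  simp only [map_add, map_smul, LinearMap.add_apply, LinearMap.smul_apply, smul_eq_mul]
  have h1 : T u w u = T w u u := hT.left _ _ _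
  have h2 : T u u w = T w u u := by rw [hT.right, h1]
  have h3 : T w u w = T w w u := hT.right _ _ _
  have h4 : T u w w = T w w u := by rw [hT.left, h3]
  rw [h1, h2, h3, h4]
  ring

/-- The three-point quadrature behind the polarization bound for cubic forms: `C`, `S` stand for the
cosine and sine of a third of the angle, `k` for `√3`. -/
lemma trisection_identities {C S k : ℝ} (h : C ^ 2 + S ^ 2 = 1) (hk : k ^ 2 = 3) :
    let c := C ^ 2 - S ^ 2
    let s := 2 * S * C
    let l0 := (1 + 2 * c) ^ 2 / 9
    let l1 := (1 - c + k * s) ^ 2 / 9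
    let l2 := (1 - c - k * s) ^ 2 / 9
    let p1 := -C / 2 - k / 2 * S
    let q1 := -S / 2 + k / 2 * C
    let p2 := -C / 2 + k / 2 * S
    let q2 := -S / 2 - k / 2 * C
    l0 + l1 + l2 = 1 ∧ p1 ^ 2 + q1 ^ 2 = 1 ∧ p2 ^ 2 + q2 ^ 2 = 1 ∧
    l0 * C ^ 3 + l1 * p1 ^ 3 + l2 * p2 ^ 3 = 4 * C ^ 3 - 3 * C ∧
    3 * (l0 * (C ^ 2 * S) + l1 * (p1 ^ 2 * q1) + l2 * (p2 ^ 2 * q2)) = 3 * S - 4 * S ^ 3 ∧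
    l0 * (C * S ^ 2) + l1 * (p1 * q1 ^ 2) + l2 * (p2 * q2 ^ 2) = 0 ∧
    l0 * S ^ 3 + l1 * q1 ^ 3 + l2 * q2 ^ 3 = 0 := by
  intro c s l0 l1 l2 p1 q1 p2 q2
  simp only [c, s, l0, l1, l2, p1, q1, p2, q2]
  refine ⟨?_, ?_, ?_, ?_, ?_, ?_, ?_⟩ <;> grind

end Forms

/-! ### Polarization of cubic forms without loss of constant. -/

section Polarization

variable {V : Type*} [AddCommGroup V] [Module ℝ V] {b : V →ₗ[ℝ] V →ₗ[ℝ] ℝ}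
  {T : V →ₗ[ℝ] V →ₗ[ℝ] V →ₗ[ℝ] ℝ} {c : ℝ}

lemma IsPSD.nm_combo (hb : IsPSD b) {u w : V} (hu : b u u = 1) (hw : b w w = 1) (huw : b u w = 0)
    (p q : ℝ) : nm b (p • u + q • w) = Real.sqrt (p ^ 2 + q ^ 2) := by
  rw [nm]
  congr 1
  simp only [map_add, map_smul, LinearMap.add_apply, LinearMap.smul_apply, smul_eq_mul,
    hb.symm w u, hu, hw, huw]
  ring

/-- With `C = cos θ`, `S = sin θ` the coefficients are `cos 3θ` and `sin 3θ`. The combination is an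
average of the cubic form over the unit vectors at angles `θ + 2πj/3`, with nonnegative weights `(1
+ 2 cos 2(θ + 2πj/3))²/9` of sum one, so the diagonal bound passes to it. -/
lemma IsSymm3.abs_trisect_le (hb : IsPSD b) (hT : IsSymm3 T)
    (hc : ∀ h, |T h h h| ≤ c * nm b h ^ 3) {u w : V} (hu : b u u = 1) (hw : b w w = 1)
    (huw : b u w = 0) {C S : ℝ} (h : C ^ 2 + S ^ 2 = 1) :
    |(4 * C ^ 3 - 3 * C) * T u u u + (3 * S - 4 * S ^ 3) * T w u u| ≤ c := by
  have hunit : ∀ p q : ℝ, p ^ 2 + q ^ 2 = 1 →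
      |p ^ 3 * T u u u + 3 * p ^ 2 * q * T w u u + 3 * p * q ^ 2 * T w w u + q ^ 3 * T w w w| ≤ c := by
    intro p q hpq
    have := hc (p • u + q • w)
    rwa [hT.apply_combo, hb.nm_combo hu hw huw, hpq, Real.sqrt_one, one_pow, mul_one] at this
  obtain ⟨e1, e2, e3, e4, e5, e6, e7⟩ :=
    trisection_identities h (Real.sq_sqrt (show (0 : ℝ) ≤ 3 by norm_num))
  generalize Real.sqrt 3 = k at e1 e2 e3 e4 e5 e6 e7
  have n0 := abs_le.1 (hunit _ _ h)
  have n1 := abs_le.1 (hunit _ _ e2)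
  have n2 := abs_le.1 (hunit _ _ e3)
  have w0 : 0 ≤ (1 + 2 * (C ^ 2 - S ^ 2)) ^ 2 / 9 := by positivity
  have w1 : 0 ≤ (1 - (C ^ 2 - S ^ 2) + k * (2 * S * C)) ^ 2 / 9 := by positivity
  have w2 : 0 ≤ (1 - (C ^ 2 - S ^ 2) - k * (2 * S * C)) ^ 2 / 9 := by positivity
  generalize (1 + 2 * (C ^ 2 - S ^ 2)) ^ 2 / 9 = l0 at *
  generalize (1 - (C ^ 2 - S ^ 2) + k * (2 * S * C)) ^ 2 / 9 = l1 at *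
  generalize (1 - (C ^ 2 - S ^ 2) - k * (2 * S * C)) ^ 2 / 9 = l2 at *
  generalize -C / 2 - k / 2 * S = p1 at *
  generalize -S / 2 + k / 2 * C = q1 at *
  generalize -C / 2 + k / 2 * S = p2 at *
  generalize -S / 2 - k / 2 * C = q2 at *
  have key : (4 * C ^ 3 - 3 * C) * T u u u + (3 * S - 4 * S ^ 3) * T w u u =
      l0 * (C ^ 3 * T u u u + 3 * C ^ 2 * S * T w u u + 3 * C * S ^ 2 * T w w u + S ^ 3 * T w w w) +
      l1 * (p1 ^ 3 * T u u u + 3 * p1 ^ 2 * q1 * T w u u + 3 * p1 * q1 ^ 2 * T w w u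
        + q1 ^ 3 * T w w w) +
      l2 * (p2 ^ 3 * T u u u + 3 * p2 ^ 2 * q2 * T w u u + 3 * p2 * q2 ^ 2 * T w w u
        + q2 ^ 3 * T w w w) := by
    rw [← e4, ← e5]
    linear_combination (-3 * T w w u) * e6 - T w w w * e7
  rw [key, abs_le]
  constructor
  · linarith [mul_le_mul_of_nonneg_left n0.1 w0, mul_le_mul_of_nonneg_left n1.1 w1,
      mul_le_mul_of_nonneg_left n2.1 w2, congrArg (c * ·) e1]
  · linarith [mul_le_mul_of_nonneg_left n0.2 w0, mul_le_mul_of_nonneg_left n1.2 w1,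
      mul_le_mul_of_nonneg_left n2.2 w2, congrArg (c * ·) e1]

lemma exists_polar (α β : ℝ) : ∃ φ : ℝ,
    α = Real.sqrt (α ^ 2 + β ^ 2) * Real.cos φ ∧ β = Real.sqrt (α ^ 2 + β ^ 2) * Real.sin φ := by
  have h : ‖(⟨α, β⟩ : ℂ)‖ = Real.sqrt (α ^ 2 + β ^ 2) := by
    rw [Complex.norm_eq_sqrt_sq_add_sq]
  refine ⟨Complex.arg ⟨α, β⟩, ?_, ?_⟩
  · rw [← h, Complex.norm_mul_cos_arg]
  · rw [← h, Complex.norm_mul_sin_arg]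

/-- Only the plane spanned by `u` and `h` matters. In an orthonormal basis `u, w` of it, `h` has
some polar angle `φ`, and the quadrature is applied at `θ = φ/3`. -/
lemma IsSymm3.abs_apply_unit_le (hb : IsPSD b) (hpos : ∀ u, b u u = 0 → u = 0) (hT : IsSymm3 T)
    (hc : ∀ h, |T h h h| ≤ c * nm b h ^ 3) {u : V} (hu : b u u = 1) (h : V) :
    |T h u u| ≤ c * nm b h := by
  have hnu : nm b u = 1 := by rw [nm, hu, Real.sqrt_one]
  set h' := h - b h u • u with hh'
  have hdec : h = b h u • u + h' := by rw [hh']; abel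
  by_cases h0 : h' = 0
  · have e : h = b h u • u := by rw [h0, add_zero] at hdec; exact hdec
    rw [e, nm_smul, hnu]
    simp only [map_smul, LinearMap.smul_apply, smul_eq_mul, abs_mul, mul_one]
    have := hc u
    rw [hnu, one_pow, mul_one] at this
    nlinarith [abs_nonneg (b h u)]
  · have hne : b h' h' ≠ 0 := fun e => h0 (hpos _ e)
    have hβ : nm b h' ^ 2 = b h' h' := hb.nm_sq h'
    have hβ0 : nm b h' ≠ 0 := fun e => hne (by rw [← hβ, e]; norm_num)
    set w := (nm b h')⁻¹ • h' with hw
    have hw1 : b w w = 1 := by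
      simp only [hw, map_smul, LinearMap.smul_apply, smul_eq_mul, ← hβ]
      field_simp
    have huw : b u w = 0 := by
      simp only [hw, hh', map_smul, map_sub, smul_eq_mul, hu, hb.symm u h]
      ring
    have hdec' : h = b h u • u + nm b h' • w := by
      rw [hw, smul_inv_smul₀ hβ0]; exact hdec
    have hnh : nm b h = Real.sqrt (b h u ^ 2 + nm b h' ^ 2) := by
      conv_lhs => rw [hdec']
      exact hb.nm_combo hu hw1 huw _ _
    obtain ⟨φ, h1, h2⟩ := exists_polar (b h u) (nm b h')
    rw [← hnh] at h1 h2
    have e3 : φ = 3 * (φ / 3) := by ring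
    rw [e3, Real.cos_three_mul] at h1
    rw [e3, Real.sin_three_mul] at h2
    have main := hT.abs_trisect_le hb hc hu hw1 huw (Real.cos_sq_add_sin_sq (φ / 3))
    have eT : T h u u = b h u * T u u u + nm b h' * T w u u := by
      conv_lhs => rw [hdec']
      simp only [map_add, map_smul, LinearMap.add_apply, LinearMap.smul_apply, smul_eq_mul]
    rw [eT, h1, h2, mul_assoc, mul_assoc, ← mul_add, abs_mul, abs_of_nonneg (nm_nonneg h), mul_comm]
    exact mul_le_mul_of_nonneg_right main (nm_nonneg h)

/-- A bound on the diagonal of a symmetric cubic form bounds its values with one argument different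
from the other two. -/
theorem IsSymm3.abs_apply_le (hb : IsPSD b) (hpos : ∀ u, b u u = 0 → u = 0) (hT : IsSymm3 T)
    (hc : ∀ h, |T h h h| ≤ c * nm b h ^ 3) (h u : V) :
    |T h u u| ≤ c * nm b h * nm b u ^ 2 := by
  by_cases h0 : u = 0
  · subst h0; simp [nm_zero]
  · have hne : b u u ≠ 0 := fun e => h0 (hpos _ e)
    have hu2 : nm b u ^ 2 = b u u := hb.nm_sq u
    have hn0 : nm b u ≠ 0 := fun e => hne (by rw [← hu2, e]; norm_num)
    have h1 : b ((nm b u)⁻¹ • u) ((nm b u)⁻¹ • u) = 1 := by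
      simp only [map_smul, LinearMap.smul_apply, smul_eq_mul, ← hu2]
      field_simp
    have := hT.abs_apply_unit_le hb hpos hc h1 h
    have e : T h u u = nm b u ^ 2 * T h ((nm b u)⁻¹ • u) ((nm b u)⁻¹ • u) := by
      simp only [map_smul, LinearMap.smul_apply, smul_eq_mul]
      field_simp
    rw [e, abs_mul, abs_of_nonneg (sq_nonneg _), mul_comm]
    exact mul_le_mul_of_nonneg_right this (sq_nonneg _)

theorem IsSymm3.abs_sub_apply_le {T' : V →ₗ[ℝ] V →ₗ[ℝ] V →ₗ[ℝ] ℝ} (hb : IsPSD b)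
    (hpos : ∀ u, b u u = 0 → u = 0) (hT : IsSymm3 T) (hT' : IsSymm3 T')
    (hc : ∀ h, |T h h h - T' h h h| ≤ c * nm b h ^ 3) (h u : V) :
    |T h u u - T' h u u| ≤ c * nm b h * nm b u ^ 2 := by
  have hS : IsSymm3 (LinearMap.mk₂ ℝ (fun u v => T u v - T' u v)
      (fun _ _ _ => by simp; abel) (fun _ _ _ => by simp [smul_sub]) (fun _ _ _ => by simp; abel)
      (fun _ _ _ => by simp [smul_sub])) :=
    ⟨fun u v w => by simp [hT.left u v w, hT'.left u v w],
      fun u v w => by simp [hT.right u v w, hT'.right u v w]⟩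
  exact hS.abs_apply_le hb hpos hc h u

end Polarization

/-! ### Relative smoothness and strong convexity of the quartic model. -/

section Model

variable {V : Type*} [AddCommGroup V] [Module ℝ V] (b H : V →ₗ[ℝ] V →ₗ[ℝ] ℝ)
  (T : V →ₗ[ℝ] V →ₗ[ℝ] V →ₗ[ℝ] ℝ) (g : V →ₗ[ℝ] ℝ) (L : ℝ)

/-- The regularized cubic model `g h + ½ H(h,h) + (1/6) T(h,h,h) + (L/4) ‖h‖⁴`. -/
def model (h : V) : ℝ := g h + 1 / 2 * H h h + 1 / 6 * T h h h + L / 4 * b h h ^ 2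

/-- The derivative of the model at `h` in direction `z`. -/
def modelD (h z : V) : ℝ := g z + H h z + 1 / 2 * T h h z + L * b h h * b h z

/-- The derivative of the reference function `½ H(h,h) + (L/4) ‖h‖⁴`. -/
def refD (h z : V) : ℝ := H h z + L * b h h * b h z

/-- The Bregman divergence of `¼ ‖·‖⁴` from `h` to `h + z`. -/
def quartBreg (h z : V) : ℝ := 1 / 2 * b h h * b z z + 1 / 4 * (2 * b h z + b z z) ^ 2

/-- The Bregman divergence `D(u, h)` of the reference function. -/
def refBreg (u h : V) : ℝ := 1 / 2 * H (u - h) (u - h) + L * quartBreg b h (u - h)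

variable {b H T g L}

lemma modelD_add (h z w : V) :
    modelD b H T g L h (z + w) = modelD b H T g L h z + modelD b H T g L h w := by
  simp only [modelD, map_add]; ring

lemma modelD_smul (h z : V) (t : ℝ) :
    modelD b H T g L h (t • z) = t * modelD b H T g L h z := by
  simp only [modelD, map_smul, smul_eq_mul]; ring

/-- By Cauchy–Schwarz the divergence is at least `(3/2)m² + mn + n²/4` with `m = b h z`, `n = b z
z`; its minimum over `m` is at `m = -n/3`. -/
lemma quartBreg_ge (hb : IsPSD b) (h z : V) : 1 / 12 * b z z ^ 2 ≤ quartBreg b h z := by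
  have := hb.apply_sq_le h z
  rw [quartBreg]
  nlinarith [sq_nonneg (b h z + 1 / 3 * b z z), hb.nonneg z, hb.nonneg h]

lemma refBreg_ge (hb : IsPSD b) (hH : IsPSD H) (hL : 0 ≤ L) (u h : V) :
    L / 12 * nm b (u - h) ^ 4 ≤ refBreg b H L u h := by
  have h1 := quartBreg_ge hb h (u - h)
  have h2 := hH.nonneg (u - h)
  have h3 : nm b (u - h) ^ 4 = b (u - h) (u - h) ^ 2 := by
    rw [← hb.nm_sq]; ring
  rw [refBreg, h3]
  nlinarith

lemma refBreg_nonneg (hb : IsPSD b) (hH : IsPSD H) (hL : 0 ≤ L) (u h : V) :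
    0 ≤ refBreg b H L u h := by
  have := refBreg_ge hb hH hL u h
  have h2 : 0 ≤ nm b (u - h) := nm_nonneg _
  have : 0 ≤ L / 12 * nm b (u - h) ^ 4 := by positivity
  linarith

lemma model_add (hb : IsPSD b) (hH : IsPSD H) (hT : IsSymm3 T) (h z : V) :
    model b H T g L (h + z) = model b H T g L h + modelD b H T g L h z +
      refBreg b H L (h + z) h + (1 / 2 * T h z z + 1 / 6 * T z z z) := by
  have a1 : T h z h = T h h z := hT.right _ _ _
  have a2 : T z h h = T h h z := by rw [hT.left, a1]
  have a3 : T z h z = T h z z := hT.left _ _ _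
  have a4 : T z z h = T h z z := by rw [hT.right, a3]
  simp only [model, modelD, refBreg, quartBreg, add_sub_cancel_left, map_add, LinearMap.add_apply,
    hb.symm z h, hH.symm z h, a1, a2, a3, a4]
  ring

/-- The compatibility of cubic and quadratic terms that convexity forces. -/
def CubicBound (b H : V →ₗ[ℝ] V →ₗ[ℝ] ℝ) (T : V →ₗ[ℝ] V →ₗ[ℝ] V →ₗ[ℝ] ℝ) (L : ℝ) : Prop :=
  ∀ u z, |T u z z| ≤ Real.sqrt 2 / 2 * (H z z + L * b u u * b z z)

/-- Both cubic remainder terms merge into `½ T(h + z/3, z, z)`. The quartic divergence dominates the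
quartic part of the resulting bound with no loss, so the constant `√2/2` survives. -/
lemma CubicBound.abs_remainder_le (hb : IsPSD b) (hc : CubicBound b H T L) (hL : 0 ≤ L) (h z : V) :
    |1 / 2 * T h z z + 1 / 6 * T z z z| ≤ Real.sqrt 2 / 2 * refBreg b H L (h + z) h := by
  have e : 1 / 2 * T h z z + 1 / 6 * T z z z = 1 / 2 * T (h + (1 / 3 : ℝ) • z) z z := by
    simp only [map_add, map_smul, LinearMap.add_apply, LinearMap.smul_apply, smul_eq_mul]; ring
  have h1 := hc (h + (1 / 3 : ℝ) • z) z
  have h2 : 1 / 2 * (b (h + (1 / 3 : ℝ) • z) (h + (1 / 3 : ℝ) • z) * b z z) ≤ quartBreg b h z := by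
    simp only [quartBreg, map_add, map_smul, LinearMap.add_apply, LinearMap.smul_apply, smul_eq_mul,
      hb.symm z h]
    nlinarith [sq_nonneg (b h z + 1 / 3 * b z z), hb.nonneg z, sq_nonneg (b z z)]
  rw [e, abs_mul, abs_of_pos (by norm_num : (0 : ℝ) < 1 / 2), refBreg, add_sub_cancel_left]
  have h3 : 0 ≤ Real.sqrt 2 / 2 := by positivity
  have h4 := mul_le_mul_of_nonneg_left (mul_le_mul_of_nonneg_left h2 hL) h3
  nlinarith

lemma model_le (hb : IsPSD b) (hH : IsPSD H) (hT : IsSymm3 T) (hc : CubicBound b H T L)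
    (hL : 0 ≤ L) (u h : V) :
    model b H T g L u ≤ model b H T g L h + modelD b H T g L h (u - h) +
      (1 + Real.sqrt 2 / 2) * refBreg b H L u h := by
  have h1 := model_add (g := g) (L := L) hb hH hT h (u - h)
  have h2 := (abs_le.1 (hc.abs_remainder_le hb hL h (u - h))).2
  rw [add_sub_cancel] at h1 h2
  linarith

lemma model_ge (hb : IsPSD b) (hH : IsPSD H) (hT : IsSymm3 T) (hc : CubicBound b H T L)
    (hL : 0 ≤ L) (u h : V) :
    model b H T g L h + modelD b H T g L h (u - h) +
      (1 - Real.sqrt 2 / 2) * refBreg b H L u h ≤ model b H T g L u := by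
  have h1 := model_add (g := g) (L := L) hb hH hT h (u - h)
  have h2 := (abs_le.1 (hc.abs_remainder_le hb hL h (u - h))).1
  rw [add_sub_cancel] at h1 h2
  linarith

lemma sqrt_two_half_lt : Real.sqrt 2 / 2 < 0.7072 := by
  have : Real.sqrt 2 < 1.4144 := by
    rw [Real.sqrt_lt' (by norm_num)]; norm_num
  linarith

/-- The derivative of the model is uniformly monotone. -/
lemma modelD_monotone (hb : IsPSD b) (hH : IsPSD H) (hT : IsSymm3 T) (hc : CubicBound b H T L)
    (hL : 0 ≤ L) (u h : V) :
    L / 24 * nm b (u - h) ^ 4 ≤ modelD b H T g L u (u - h) - modelD b H T g L h (u - h) := by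
  have h1 := model_ge (g := g) hb hH hT hc hL u h
  have h2 := model_ge (g := g) hb hH hT hc hL h u
  have e : modelD b H T g L u (h - u) = - modelD b H T g L u (u - h) := by
    rw [← neg_sub u h, ← neg_one_smul ℝ, modelD_smul]; ring
  have h3 := refBreg_ge hb hH hL u h
  have h4 := refBreg_ge hb hH hL h u
  rw [nm_sub_comm h u] at h4
  have h5 := sqrt_two_half_lt
  have h6 : 0 ≤ nm b (u - h) := nm_nonneg _
  have h7 : 0 ≤ L / 12 * nm b (u - h) ^ 4 := by positivity
  rw [e] at h2
  nlinarith

/-- One inexact relative gradient step contracts the Bregman distance to a critical point. -/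
lemma refBreg_step_le (hb : IsPSD b) (hH : IsPSD H) (hT : IsSymm3 T) (hc : CubicBound b H T L)
    (hL : 0 ≤ L) {hs h h' : V} {e : ℝ} (hcrit : ∀ z, modelD b H T g L hs z = 0)
    (hstep : ∀ z, |refD b H L h' z - refD b H L h z +
      (1 + Real.sqrt 2 / 2)⁻¹ * modelD b H T g L h z| ≤ e * nm b z) :
    refBreg b H L hs h' ≤ 0.83 * refBreg b H L hs h + e * nm b (h' - hs) := by
  have h1 := model_le (g := g) hb hH hT hc hL h' h
  have h2 := model_ge (g := g) hb hH hT hc hL hs h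
  have h3 := model_ge (g := g) hb hH hT hc hL h' hs
  rw [hcrit, add_zero] at h3
  have hr : 0 ≤ Real.sqrt 2 / 2 := by positivity
  have hr2 := sqrt_two_half_lt
  generalize Real.sqrt 2 / 2 = r at *
  have hκ : 0 < 1 + r := by linarith
  have n0 := refBreg_nonneg hb hH hL h' hs
  have n1 := refBreg_nonneg hb hH hL hs h
  have e1 : modelD b H T g L h (h' - h) =
      modelD b H T g L h (hs - h) + modelD b H T g L h (h' - hs) := by
    rw [← modelD_add]; congr 1; abel
  -- The three-point identity for Bregman divergences. With `r = √2/2` the two-sided model bounds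
  -- then leave the factor `2r/(1 + r) < 0.83`.
  have three : refBreg b H L hs h - refBreg b H L hs h' - refBreg b H L h' h =
      refD b H L h' (hs - h') - refD b H L h (hs - h') := by
    simp only [refBreg, refD, quartBreg, map_sub, LinearMap.sub_apply, hb.symm h h', hb.symm h hs,
      hb.symm h' hs, hH.symm h h', hH.symm h hs, hH.symm h' hs]
    ring
  have e2 := (abs_le.1 (hstep (hs - h'))).1
  have e3 : modelD b H T g L h (hs - h') = - modelD b H T g L h (h' - hs) := by
    rw [← neg_sub h' hs, ← neg_one_smul ℝ, modelD_smul]; ring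
  rw [e3, nm_sub_comm hs h'] at e2
  have e4 : (1 + r) * ((1 + r)⁻¹ * modelD b H T g L h (h' - hs)) = modelD b H T g L h (h' - hs) := by
    field_simp
  have e5 : 0 ≤ (1 - r) * refBreg b H L h' hs := mul_nonneg (by linarith) n0
  have key : (1 + r) * refBreg b H L hs h' ≤ (1 + r) * (0.83 * refBreg b H L hs h +
      e * nm b (h' - hs)) := by
    nlinarith
  exact le_of_mul_le_mul_left key hκ

end Model

/-! ### Error of the one-dimensional dual search. -/

section DualSearch

variable {V : Type*} [AddCommGroup V] [Module ℝ V] {b H : V →ₗ[ℝ] V →ₗ[ℝ] ℝ} {L : ℝ} {β : V → ℝ}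

/-- `μ ↦ μ ‖h(μ)‖` is monotone along solutions of `(H + μ b) h = -β`. -/
lemma resolvent_mul_nm_le (hb : IsPSD b) (hH : IsPSD H) {lo hi : ℝ} (h0 : 0 < lo) (hle : lo ≤ hi)
    {u v : V} (hu : ∀ z, H u z + lo * b u z = β z) (hv : ∀ z, H v z + hi * b v z = β z) :
    lo * nm b u ≤ hi * nm b v := by
  have e1 := hu (v - u)
  have e2 := hv (v - u)
  have e3 := hH.nonneg (v - u)
  have e4 := (abs_le.1 (hb.abs_apply_le u v)).2
  have e5 := hb.nm_sq u
  have e6 := hb.nm_sq v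
  simp only [map_sub, LinearMap.sub_apply, hb.symm v u, hH.symm v u] at e1 e2 e3
  have nu : 0 ≤ nm b u := nm_nonneg u
  have nv : 0 ≤ nm b v := nm_nonneg v
  by_contra! hlt
  have k1 : hi * nm b v ^ 2 + lo * nm b u ^ 2 ≤ (lo + hi) * (nm b u * nm b v) := by
    rw [e5, e6]; nlinarith
  have k2 : (hi * nm b v - lo * nm b u) * (nm b v - nm b u) ≤ 0 := by nlinarith
  have k3 : nm b v < nm b u := by
    have : lo * nm b v ≤ hi * nm b v := mul_le_mul_of_nonneg_right hle nv
    by_contra! h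
    have := mul_le_mul_of_nonneg_left h h0.le
    linarith
  nlinarith [mul_pos (sub_pos.2 hlt) (sub_pos.2 k3)]

/-- Monotonicity of `μ‖h(μ)‖` gives `lo³ ≤ lo² L‖u‖² ≤ hi² L‖v‖²`, so the residual times `hi²` is at
most `hi³ - lo³ ≤ 3 hi² (hi - lo)`. No lower bound on `H` enters. -/
lemma resolvent_residual (hb : IsPSD b) (hH : IsPSD H) (hL : 0 ≤ L) {lo hi : ℝ} (h0 : 0 ≤ lo)
    (hle : lo ≤ hi) (hhi : 0 < hi) {u v : V} (hu : 0 < lo → ∀ z, H u z + lo * b u z = β z)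
    (hv : ∀ z, H v z + hi * b v z = β z) (hlo : lo ≤ L * b u u) :
    hi - L * b v v ≤ 3 * (hi - lo) := by
  rcases h0.eq_or_lt with rfl | h0
  · have := mul_nonneg hL (hb.nonneg v); linarith
  · have h1 := resolvent_mul_nm_le hb hH h0 hle (hu h0) hv
    have nu : 0 ≤ nm b u := nm_nonneg u
    have h2 : lo ^ 2 * b u u ≤ hi ^ 2 * b v v := by
      rw [← hb.nm_sq, ← hb.nm_sq, ← mul_pow, ← mul_pow]
      exact pow_le_pow_left₀ (by positivity) h1 2
    have h3 : lo ^ 3 ≤ hi ^ 2 * (L * b v v) := by nlinarith [sq_nonneg lo]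
    have h4 : hi ^ 2 * (hi - L * b v v) ≤ hi ^ 2 * (3 * (hi - lo)) := by
      nlinarith [mul_nonneg (sub_nonneg.2 hle) (sq_nonneg (hi - lo)), mul_nonneg h0.le (sq_nonneg (hi - lo))]
    exact le_of_mul_le_mul_left h4 (by positivity)

end DualSearch

/-! ### Matrices as bilinear forms, and solver calls as Riesz representatives. -/

section MatrixForms

variable {d : ℕ}

/-- The bilinear form of a matrix. -/
def form (B : Matrix (Fin d) (Fin d) ℝ) : (Fin d → ℝ) →ₗ[ℝ] (Fin d → ℝ) →ₗ[ℝ] ℝ :=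
  Matrix.toLinearMap₂' ℝ B

lemma form_apply (B : Matrix (Fin d) (Fin d) ℝ) (u v : Fin d → ℝ) :
    form B u v = u ⬝ᵥ (B *ᵥ v) := Matrix.toLinearMap₂'_apply' _ _ _

lemma bNorm_eq_nm (B : Matrix (Fin d) (Fin d) ℝ) (u : Fin d → ℝ) : bNorm B u = nm (form B) u := by
  rw [bNorm, nm, form_apply]

lemma isPSD_form {B : Matrix (Fin d) (Fin d) ℝ} (hB : B.PosSemidef) : IsPSD (form B) where
  symm u v := by
    have h : Bᵀ = B := by
      have := hB.isHermitian
      rwa [Matrix.IsHermitian, Matrix.conjTranspose_eq_transpose_of_trivial] at this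
    rw [form_apply, form_apply, Matrix.dotProduct_mulVec, ← Matrix.mulVec_transpose, h,
      dotProduct_comm]
  nonneg u := by
    have := hB.dotProduct_mulVec_nonneg u
    rwa [star_trivial, ← form_apply] at this

lemma form_definite {B : Matrix (Fin d) (Fin d) ℝ} (hB : B.PosDef) (u : Fin d → ℝ)
    (h : form B u u = 0) : u = 0 := by
  by_contra h0
  have := hB.dotProduct_mulVec_pos h0
  rw [star_trivial, ← form_apply, h] at this
  exact lt_irrefl _ this

/-- The defining equation of a solver call. -/
lemma form_callSolve {A : Matrix (Fin d) (Fin d) ℝ} (hA : A.PosDef) (c z : Fin d → ℝ) :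
    form A (callSolve A c).val z = c ⬝ᵥ z := by
  have hu : IsUnit A.det := (Matrix.isUnit_iff_isUnit_det _).1 hA.isUnit
  rw [(isPSD_form hA.posSemidef).symm, form_apply, callSolve, Matrix.mulVec_mulVec,
    Matrix.mul_nonsing_inv _ hu, Matrix.one_mulVec, dotProduct_comm]

lemma callSolve_zero (A : Matrix (Fin d) (Fin d) ℝ) : (callSolve A 0).val = 0 := by
  simp [callSolve]

lemma abs_dot_le {B : Matrix (Fin d) (Fin d) ℝ} (hB : B.PosDef) (c z : Fin d → ℝ) :
    |c ⬝ᵥ z| ≤ nm (form B) (callSolve B c).val * nm (form B) z := by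
  rw [← form_callSolve hB]
  exact (isPSD_form hB.posSemidef).abs_apply_le _ _

/-- A bound on a functional bounds its Riesz representative. -/
lemma nm_callSolve_le {B : Matrix (Fin d) (Fin d) ℝ} (hB : B.PosDef) {c : Fin d → ℝ} {C : ℝ}
    (hC : 0 ≤ C) (h : ∀ z, |c ⬝ᵥ z| ≤ C * nm (form B) z) :
    nm (form B) (callSolve B c).val ≤ C := by
  have h1 := h (callSolve B c).val
  rw [← form_callSolve hB, ← (isPSD_form hB.posSemidef).nm_sq, abs_of_nonneg (sq_nonneg _)] at h1
  have h2 : 0 ≤ nm (form B) (callSolve B c).val := nm_nonneg _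
  rcases h2.eq_or_lt with h2 | h2
  · rw [← h2]; exact hC
  · nlinarith

lemma posDef_add_smul {A B : Matrix (Fin d) (Fin d) ℝ} (hA : A.PosSemidef) (hB : B.PosDef) {μ : ℝ}
    (hμ : 0 < μ) : (A + μ • B).PosDef := Matrix.PosDef.posSemidef_add hA (hB.smul hμ)

lemma form_add_smul (A B : Matrix (Fin d) (Fin d) ℝ) (μ : ℝ) (u v : Fin d → ℝ) :
    form (A + μ • B) u v = form A u v + μ * form B u v := by
  simp [form]

end MatrixForms

/-! ### Values and call counts of composed computations. -/

section Counted

variable {α β : Type}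

lemma bind_val (m : Counted α) (k : α → Counted β) : (m >>= k).val = (k m.val).val := rfl

lemma bind_gradCalls (m : Counted α) (k : α → Counted β) :
    (m >>= k).gradCalls = m.gradCalls + (k m.val).gradCalls := rfl

lemma bind_solveCalls (m : Counted α) (k : α → Counted β) :
    (m >>= k).solveCalls = m.solveCalls + (k m.val).solveCalls := rfl

lemma pure_val (a : α) : (pure a : Counted α).val = a := rfl

/-- The total number of calls. -/
def Counted.total (m : Counted α) : ℕ := m.gradCalls + m.solveCalls

lemma bind_total (m : Counted α) (k : α → Counted β) :
    (m >>= k).total = m.total + (k m.val).total := by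
  simp only [Counted.total, bind_gradCalls, bind_solveCalls]; ring

lemma pure_total (a : α) : (pure a : Counted α).total = 0 := rfl

end Counted

/-! ### The inner quartic subproblem solved by bisection. -/

section QuarticStep

variable {d : ℕ} {q : Problem d} {p : Init} {y c : Fin d → ℝ}

/-- The bisection keeps `μ ≤ L‖s(μ)‖²` at the lower end and the reverse at the upper end. The lower
condition is guarded by positivity because at `0` the matrix may be singular. -/
lemma dualSearch_spec (hL : 0 < q.L) (n : ℕ) : ∀ lo hi : ℝ, 0 ≤ lo → lo ≤ hi → 0 < hi →
    (0 < lo → lo ≤ q.L * nm (form q.B) (callSolve (hess q.f y + lo • q.B) c).val ^ 2) →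
    q.L * nm (form q.B) (callSolve (hess q.f y + hi • q.B) c).val ^ 2 ≤ hi →
    ∃ lo', 0 ≤ lo' ∧ lo' ≤ (dualSearch q y c n lo hi).val ∧ 0 < (dualSearch q y c n lo hi).val ∧
      (dualSearch q y c n lo hi).val ≤ hi ∧
      (0 < lo' → lo' ≤ q.L * nm (form q.B) (callSolve (hess q.f y + lo' • q.B) c).val ^ 2) ∧
      q.L * nm (form q.B) (callSolve (hess q.f y + (dualSearch q y c n lo hi).val • q.B) c).val ^ 2
        ≤ (dualSearch q y c n lo hi).val ∧
      (dualSearch q y c n lo hi).val - lo' = (hi - lo) / 2 ^ n := by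
  induction n with
  | zero =>
    intro lo hi h0 h1 h2 h3 h4
    exact ⟨lo, h0, h1, h2, le_refl _, h3, h4, by simp [dualSearch, pure_val]⟩
  | succ n ih =>
    intro lo hi h0 h1 h2 h3 h4
    have hμ : 0 < (lo + hi) / 2 := by linarith
    rw [dualSearch, bind_val]
    split_ifs with hc
    · have h5 : q.L * nm (form q.B) (callSolve (hess q.f y + ((lo + hi) / 2) • q.B) c).val ^ 2 ≤
          (lo + hi) / 2 := by
        rw [bNorm_eq_nm, sub_nonneg, le_div_iff₀ hL] at hc
        linarith
      obtain ⟨lo', a1, a2, a3, a4, a5, a6, a7⟩ := ih lo ((lo + hi) / 2) h0 (by linarith) hμ h3 h5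
      exact ⟨lo', a1, a2, a3, by linarith, a5, a6, by rw [a7]; field_simp; ring⟩
    · have h5 : (lo + hi) / 2 ≤
          q.L * nm (form q.B) (callSolve (hess q.f y + ((lo + hi) / 2) • q.B) c).val ^ 2 := by
        rw [bNorm_eq_nm, sub_nonneg, le_div_iff₀ hL, not_le] at hc
        linarith
      obtain ⟨lo', a1, a2, a3, a4, a5, a6, a7⟩ :=
        ih ((lo + hi) / 2) hi hμ.le (by linarith) h2 (fun _ => h5) h4
      exact ⟨lo', a1, a2, a3, a4, a5, a6, by rw [a7]; field_simp; ring⟩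

/-- The norm of a resolvent. -/
lemma mul_nm_resolvent_le (hB : q.B.PosDef) (hH : (hess q.f y).PosSemidef) {μ : ℝ} (hμ : 0 < μ) :
    μ * nm (form q.B) (callSolve (hess q.f y + μ • q.B) c).val ≤
      nm (form q.B) (callSolve q.B c).val := by
  set s := (callSolve (hess q.f y + μ • q.B) c).val
  have h1 := form_callSolve (posDef_add_smul hH hB hμ) c s
  rw [form_add_smul, ← (isPSD_form hB.posSemidef).nm_sq] at h1
  have h2 := (abs_le.1 (abs_dot_le hB c s)).2
  have h3 := (isPSD_form hH).nonneg s
  have h4 : 0 ≤ nm (form q.B) s := nm_nonneg _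
  rcases h4.eq_or_lt with h4 | h4
  · rw [← h4, mul_zero]; exact nm_nonneg _
  · nlinarith

lemma quarticStep_spec (hB : q.B.PosDef) (hH : (hess q.f y).PosSemidef) (hL : 0 < q.L) {N : ℝ}
    (hN : nm (form q.B) (callSolve q.B c).val ≤ N) :
    q.L * nm (form q.B) (quarticStep q p y c).val ^ 2 ≤ (q.L * N ^ 2) ^ (1 / 3 : ℝ) ∧
    ∀ z, |refD (form q.B) (form (hess q.f y)) q.L (quarticStep q p y c).val z + c ⬝ᵥ z| ≤
      3 * ((q.L * N ^ 2) ^ (1 / 3 : ℝ) / 2 ^ p.J) * nm (form q.B) (quarticStep q p y c).val *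
        nm (form q.B) z := by
  have hb := isPSD_form hB.posSemidef
  have hH' := isPSD_form hH
  have hN0 : 0 ≤ nm (form q.B) (callSolve q.B c).val := nm_nonneg _
  have hhi0 : 0 ≤ (q.L * N ^ 2) ^ (1 / 3 : ℝ) := Real.rpow_nonneg (by positivity) _
  have hv : ∃ μ : ℝ, μ = (dualSearch q y c p.J 0
      ((q.L * (c ⬝ᵥ (callSolve q.B c).val)) ^ (1 / 3 : ℝ))).val ∧ (quarticStep q p y c).val =
      -(callSolve (hess q.f y + μ • q.B) c).val := ⟨_, rfl, rfl⟩
  obtain ⟨μ, hμ, hval⟩ := hv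
  rw [← form_callSolve hB, ← hb.nm_sq] at hμ
  rw [hval, nm_neg]
  -- For `c = 0` the initial interval is `[0, 0]` and positivity of `μ` is lost, but every solver
  -- call returns `0`.
  by_cases hc : nm (form q.B) (callSolve q.B c).val = 0
  · have hc0 : c = 0 := by
      have h1 : (callSolve q.B c).val = 0 := by
        apply form_definite hB; rw [← hb.nm_sq, hc]; norm_num
      ext i
      have h2 := form_callSolve hB c (Pi.single i 1)
      rw [h1] at h2
      simpa using h2.symm
    subst hc0
    rw [callSolve_zero]
    constructor
    · simpa [nm_zero] using hhi0
    · intro z; simp [nm_zero, refD]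
  · have hc' : 0 < nm (form q.B) (callSolve q.B c).val := lt_of_le_of_ne hN0 (Ne.symm hc)
    set n0 := nm (form q.B) (callSolve q.B c).val with hn0
    set hi := (q.L * n0 ^ 2) ^ (1 / 3 : ℝ) with hhi
    have hpos : 0 < q.L * n0 ^ 2 := by positivity
    have hhipos : 0 < hi := Real.rpow_pos_of_pos hpos _
    have hcube : hi ^ 3 = q.L * n0 ^ 2 := by
      rw [hhi, ← Real.rpow_natCast, ← Real.rpow_mul hpos.le]; norm_num
    have hle : hi ≤ (q.L * N ^ 2) ^ (1 / 3 : ℝ) := by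
      apply Real.rpow_le_rpow hpos.le _ (by norm_num)
      have : n0 ^ 2 ≤ N ^ 2 := pow_le_pow_left₀ hN0 hN 2
      nlinarith
    -- The starting upper end satisfies `hi³ = L n0²`, which together with `hi ‖s(hi)‖ ≤ n0` gives
    -- the upper invariant.
    have hstart : q.L * nm (form q.B) (callSolve (hess q.f y + hi • q.B) c).val ^ 2 ≤ hi := by
      have h1 := mul_nm_resolvent_le (c := c) hB hH hhipos
      rw [← hn0] at h1
      have h2 : (hi * nm (form q.B) (callSolve (hess q.f y + hi • q.B) c).val) ^ 2 ≤ n0 ^ 2 :=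
        pow_le_pow_left₀ (mul_nonneg hhipos.le (nm_nonneg _)) h1 2
      have h3 : hi ^ 2 * (q.L * nm (form q.B) (callSolve (hess q.f y + hi • q.B) c).val ^ 2) ≤
          hi ^ 2 * hi := by nlinarith
      exact le_of_mul_le_mul_left h3 (by positivity)
    obtain ⟨lo', a1, a2, a3, a4, a5, a6, a7⟩ :=
      dualSearch_spec (y := y) (c := c) hL p.J 0 hi le_rfl hhipos.le hhipos
        (fun h => absurd h (lt_irrefl _)) hstart
    rw [← hμ] at a2 a3 a4 a6 a7
    set s := (callSolve (hess q.f y + μ • q.B) c).val with hs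
    have hse : ∀ z, form (hess q.f y) s z + μ * form q.B s z = c ⬝ᵥ z := fun z => by
      rw [← form_add_smul, hs, form_callSolve (posDef_add_smul hH hB a3)]
    have hres : μ - q.L * nm (form q.B) s ^ 2 ≤ 3 * (μ - lo') := by
      rw [hb.nm_sq]
      refine resolvent_residual (β := fun z => c ⬝ᵥ z) hb hH' hL.le a1 a2 a3
        (u := (callSolve (hess q.f y + lo' • q.B) c).val) ?_ hse ?_
      · intro h z
        rw [← form_add_smul, form_callSolve (posDef_add_smul hH hB h)]
      · rcases a1.eq_or_lt with h | h
        · rw [← h]; exact mul_nonneg hL.le (hb.nonneg _)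
        · rw [← hb.nm_sq]; exact a5 h
    rw [sub_zero] at a7
    have hfac : μ - q.L * nm (form q.B) s ^ 2 ≤ 3 * ((q.L * N ^ 2) ^ (1 / 3 : ℝ) / 2 ^ p.J) := by
      rw [a7] at hres
      refine hres.trans ?_
      gcongr
    refine ⟨by linarith, fun z => ?_⟩
    -- The step solves the system with `μ` in place of `L‖s‖²`, so its defect is exactly the scalar
    -- residual times `B s`.
    have e : refD (form q.B) (form (hess q.f y)) q.L (-s) z + c ⬝ᵥ z =
        (μ - q.L * nm (form q.B) s ^ 2) * form q.B s z := by
      rw [← hse, hb.nm_sq]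
      simp only [refD, map_neg, LinearMap.neg_apply, neg_neg]
      ring
    rw [e, abs_mul, abs_of_nonneg (by linarith : 0 ≤ μ - q.L * nm (form q.B) s ^ 2), mul_assoc]
    have h5 := hb.abs_apply_le s z
    have h6 : 0 ≤ nm (form q.B) s * nm (form q.B) z := mul_nonneg (nm_nonneg _) (nm_nonneg _)
    calc _ ≤ (μ - q.L * nm (form q.B) s ^ 2) * (nm (form q.B) s * nm (form q.B) z) :=
          mul_le_mul_of_nonneg_left h5 (by linarith)
      _ ≤ _ := mul_le_mul_of_nonneg_right hfac h6

end QuarticStep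

/-! ### One-variable Taylor estimates. -/

section Taylor

/-- First-order Taylor estimate from a Lipschitz derivative. -/
lemma abs_taylor_one_le {s s' : ℝ → ℝ} {K : ℝ} (hs : ∀ t, HasDerivAt s (s' t) t)
    (hK : ∀ t, 0 ≤ t → |s' t - s' 0| ≤ K * t) {t : ℝ} (ht : 0 ≤ t) :
    |s t - s 0 - s' 0 * t| ≤ K * t ^ 2 / 2 := by
  have h1 : ∀ x, HasDerivAt (fun t => s t - s 0 - s' 0 * t) (s' x - s' 0) x := fun x => by
    exact (((hs x).sub_const (s 0)).fun_sub ((hasDerivAt_id' x).const_mul (s' 0))).congr_deriv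
      (by ring)
  have h2 : ∀ x, HasDerivAt (fun t => K * t ^ 2 / 2) (K * x) x := fun x => by
    exact (((hasDerivAt_pow 2 x).const_mul K).div_const 2).congr_deriv (by norm_num; ring)
  have := image_norm_le_of_norm_deriv_right_le_deriv_boundary' (a := 0) (b := t)
    (fun x _ => (h1 x).continuousAt.continuousWithinAt) (fun x _ => (h1 x).hasDerivWithinAt)
    (B := fun t => K * t ^ 2 / 2) (B' := fun t => K * t) (by simp)
    (fun x _ => (h2 x).continuousAt.continuousWithinAt) (fun x _ => (h2 x).hasDerivWithinAt)
    (fun x hx => hK x hx.1) (right_mem_Icc.2 ht)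
  simpa using this

/-- Second-order Taylor estimate from a Lipschitz second derivative. -/
lemma abs_taylor_two_le {s s' s'' : ℝ → ℝ} {K : ℝ} (hs : ∀ t, HasDerivAt s (s' t) t)
    (hs' : ∀ t, HasDerivAt s' (s'' t) t) (hK : ∀ t, 0 ≤ t → |s'' t - s'' 0| ≤ K * t) :
    |s 1 - s 0 - s' 0 - s'' 0 / 2| ≤ K / 6 := by
  have h1 : ∀ x, HasDerivAt (fun t => s t - s 0 - s' 0 * t - s'' 0 * t ^ 2 / 2)
      (s' x - s' 0 - s'' 0 * x) x := fun x => by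
    exact ((((hs x).sub_const (s 0)).fun_sub ((hasDerivAt_id' x).const_mul (s' 0))).fun_sub
      (((hasDerivAt_pow 2 x).const_mul (s'' 0)).div_const 2)).congr_deriv (by norm_num; ring)
  have h2 : ∀ x, HasDerivAt (fun t => K * t ^ 3 / 6) (K * x ^ 2 / 2) x := fun x => by
    exact (((hasDerivAt_pow 3 x).const_mul K).div_const 6).congr_deriv (by norm_num; ring)
  have := image_norm_le_of_norm_deriv_right_le_deriv_boundary' (a := 0) (b := 1)
    (fun x _ => (h1 x).continuousAt.continuousWithinAt) (fun x _ => (h1 x).hasDerivWithinAt)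
    (B := fun t => K * t ^ 3 / 6) (B' := fun t => K * t ^ 2 / 2) (by simp)
    (fun x _ => (h2 x).continuousAt.continuousWithinAt) (fun x _ => (h2 x).hasDerivWithinAt)
    (fun x hx => abs_taylor_one_le hs' hK hx.1) (right_mem_Icc.2 zero_le_one)
  simpa using this

end Taylor

/-! ### Coordinate derivatives as multilinear forms; consequences of convexity. -/

section Derivatives

variable {d : ℕ} {f : (Fin d → ℝ) → ℝ}

/-- The derivative as a linear form. -/
def der1 (f : (Fin d → ℝ) → ℝ) (y : Fin d → ℝ) : (Fin d → ℝ) →ₗ[ℝ] ℝ := (fderiv ℝ f y).toLinearMap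

/-- The third derivative as a trilinear form. -/
def der3 (f : (Fin d → ℝ) → ℝ) (y : Fin d → ℝ) :
    (Fin d → ℝ) →ₗ[ℝ] (Fin d → ℝ) →ₗ[ℝ] (Fin d → ℝ) →ₗ[ℝ] ℝ :=
  LinearMap.mk₂ ℝ (fun u v => (fderiv ℝ (fderiv ℝ (fderiv ℝ f)) y u v).toLinearMap)
    (fun _ _ _ => by ext; simp) (fun _ _ _ => by ext; simp) (fun _ _ _ => by ext; simp)
    (fun _ _ _ => by ext; simp)

lemma der3_apply (y u v w : Fin d → ℝ) :
    der3 f y u v w = fderiv ℝ (fderiv ℝ (fderiv ℝ f)) y u v w := rfl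

lemma linear_apply_eq_sum (φ : (Fin d → ℝ) →ₗ[ℝ] ℝ) (x : Fin d → ℝ) :
    φ x = ∑ i, x i * φ (Pi.single i 1) := by
  conv_lhs => rw [pi_eq_sum_univ' x, map_sum]
  refine Finset.sum_congr rfl fun i _ => ?_
  rw [map_smul, smul_eq_mul]

lemma grad_dot (y z : Fin d → ℝ) : grad f y ⬝ᵥ z = der1 f y z := by
  rw [linear_apply_eq_sum, dotProduct]
  exact Finset.sum_congr rfl fun i _ => mul_comm _ _

lemma form_hess (y u v : Fin d → ℝ) :
    form (hess f y) u v = fderiv ℝ (fderiv ℝ f) y u v := by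
  rw [form, Matrix.toLinearMap₂'_apply]
  have h1 : fderiv ℝ (fderiv ℝ f) y u v =
      ∑ i, u i * fderiv ℝ (fderiv ℝ f) y (Pi.single i 1) v := by
    have := linear_apply_eq_sum
      ((ContinuousLinearMap.apply ℝ ℝ v).toLinearMap ∘ₗ (fderiv ℝ (fderiv ℝ f) y).toLinearMap) u
    simpa using this
  rw [h1]
  refine Finset.sum_congr rfl fun i _ => ?_
  have h2 := linear_apply_eq_sum (fderiv ℝ (fderiv ℝ f) y (Pi.single i 1)).toLinearMap v
  rw [ContinuousLinearMap.coe_coe] at h2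
  rw [h2, Finset.mul_sum]
  refine Finset.sum_congr rfl fun j _ => ?_
  simp [hess, iteratedFDeriv_two_apply]

lemma iteratedFDeriv_three_apply (y u v w : Fin d → ℝ) :
    iteratedFDeriv ℝ 3 f y ![u, v, w] = der3 f y u v w := by
  rw [iteratedFDeriv_succ_apply_right, iteratedFDeriv_two_apply]
  rfl

lemma third_dot (y h z : Fin d → ℝ) : third f y h ⬝ᵥ z = der3 f y z h h := by
  have := linear_apply_eq_sum (((der3 f y).flip h).flip h) z
  simp only [LinearMap.flip_apply] at this
  rw [this, dotProduct]
  refine Finset.sum_congr rfl fun i _ => ?_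
  rw [mul_comm, third, iteratedFDeriv_three_apply]

variable (hf : ContDiff ℝ 3 f)
include hf

lemma contDiff_fderiv : ContDiff ℝ 2 (fderiv ℝ f) := hf.fderiv_right (by norm_num)

lemma contDiff_fderiv_fderiv : ContDiff ℝ 1 (fderiv ℝ (fderiv ℝ f)) :=
  (contDiff_fderiv hf).fderiv_right (by norm_num)

lemma hasDerivAt_line_zero (y h : Fin d → ℝ) (t : ℝ) :
    HasDerivAt (fun t : ℝ => f (y + t • h)) (der1 f (y + t • h) h) t := by
  have h0 : HasDerivAt (fun t : ℝ => y + t • h) h t := by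
    simpa using ((hasDerivAt_id t).smul_const h).const_add y
  exact ((hf.differentiable (by norm_num)) (y + t • h)).hasFDerivAt.comp_hasDerivAt t h0

lemma hasDerivAt_line_one (y h u : Fin d → ℝ) (t : ℝ) :
    HasDerivAt (fun t : ℝ => der1 f (y + t • h) u) (form (hess f (y + t • h)) h u) t := by
  have h0 : HasDerivAt (fun t : ℝ => y + t • h) h t := by
    simpa using ((hasDerivAt_id t).smul_const h).const_add y
  have h1 := (((contDiff_fderiv hf).differentiable (by norm_num))
    (y + t • h)).hasFDerivAt.comp_hasDerivAt t h0
  rw [form_hess]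
  exact ((ContinuousLinearMap.apply ℝ ℝ u).hasFDerivAt).comp_hasDerivAt t h1

lemma hasDerivAt_line_two (y h u v : Fin d → ℝ) (t : ℝ) :
    HasDerivAt (fun t : ℝ => form (hess f (y + t • h)) u v) (der3 f (y + t • h) h u v) t := by
  have h0 : HasDerivAt (fun t : ℝ => y + t • h) h t := by
    simpa using ((hasDerivAt_id t).smul_const h).const_add y
  have h1 := (((contDiff_fderiv_fderiv hf).differentiable (by norm_num))
    (y + t • h)).hasFDerivAt.comp_hasDerivAt t h0
  have h2 := ((ContinuousLinearMap.apply ℝ ((Fin d → ℝ) →L[ℝ] ℝ) u).hasFDerivAt).comp_hasDerivAt t h1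
  have h3 := ((ContinuousLinearMap.apply ℝ ℝ v).hasFDerivAt).comp_hasDerivAt t h2
  rw [der3_apply]
  refine h3.congr_of_eventuallyEq (Filter.Eventually.of_forall fun s => ?_)
  exact form_hess _ _ _

lemma form_hess_symm (y u v : Fin d → ℝ) : form (hess f y) u v = form (hess f y) v u := by
  rw [form_hess, form_hess]
  exact (hf.contDiffAt.isSymmSndFDerivAt (by
    rw [minSmoothness_of_isRCLikeNormedField]; norm_num)) u v

lemma isSymm3_der3 (y : Fin d → ℝ) : IsSymm3 (der3 f y) where
  left u v w := by
    have := ((contDiff_fderiv hf).contDiffAt (x := y)).isSymmSndFDerivAt (by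
      rw [minSmoothness_of_isRCLikeNormedField]) u v
    rw [der3_apply, der3_apply, this]
  right u v w := by
    have h1 := hasDerivAt_line_two hf y u v w 0
    have h2 := hasDerivAt_line_two hf y u w v 0
    simp only [zero_smul, add_zero] at h1 h2
    refine h1.unique (h2.congr_of_eventuallyEq (Filter.Eventually.of_forall fun t => ?_))
    exact form_hess_symm hf _ _ _

omit hf in
lemma convexOn_line (hc : ConvexOn ℝ univ f) (y h : Fin d → ℝ) :
    ConvexOn ℝ univ (fun t : ℝ => f (y + t • h)) := by
  refine ⟨convex_univ, fun s _ t _ a b ha hb hab => ?_⟩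
  have := hc.2 (mem_univ (y + s • h)) (mem_univ (y + t • h)) ha hb hab
  convert this using 2
  rw [smul_add, smul_add, smul_smul, smul_smul, smul_eq_mul, smul_eq_mul, add_smul]
  rw [show a • y + (a * s) • h + (b • y + (b * t) • h) =
    (a + b) • y + ((a * s) • h + (b * t) • h) by rw [add_smul]; abel, hab, one_smul]

lemma hess_posSemidef (hc : ConvexOn ℝ univ f) (y : Fin d → ℝ) : (hess f y).PosSemidef := by
  refine Matrix.PosSemidef.of_dotProduct_mulVec_nonneg ?_ fun u => ?_
  · ext i j
    have := form_hess_symm hf y (Pi.single j 1) (Pi.single i 1)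
    simpa [form_apply] using this
  · rw [star_trivial, ← form_apply]
    have h1 := (convexOn_line hc y u).monotoneOn_deriv
      fun t _ => (hasDerivAt_line_zero hf y u t).differentiableAt
    have h2 : deriv (fun t : ℝ => f (y + t • u)) = fun t => der1 f (y + t • u) u :=
      funext fun t => (hasDerivAt_line_zero hf y u t).deriv
    rw [h2, monotoneOn_univ] at h1
    have h3 := h1.deriv_nonneg (x := 0)
    rw [(hasDerivAt_line_one hf y u u 0).deriv] at h3
    simpa using h3

/-- A convex function lies above its tangents. -/
lemma le_of_convexOn (hc : ConvexOn ℝ univ f) (y z : Fin d → ℝ) :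
    f y + der1 f y (z - y) ≤ f z := by
  have h1 := (convexOn_line hc y (z - y)).le_slope_of_hasDerivAt (mem_univ 0) (mem_univ 1)
    zero_lt_one (hasDerivAt_line_zero hf y (z - y) 0)
  simp only [slope, sub_zero, inv_one, one_smul, zero_smul, add_zero, add_sub_cancel,
    vsub_eq_sub] at h1
  linarith

end Derivatives

/-! ### Taylor estimates from third-order smoothness, and the cubic bound. -/

section Smooth

variable {d : ℕ} {f : (Fin d → ℝ) → ℝ} {B : Matrix (Fin d) (Fin d) ℝ} {L : ℝ}

lemma abs_der3_diag_sub_le (hB : B.PosDef) (hs : IsSmoothOfDegree 3 L B f) (x y h : Fin d → ℝ) :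
    |der3 f y h h h - der3 f x h h h| ≤ L * nm (form B) (y - x) * nm (form B) h ^ 3 := by
  have key : ∀ w, nm (form B) w ≤ 1 → |der3 f y w w w - der3 f x w w w| ≤
      L * nm (form B) (y - x) := by
    intro w hw
    have := hs.2 x y w (by rw [bNorm_eq_nm]; exact hw)
    have e : (fun _ : Fin 3 => w) = ![w, w, w] := by
      ext i; fin_cases i <;> rfl
    rwa [e, iteratedFDeriv_three_apply, iteratedFDeriv_three_apply, bNorm_eq_nm] at this
  by_cases h0 : nm (form B) h = 0
  · have : h = 0 := form_definite hB h (by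
      rw [← (isPSD_form hB.posSemidef).nm_sq, h0]; norm_num)
    subst this
    simp [nm_zero]
  · have hp : 0 < nm (form B) h := lt_of_le_of_ne (nm_nonneg _) (Ne.symm h0)
    have h1 := key ((nm (form B) h)⁻¹ • h) (by
      rw [nm_smul, abs_of_pos (inv_pos.2 hp), inv_mul_cancel₀ h0])
    simp only [map_smul, LinearMap.smul_apply, smul_eq_mul] at h1
    have e : der3 f y h h h - der3 f x h h h = nm (form B) h ^ 3 *
        ((nm (form B) h)⁻¹ * ((nm (form B) h)⁻¹ * ((nm (form B) h)⁻¹ * der3 f y h h h)) -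
        (nm (form B) h)⁻¹ * ((nm (form B) h)⁻¹ * ((nm (form B) h)⁻¹ * der3 f x h h h))) := by
      field_simp
    rw [e, abs_mul, abs_of_pos (by positivity), mul_comm]
    exact mul_le_mul_of_nonneg_right h1 (by positivity)

/-- Polarization is needed here: the Taylor formulas below differentiate along `h` while testing in
a different direction `z`. -/
lemma abs_der3_sub_le (hB : B.PosDef) (hs : IsSmoothOfDegree 3 L B f) (x y h z : Fin d → ℝ) :
    |der3 f y z h h - der3 f x z h h| ≤
      L * nm (form B) (y - x) * nm (form B) z * nm (form B) h ^ 2 := by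
  have hy := isSymm3_der3 hs.1 y
  have hx := isSymm3_der3 hs.1 x
  exact hy.abs_sub_apply_le (isPSD_form hB.posSemidef) (form_definite hB) hx
    (fun w => abs_der3_diag_sub_le hB hs x y w) z h

lemma abs_der1_taylor_le (hB : B.PosDef) (hs : IsSmoothOfDegree 3 L B f) (y h z : Fin d → ℝ) :
    |der1 f (y + h) z - der1 f y z - form (hess f y) h z - der3 f y h h z / 2| ≤
      L * nm (form B) h ^ 3 * nm (form B) z / 6 := by
  have := abs_taylor_two_le (K := L * nm (form B) h ^ 3 * nm (form B) z)
    (hasDerivAt_line_one hs.1 y h z) (hasDerivAt_line_two hs.1 y h h z) (fun t ht => by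
      have e : ∀ x, der3 f x h h z = der3 f x z h h := fun x => by
        rw [(isSymm3_der3 hs.1 x).right, (isSymm3_der3 hs.1 x).left]
      rw [e, e]
      have := abs_der3_sub_le hB hs (y + (0 : ℝ) • h) (y + t • h) h z
      rw [zero_smul, add_zero, add_sub_cancel_left, nm_smul, abs_of_nonneg ht] at this
      rw [zero_smul, add_zero]
      linarith)
  simpa using this

lemma abs_hess_taylor_le (hB : B.PosDef) (hs : IsSmoothOfDegree 3 L B f) (y h z : Fin d → ℝ) :
    |form (hess f (y + h)) z z - form (hess f y) z z - der3 f y h z z| ≤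
      L * nm (form B) h ^ 2 * nm (form B) z ^ 2 / 2 := by
  have := abs_taylor_one_le (K := L * nm (form B) h ^ 2 * nm (form B) z ^ 2)
    (hasDerivAt_line_two hs.1 y h z z) (fun t ht => by
      have := abs_der3_sub_le hB hs (y + (0 : ℝ) • h) (y + t • h) z h
      rw [zero_smul, add_zero, add_sub_cancel_left, nm_smul, abs_of_nonneg ht] at this
      rw [zero_smul, add_zero]
      linarith) zero_le_one
  simpa using this

/-- The Hessian is nonnegative at `y - √2 u`, and its first-order expansion around `y` contains `-√2
T(u,z,z)`. The shift `√2` makes the Taylor remainder exactly `L‖u‖²‖z‖²`. -/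
lemma cubicBound_der3 (hB : B.PosDef) (hc : ConvexOn ℝ univ f) (hs : IsSmoothOfDegree 3 L B f)
    (y : Fin d → ℝ) : CubicBound (form B) (form (hess f y)) (der3 f y) L := by
  intro u z
  have hb := isPSD_form hB.posSemidef
  have key : ∀ u, der3 f y u z z ≤
      Real.sqrt 2 / 2 * (form (hess f y) z z + L * form B u u * form B z z) := by
    intro u
    have h2 : Real.sqrt 2 ^ 2 = 2 := Real.sq_sqrt (by norm_num)
    have h20 : 0 < Real.sqrt 2 := by positivity
    have h1 := (abs_le.1 (abs_hess_taylor_le hB hs y (-(Real.sqrt 2 • u)) z)).2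
    have h3 := (isPSD_form (hess_posSemidef hs.1 hc (y + -(Real.sqrt 2 • u)))).nonneg z
    rw [nm_neg, nm_smul, abs_of_pos h20, mul_pow, h2, hb.nm_sq, hb.nm_sq] at h1
    simp only [map_neg, map_smul, LinearMap.neg_apply, LinearMap.smul_apply, smul_eq_mul] at h1
    have h4 : Real.sqrt 2 * der3 f y u z z ≤
        form (hess f y) z z + L * form B u u * form B z z := by linarith
    have h5 := mul_le_mul_of_nonneg_left h4 (by positivity : 0 ≤ Real.sqrt 2 / 2)
    calc der3 f y u z z = Real.sqrt 2 / 2 * (Real.sqrt 2 * der3 f y u z z) := by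
          linear_combination (-1 / 2 * der3 f y u z z) * h2
      _ ≤ _ := h5
  rw [abs_le]
  have := key (-u)
  simp only [map_neg, LinearMap.neg_apply, neg_neg] at this
  exact ⟨by linarith, key u⟩

end Smooth

/-! ### Comparison of the `B`-norm with the sup norm. -/

section Topology

variable {d : ℕ} {B : Matrix (Fin d) (Fin d) ℝ}

lemma continuous_form (A : Matrix (Fin d) (Fin d) ℝ) :
    Continuous fun u : Fin d → ℝ => form A u u := by
  simp only [form_apply]
  exact continuous_id.dotProduct (continuous_const.matrix_mulVec continuous_id)

lemma continuous_nm (B : Matrix (Fin d) (Fin d) ℝ) : Continuous (nm (form B)) :=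
  Real.continuous_sqrt.comp (continuous_form B)

lemma exists_norm_le_nm (hB : B.PosDef) : ∃ c : ℝ, 0 < c ∧ ∀ v, ‖v‖ ≤ c * nm (form B) v := by
  by_cases hne : (Metric.sphere (0 : Fin d → ℝ) 1).Nonempty
  · obtain ⟨w, hw, hmin⟩ := (isCompact_sphere (0 : Fin d → ℝ) 1).exists_isMinOn hne
      (continuous_nm B).continuousOn
    have hw0 : w ≠ 0 := by rintro rfl; simp at hw
    have hm : 0 < nm (form B) w := by
      refine lt_of_le_of_ne (nm_nonneg _) fun h => hw0 (form_definite hB w ?_)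
      rw [← (isPSD_form hB.posSemidef).nm_sq, ← h]; norm_num
    refine ⟨(nm (form B) w)⁻¹, inv_pos.2 hm, fun v => ?_⟩
    by_cases hv : v = 0
    · subst hv; simp [nm_zero]
    · have hv' : 0 < ‖v‖ := norm_pos_iff.2 hv
      have h1 : nm (form B) w ≤ nm (form B) (‖v‖⁻¹ • v) := hmin (by
        simp [norm_smul, hv'.ne'])
      rw [nm_smul, abs_of_pos (inv_pos.2 hv')] at h1
      rw [← div_eq_inv_mul, le_div_iff₀ hm]
      calc ‖v‖ * nm (form B) w ≤ ‖v‖ * (‖v‖⁻¹ * nm (form B) v) := by gcongr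
        _ = nm (form B) v := by field_simp
  -- An empty unit sphere means that the space is trivial.
  · refine ⟨1, one_pos, fun v => ?_⟩
    have hv : v = 0 := by
      by_contra hv
      refine hne ⟨‖v‖⁻¹ • v, ?_⟩
      simp [norm_smul, norm_ne_zero_iff.2 hv]
    subst hv; simp [nm_zero]

lemma isCompact_nm_ball (hB : B.PosDef) (x : Fin d → ℝ) (r : ℝ) :
    IsCompact {u | nm (form B) (u - x) ≤ r} := by
  obtain ⟨c, hc, hcv⟩ := exists_norm_le_nm hB
  refine Metric.isCompact_of_isClosed_isBounded
    (isClosed_le ((continuous_nm B).comp (continuous_id.sub continuous_const)) continuous_const) ?_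
  refine (Metric.isBounded_closedBall (x := x) (r := c * r)).subset fun u hu => ?_
  rw [mem_closedBall_iff_norm]
  exact (hcv _).trans (mul_le_mul_of_nonneg_left hu hc.le)

end Topology

/-- A common bound on the first three derivatives of `f` at `y`. -/
structure DerivBound {d : ℕ} (f : (Fin d → ℝ) → ℝ) (B : Matrix (Fin d) (Fin d) ℝ) (C : ℝ)
    (y : Fin d → ℝ) : Prop where
  one : ∀ z, |der1 f y z| ≤ C * nm (form B) z
  two : ∀ u z, |form (hess f y) u z| ≤ C * nm (form B) u * nm (form B) z
  three : ∀ u v z, |der3 f y u v z| ≤ C * nm (form B) u * nm (form B) v * nm (form B) z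

/-- The standing assumptions on a problem. -/
structure Problem.Good {d : ℕ} (q : Problem d) : Prop where
  pos : q.B.PosDef
  L_pos : 0 < q.L
  convex : ConvexOn ℝ univ q.f
  smooth : IsSmoothOfDegree 3 q.L q.B q.f

/-! ### Linear convergence of the inexact inner iteration. -/

section Aux

variable {d : ℕ} {q : Problem d}

/-- The derivative of the model of `q.f` at `y`. -/
def auxD (q : Problem d) (y h z : Fin d → ℝ) : ℝ :=
  modelD (form q.B) (form (hess q.f y)) (der3 q.f y) (der1 q.f y) q.L h z

/-- The Bregman divergence of the reference function at `y`. -/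
def auxBreg (q : Problem d) (y u h : Fin d → ℝ) : ℝ :=
  refBreg (form q.B) (form (hess q.f y)) q.L u h

namespace Problem.Good

lemma form_psd (hq : q.Good) : IsPSD (form q.B) := isPSD_form hq.pos.posSemidef

lemma hess_psd (hq : q.Good) (y : Fin d → ℝ) : IsPSD (form (hess q.f y)) :=
  isPSD_form (hess_posSemidef hq.smooth.1 hq.convex y)

lemma symm3 (hq : q.Good) (y : Fin d → ℝ) : IsSymm3 (der3 q.f y) := isSymm3_der3 hq.smooth.1 y

lemma cubic (hq : q.Good) (y : Fin d → ℝ) :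
    CubicBound (form q.B) (form (hess q.f y)) (der3 q.f y) q.L :=
  cubicBound_der3 hq.pos hq.convex hq.smooth y

end Problem.Good

/-- Translates the bisection error into the inexactness `e` of `refBreg_step_le`; `N` bounds the
dual norm of the linear term, hence the initial bisection interval. -/
lemma auxStep_spec (hq : q.Good) (p : Init) (y h : Fin d → ℝ) {N : ℝ} (hN0 : 0 ≤ N)
    (hN : ∀ z, |(1 + Real.sqrt 2 / 2)⁻¹ * auxD q y h z -
      refD (form q.B) (form (hess q.f y)) q.L h z| ≤ N * nm (form q.B) z) :
    q.L * nm (form q.B) (auxStep q p y h).val ^ 2 ≤ (q.L * N ^ 2) ^ (1 / 3 : ℝ) ∧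
    ∀ z, |refD (form q.B) (form (hess q.f y)) q.L (auxStep q p y h).val z -
        refD (form q.B) (form (hess q.f y)) q.L h z +
        (1 + Real.sqrt 2 / 2)⁻¹ * auxD q y h z| ≤
      3 * ((q.L * N ^ 2) ^ (1 / 3 : ℝ) / 2 ^ p.J) * nm (form q.B) (auxStep q p y h).val *
        nm (form q.B) z := by
  set r := (q.L * bNorm q.B h ^ 2) • (q.B *ᵥ h) with hr
  set c := (1 + 1 / Real.sqrt 2)⁻¹ •
    (grad q.f y + hess q.f y *ᵥ h + (1 / 2 : ℝ) • third q.f y h + r) -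
    (hess q.f y *ᵥ h + r) with hc
  have hval : (auxStep q p y h).val = (quarticStep q p y c).val := rfl
  have e0 : (1 : ℝ) / Real.sqrt 2 = Real.sqrt 2 / 2 := by
    rw [div_eq_div_iff (by positivity) (by norm_num), one_mul, Real.mul_self_sqrt (by norm_num)]
  have e1 : ∀ z, (hess q.f y *ᵥ h) ⬝ᵥ z = form (hess q.f y) h z := fun z => by
    rw [(hq.hess_psd y).symm, form_apply, dotProduct_comm]
  have e2 : ∀ z, r ⬝ᵥ z = q.L * form q.B h h * form q.B h z := fun z => by
    rw [hr, smul_dotProduct, bNorm_eq_nm, hq.form_psd.nm_sq, smul_eq_mul, hq.form_psd.symm h z,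
      form_apply q.B z h, dotProduct_comm z]
  have hcz : ∀ z, c ⬝ᵥ z = (1 + Real.sqrt 2 / 2)⁻¹ * auxD q y h z -
      refD (form q.B) (form (hess q.f y)) q.L h z := fun z => by
    rw [hc, e0]
    simp only [sub_dotProduct, smul_dotProduct, add_dotProduct, e1, e2, grad_dot, third_dot,
      smul_eq_mul, auxD, modelD, refD]
    rw [(hq.symm3 y).left z h h, (hq.symm3 y).right h z h]
  have hN' := nm_callSolve_le hq.pos hN0 (c := c) (fun z => by rw [hcz]; exact hN z)
  obtain ⟨h1, h2⟩ := quarticStep_spec (p := p) hq.pos (hess_posSemidef hq.smooth.1 hq.convex y)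
    hq.L_pos hN'
  rw [hval]
  refine ⟨h1, fun z => ?_⟩
  have := h2 z
  rw [hcz] at this
  convert this using 2
  ring

lemma auxD_sub (hq : q.Good) {y h s : Fin d → ℝ} {C R : ℝ} (hC : DerivBound q.f q.B C y)
    (hC0 : 0 ≤ C) (hh : nm (form q.B) h ≤ R) (hs : nm (form q.B) s ≤ R) (z : Fin d → ℝ) :
    |auxD q y h z - auxD q y s z| ≤
      (C + C * R + 3 * q.L * R ^ 2) * nm (form q.B) (h - s) * nm (form q.B) z := by
  have hb := hq.form_psd
  have hL := hq.L_pos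
  set w := h - s with hw
  have e : auxD q y h z - auxD q y s z = form (hess q.f y) w z +
      (1 / 2 * (der3 q.f y w h z + der3 q.f y s w z) +
      q.L * ((form q.B w h + form q.B s w) * form q.B h z + form q.B s s * form q.B w z)) := by
    simp only [auxD, modelD, hw, map_sub, LinearMap.sub_apply]
    ring
  have nz : 0 ≤ nm (form q.B) z := nm_nonneg _
  have nw : 0 ≤ nm (form q.B) w := nm_nonneg _
  have nh : 0 ≤ nm (form q.B) h := nm_nonneg _
  have ns : 0 ≤ nm (form q.B) s := nm_nonneg _
  have hR : 0 ≤ R := nh.trans hh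
  have a1 := hC.two w z
  have a2 : |der3 q.f y w h z| ≤ C * R * (nm (form q.B) w * nm (form q.B) z) := by
    refine (hC.three w h z).trans ?_
    calc _ = C * nm (form q.B) h * (nm (form q.B) w * nm (form q.B) z) := by ring
      _ ≤ _ := by gcongr
  have a3 : |der3 q.f y s w z| ≤ C * R * (nm (form q.B) w * nm (form q.B) z) := by
    refine (hC.three s w z).trans ?_
    calc _ = C * nm (form q.B) s * (nm (form q.B) w * nm (form q.B) z) := by ring
      _ ≤ _ := by gcongr
  have a4 : |form q.B w h * form q.B h z| ≤ R ^ 2 * (nm (form q.B) w * nm (form q.B) z) := by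
    rw [abs_mul]
    calc _ ≤ (nm (form q.B) w * nm (form q.B) h) * (nm (form q.B) h * nm (form q.B) z) :=
          mul_le_mul (hb.abs_apply_le _ _) (hb.abs_apply_le _ _) (abs_nonneg _) (by positivity)
      _ ≤ (nm (form q.B) w * R) * (R * nm (form q.B) z) := by gcongr
      _ = _ := by ring
  have a5 : |form q.B s w * form q.B h z| ≤ R ^ 2 * (nm (form q.B) w * nm (form q.B) z) := by
    rw [abs_mul]
    calc _ ≤ (nm (form q.B) s * nm (form q.B) w) * (nm (form q.B) h * nm (form q.B) z) :=
          mul_le_mul (hb.abs_apply_le _ _) (hb.abs_apply_le _ _) (abs_nonneg _) (by positivity)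
      _ ≤ (R * nm (form q.B) w) * (R * nm (form q.B) z) := by gcongr
      _ = _ := by ring
  have a6 : |form q.B s s * form q.B w z| ≤ R ^ 2 * (nm (form q.B) w * nm (form q.B) z) := by
    rw [abs_mul]
    calc _ ≤ (nm (form q.B) s * nm (form q.B) s) * (nm (form q.B) w * nm (form q.B) z) :=
          mul_le_mul (hb.abs_apply_le _ _) (hb.abs_apply_le _ _) (abs_nonneg _) (by positivity)
      _ ≤ (R * R) * (nm (form q.B) w * nm (form q.B) z) := by gcongr
      _ = _ := by ring
  rw [e, abs_le]
  rw [abs_le] at a1 a2 a3 a4 a5 a6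
  constructor
  · linarith [mul_le_mul_of_nonneg_left a4.1 hL.le, mul_le_mul_of_nonneg_left a5.1 hL.le,
      mul_le_mul_of_nonneg_left a6.1 hL.le]
  · linarith [mul_le_mul_of_nonneg_left a4.2 hL.le, mul_le_mul_of_nonneg_left a5.2 hL.le,
      mul_le_mul_of_nonneg_left a6.2 hL.le]

lemma auxD_zero_left (y z : Fin d → ℝ) : auxD q y 0 z = der1 q.f y z := by
  simp [auxD, modelD]

lemma eq_zero_of_forall_quadratic {m C : ℝ} (hC : 0 ≤ C)
    (h : ∀ t : ℝ, |t| ≤ 1 → 0 ≤ t * m + t ^ 2 * C) : m = 0 := by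
  by_contra hm
  have hD : 0 < |m| + C + 1 := by positivity
  have h1 := h (-m / (|m| + C + 1)) (by
    rw [abs_div, abs_neg, abs_of_pos hD, div_le_one hD]; linarith [abs_nonneg m])
  have e : -m / (|m| + C + 1) * m + (-m / (|m| + C + 1)) ^ 2 * C =
      -(m ^ 2 * (|m| + 1) / (|m| + C + 1) ^ 2) := by
    field_simp; ring
  rw [e] at h1
  have : 0 < m ^ 2 * (|m| + 1) / (|m| + C + 1) ^ 2 := by positivity
  linarith

/-- The model has a critical point, in a ball whose radius depends only on the gradient. -/
lemma exists_auxD_critical (hq : q.Good) {y : Fin d → ℝ} {C : ℝ} (hC0 : 0 ≤ C)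
    (hC : ∀ z, |der1 q.f y z| ≤ C * nm (form q.B) z) :
    ∃ s, nm (form q.B) s ≤ 48 * C / q.L + 1 ∧ ∀ z, auxD q y s z = 0 := by
  have hb := hq.form_psd
  have hH := hq.hess_psd y
  have hL := hq.L_pos
  set R := 48 * C / q.L + 1 with hR
  have hR1 : 1 ≤ R := by rw [hR]; have : 0 ≤ 48 * C / q.L := by positivity
                         linarith
  set Γ := model (form q.B) (form (hess q.f y)) (der3 q.f y) (der1 q.f y) q.L with hΓ
  have hcont : Continuous Γ := by
    have c1 : Continuous fun h => der1 q.f y h := (fderiv ℝ q.f y).continuous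
    have c2 := continuous_form (hess q.f y)
    have c3 : Continuous fun h => der3 q.f y h h h :=
      (((fderiv ℝ (fderiv ℝ (fderiv ℝ q.f)) y).continuous.clm_apply continuous_id).clm_apply
        continuous_id)
    have c4 := continuous_form q.B
    exact ((c1.add (continuous_const.mul c2)).add (continuous_const.mul c3)).add
      (continuous_const.mul (c4.pow 2))
  have hΓ0 : Γ 0 = 0 := by simp [hΓ, model]
  obtain ⟨s, hs, hmin⟩ := (isCompact_nm_ball hq.pos 0 R).exists_isMinOn
    ⟨0, by simp only [mem_ofPred_eq, sub_zero, nm_zero]; linarith⟩ hcont.continuousOn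
  simp only [mem_ofPred_eq, sub_zero] at hs
  -- A minimizer over the ball is global: beyond radius `48C/L + 1` the quartic growth, of
  -- coefficient at least `¼ · L/12`, beats the linear term, and the model exceeds its value `0` at
  -- the origin.
  have hall : ∀ u, Γ s ≤ Γ u := by
    intro u
    by_cases hu : nm (form q.B) u ≤ R
    · exact hmin (by simpa using hu)
    · push Not at hu
      have h0 : Γ s ≤ Γ 0 := hmin (by simp only [mem_ofPred_eq, sub_zero, nm_zero]; linarith)
      have h1 := model_ge (g := der1 q.f y) hb hH (hq.symm3 y) (hq.cubic y) hL.le u 0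
      have h2 := refBreg_ge hb hH hL.le u 0
      have h3 : modelD (form q.B) (form (hess q.f y)) (der3 q.f y) (der1 q.f y) q.L 0 (u - 0) =
          der1 q.f y u := by rw [sub_zero]; exact auxD_zero_left y u
      rw [← hΓ, hΓ0, h3] at h1
      rw [sub_zero] at h2
      have h4 := (abs_le.1 (hC u)).1
      have h5 := sqrt_two_half_lt
      have hn : 0 < nm (form q.B) u := by linarith
      have h6 : C ≤ q.L / 48 * nm (form q.B) u ^ 3 := by
        have h7 : 48 * C / q.L ≤ nm (form q.B) u := by linarith
        have h8 : nm (form q.B) u ≤ nm (form q.B) u ^ 3 := by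
          have : 1 ≤ nm (form q.B) u := by linarith
          nlinarith [sq_nonneg (nm (form q.B) u), mul_nonneg hn.le (sub_nonneg.2 this)]
        have h9 : C = q.L / 48 * (48 * C / q.L) := by field_simp
        rw [h9]; gcongr; linarith
      have h10 : C * nm (form q.B) u ≤ q.L / 48 * nm (form q.B) u ^ 4 := by
        calc _ ≤ q.L / 48 * nm (form q.B) u ^ 3 * nm (form q.B) u := by gcongr
          _ = _ := by ring
      have h11 : 0 ≤ q.L / 12 * nm (form q.B) u ^ 4 := by positivity
      have h12 : (1 / 4 : ℝ) * (q.L / 12 * nm (form q.B) u ^ 4) ≤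
          (1 - Real.sqrt 2 / 2) * refBreg (form q.B) (form (hess q.f y)) q.L u 0 :=
        mul_le_mul (by linarith) h2 h11 (by linarith)
      linarith
  refine ⟨s, hs, fun z => ?_⟩
  set κ := 1 + Real.sqrt 2 / 2
  have hκ : 0 ≤ κ := by positivity
  set D := κ * (1 / 2 * form (hess q.f y) z z + q.L * (1 / 2 * form q.B s s * form q.B z z +
    1 / 4 * (2 * |form q.B s z| + form q.B z z) ^ 2)) with hD
  have hz := hH.nonneg z
  have hbz := hb.nonneg z
  have hbs := hb.nonneg s
  refine eq_zero_of_forall_quadratic (C := D) (by positivity) fun t ht => ?_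
  have h1 := model_le (g := der1 q.f y) hb hH (hq.symm3 y) (hq.cubic y) hL.le (s + t • z) s
  rw [add_sub_cancel_left, modelD_smul] at h1
  have h2 := hall (s + t • z)
  have h3 : κ * refBreg (form q.B) (form (hess q.f y)) q.L (s + t • z) s ≤ t ^ 2 * D := by
    rw [hD, mul_left_comm]
    refine mul_le_mul_of_nonneg_left ?_ hκ
    simp only [refBreg, add_sub_cancel_left, quartBreg, map_smul, LinearMap.smul_apply, smul_eq_mul]
    have h4 : (2 * (t * form q.B s z) + t * (t * form q.B z z)) ^ 2 ≤
        t ^ 2 * (2 * |form q.B s z| + form q.B z z) ^ 2 := by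
      have : (2 * (t * form q.B s z) + t * (t * form q.B z z)) ^ 2 =
        t ^ 2 * (2 * form q.B s z + t * form q.B z z) ^ 2 := by ring
      rw [this]
      refine mul_le_mul_of_nonneg_left (sq_le_sq' ?_ ?_) (sq_nonneg t)
      · have := neg_abs_le (form q.B s z)
        have := neg_abs_le t
        nlinarith
      · have := le_abs_self (form q.B s z)
        have := le_abs_self t
        nlinarith
    have h5 := mul_le_mul_of_nonneg_left h4 hL.le
    nlinarith
  have h5 : Γ (s + t • z) ≤ Γ s + t * auxD q y s z +
      κ * refBreg (form q.B) (form (hess q.f y)) q.L (s + t • z) s := h1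
  linarith

lemma abs_inv_mul_auxD_sub_le (hq : q.Good) {y h : Fin d → ℝ} {C R : ℝ}
    (hC : DerivBound q.f q.B C y) (hC0 : 0 ≤ C) (hh : nm (form q.B) h ≤ R) (z : Fin d → ℝ) :
    |(1 + Real.sqrt 2 / 2)⁻¹ * auxD q y h z - refD (form q.B) (form (hess q.f y)) q.L h z| ≤
      (C + (C + C * R + 3 * q.L * R ^ 2) * R + (C * R + q.L * R ^ 3)) * nm (form q.B) z := by
  have hb := hq.form_psd
  have hL := hq.L_pos
  have nz : 0 ≤ nm (form q.B) z := nm_nonneg _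
  have nh : 0 ≤ nm (form q.B) h := nm_nonneg _
  have hR : 0 ≤ R := nh.trans hh
  have a1 := auxD_sub hq hC hC0 hh (by rw [nm_zero]; exact hR : nm (form q.B) 0 ≤ R) z
  rw [auxD_zero_left, sub_zero] at a1
  have a2 := hC.one z
  have a3 : |auxD q y h z| ≤ (C + (C + C * R + 3 * q.L * R ^ 2) * R) * nm (form q.B) z := by
    have : |auxD q y h z| ≤ |auxD q y h z - der1 q.f y z| + |der1 q.f y z| := by
      simpa using abs_add_le (auxD q y h z - der1 q.f y z) (der1 q.f y z)
    have h5 : (C + C * R + 3 * q.L * R ^ 2) * nm (form q.B) h * nm (form q.B) z ≤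
      (C + C * R + 3 * q.L * R ^ 2) * R * nm (form q.B) z := by gcongr
    linarith
  have a4 : |(1 + Real.sqrt 2 / 2)⁻¹ * auxD q y h z| ≤ |auxD q y h z| := by
    rw [abs_mul, abs_of_pos (by positivity)]
    refine mul_le_of_le_one_left (abs_nonneg _) (inv_le_one_of_one_le₀ ?_)
    have : 0 ≤ Real.sqrt 2 / 2 := by positivity
    linarith
  have a5 : |refD (form q.B) (form (hess q.f y)) q.L h z| ≤
      (C * R + q.L * R ^ 3) * nm (form q.B) z := by
    have b1 := hC.two h z
    have b2 : |q.L * form q.B h h * form q.B h z| ≤ q.L * R ^ 3 * nm (form q.B) z := by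
      rw [← hb.nm_sq, abs_mul, abs_of_nonneg (by positivity)]
      calc _ ≤ q.L * nm (form q.B) h ^ 2 * (nm (form q.B) h * nm (form q.B) z) := by
            gcongr; exact hb.abs_apply_le _ _
        _ = q.L * nm (form q.B) h ^ 3 * nm (form q.B) z := by ring
        _ ≤ _ := by gcongr
    have b3 : C * nm (form q.B) h * nm (form q.B) z ≤ C * R * nm (form q.B) z := by gcongr
    rw [refD]
    refine (abs_add_le _ _).trans ?_
    linarith
  refine (abs_sub _ _).trans ?_
  linarith

lemma pow_083_le (m : ℕ) : (0.83 : ℝ) ^ (4 * m) ≤ (2 ^ m)⁻¹ := by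
  rw [pow_mul, ← inv_pow]
  exact pow_le_pow_left₀ (by norm_num) (by norm_num) m

set_option maxHeartbeats 1000000 in
/-- Linear convergence of `ApproxAuxMin`, uniformly over points with bounded derivatives. -/
theorem exists_auxLoop_bound {L C : ℝ} (hL : 0 < L) (hC0 : 0 ≤ C) :
    ∃ (R : ℝ) (n0 : ℕ), 0 ≤ R ∧ ∀ (d : ℕ) (q : Problem d), q.Good → q.L = L →
      ∀ n, n0 ≤ n → ∀ (p : Init), p.K = 164 * n → p.J = 41 * n → ∀ y, DerivBound q.f q.B C y →
        nm (form q.B) (auxLoop q p y p.K 0).val ≤ R ∧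
        ∀ z, |auxD q y (auxLoop q p y p.K 0).val z| ≤ ((2 : ℝ) ^ (10 * n))⁻¹ * nm (form q.B) z := by
  -- `R1` bounds the critical point, `D0` the initial divergence, `R2` all points of divergence at
  -- most `D0 + 1`, `N` and `U` the data of the bisection, `R3` the next iterate, `C3` the error of
  -- a step, and `C5` the Lipschitz constant of the model derivative. All depend on `L` and `C`
  -- only.
  obtain ⟨R1, hR1⟩ : ∃ x, x = 48 * C / L + 1 := ⟨_, rfl⟩
  have hR10 : 0 ≤ R1 := by rw [hR1]; positivity
  obtain ⟨D0, hD0⟩ : ∃ x, x = C * R1 ^ 2 + L * R1 ^ 4 := ⟨_, rfl⟩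
  have hD00 : 0 ≤ D0 := by rw [hD0]; positivity
  obtain ⟨R2, hR2⟩ : ∃ x, x = 12 * (D0 + 1) / L + 1 + R1 := ⟨_, rfl⟩
  have hR20 : 0 ≤ R2 := by rw [hR2]; positivity
  obtain ⟨N, hN⟩ : ∃ x, x = C + (C + C * R2 + 3 * L * R2 ^ 2) * R2 + (C * R2 + L * R2 ^ 3) :=
    ⟨_, rfl⟩
  have hN0 : 0 ≤ N := by rw [hN]; positivity
  obtain ⟨U, hU⟩ : ∃ x, x = (L * N ^ 2) ^ (1 / 3 : ℝ) := ⟨_, rfl⟩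
  have hU0 : 0 ≤ U := by rw [hU]; positivity
  obtain ⟨R3, hR3⟩ : ∃ x, x = U / L + 1 := ⟨_, rfl⟩
  have hR30 : 0 ≤ R3 := by rw [hR3]; positivity
  obtain ⟨C3, hC3⟩ : ∃ x, x = 3 * U * R3 * (R3 + R1) := ⟨_, rfl⟩
  have hC30 : 0 ≤ C3 := by rw [hC3]; positivity
  obtain ⟨C5, hC5⟩ : ∃ x, x = C + C * R2 + 3 * L * R2 ^ 2 := ⟨_, rfl⟩
  have hC50 : 0 ≤ C5 := by rw [hC5]; positivity
  obtain ⟨C6, hC6⟩ : ∃ x, x = C5 ^ 4 * (12 / L * (D0 + 6 * C3)) := ⟨_, rfl⟩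
  have hC60 : 0 ≤ C6 := by rw [hC6]; positivity
  obtain ⟨n0, hn0⟩ := exists_nat_ge (6 * C3 + C6)
  refine ⟨R2, n0, hR20, fun d q hq hqL n hn p hK hJ y hy => ?_⟩
  subst hqL
  have hb := hq.form_psd
  have hH := hq.hess_psd y
  have h2n : 6 * C3 + C6 ≤ 2 ^ n := by
    have h1 : (n : ℝ) ≤ 2 ^ n := by exact_mod_cast Nat.lt_two_pow_self.le
    have h2 : (n0 : ℝ) ≤ n := by exact_mod_cast hn
    linarith
  have hpow : (2 : ℝ) ^ n ≤ 2 ^ p.J := by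
    rw [hJ]; exact pow_le_pow_right₀ (by norm_num) (by omega)
  have hJ0 : (0 : ℝ) < 2 ^ p.J := by positivity
  have hsmall : 6 * (C3 / 2 ^ p.J) ≤ 1 := by
    rw [← mul_div_assoc, div_le_one hJ0]; linarith
  obtain ⟨s, hs, hcrit⟩ := exists_auxD_critical hq hC0 hy.one
  rw [← hR1] at hs
  have ns : 0 ≤ nm (form q.B) s := nm_nonneg _
  have hinit : auxBreg q y s 0 ≤ D0 := by
    have h1 := (abs_le.1 (hy.two s s)).2
    have h2 : nm (form q.B) s ^ 2 ≤ R1 ^ 2 := pow_le_pow_left₀ ns hs 2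
    have h3 : nm (form q.B) s ^ 4 ≤ R1 ^ 4 := pow_le_pow_left₀ ns hs 4
    have e : auxBreg q y s 0 = 1 / 2 * form (hess q.f y) s s +
        q.L / 4 * nm (form q.B) s ^ 4 := by
      have : nm (form q.B) s ^ 4 = form q.B s s ^ 2 := by rw [← hb.nm_sq]; ring
      rw [this]
      simp [auxBreg, refBreg, quartBreg]
      ring
    rw [e, hD0]
    have h4 : C * nm (form q.B) s * nm (form q.B) s ≤ C * R1 ^ 2 := by
      calc _ = C * nm (form q.B) s ^ 2 := by ring
        _ ≤ _ := by gcongr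
    have h5 : q.L / 4 * nm (form q.B) s ^ 4 ≤ q.L * R1 ^ 4 := by
      have := hq.L_pos
      have h6 : 0 ≤ R1 ^ 4 := by positivity
      nlinarith
    linarith [mul_nonneg hC0 (sq_nonneg R1)]
  have hclose : ∀ h, auxBreg q y s h ≤ D0 + 1 → nm (form q.B) h ≤ R2 := by
    intro h hle
    have h1 := refBreg_ge hb hH hL.le s h
    have h2 : q.L / 12 * nm (form q.B) (s - h) ^ 4 ≤ D0 + 1 := h1.trans hle
    have h3 : nm (form q.B) (h - s) ≤ 12 * (D0 + 1) / q.L + 1 := by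
      rw [nm_sub_comm]
      by_contra! hlt
      have h4 : 0 ≤ 12 * (D0 + 1) / q.L := by positivity
      have h5 : nm (form q.B) (s - h) ≤ nm (form q.B) (s - h) ^ 4 :=
        le_self_pow₀ (by linarith) (by norm_num)
      have h6 : D0 + 1 = q.L / 12 * (12 * (D0 + 1) / q.L) := by field_simp
      have h7 : q.L / 12 * (12 * (D0 + 1) / q.L) < q.L / 12 * nm (form q.B) (s - h) ^ 4 := by
        gcongr; linarith
      linarith
    have h4 := hb.nm_le_add_sub h s
    rw [hR2]; linarith
  have hstep : ∀ h, auxBreg q y s h ≤ D0 + 1 →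
      auxBreg q y s (auxStep q p y h).val ≤ 0.83 * auxBreg q y s h + C3 / 2 ^ p.J := by
    intro h hle
    have hhR := hclose h hle
    obtain ⟨h1, h2⟩ := auxStep_spec hq p y h hN0
      (by rw [hN]; exact abs_inv_mul_auxD_sub_le hq hy hC0 hhR)
    rw [← hU] at h1 h2
    set h' := (auxStep q p y h).val
    have nh' : 0 ≤ nm (form q.B) h' := nm_nonneg _
    have hh' : nm (form q.B) h' ≤ R3 := by
      have h3 : nm (form q.B) h' ^ 2 ≤ U / q.L := by
        rw [le_div_iff₀ hL]; linarith
      rw [hR3]; nlinarith [sq_nonneg (nm (form q.B) h' - 1)]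
    have h3 := refBreg_step_le hb hH (hq.symm3 y) (hq.cubic y) hL.le hcrit h2
    have h4 : nm (form q.B) (h' - s) ≤ R3 + R1 := (hb.nm_sub_le _ _).trans (add_le_add hh' hs)
    refine h3.trans ?_
    have h5 : 3 * (U / 2 ^ p.J) * nm (form q.B) h' * nm (form q.B) (h' - s) ≤
        3 * (U / 2 ^ p.J) * R3 * (R3 + R1) := by
      have : 0 ≤ nm (form q.B) (h' - s) := nm_nonneg _
      gcongr
    have h6 : C3 / 2 ^ p.J = 3 * (U / 2 ^ p.J) * R3 * (R3 + R1) := by rw [hC3]; ring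
    rw [h6]
    exact add_le_add le_rfl h5
  -- Step errors accumulate to at most `6` times one error, as `0.83 · 6 + 1 ≤ 6`. By `hsmall` the
  -- total stays below `1`, so iterates never leave the region where the constants are valid.
  have hloop : ∀ (m : ℕ) (h : Fin d → ℝ) (δ : ℝ), δ ≤ D0 →
      auxBreg q y s h ≤ δ + 6 * (C3 / 2 ^ p.J) → 0 ≤ δ →
      auxBreg q y s (auxLoop q p y m h).val ≤ 0.83 ^ m * δ + 6 * (C3 / 2 ^ p.J) := by
    intro m
    induction m with
    | zero => intro h δ _ h2 _; simpa [auxLoop, pure_val] using h2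
    | succ m ih =>
      intro h δ h1 h2 h3
      have h4 := hstep h (by linarith)
      have h5 : 0 ≤ C3 / 2 ^ p.J := by positivity
      have := ih (auxStep q p y h).val (0.83 * δ) (by linarith) (by linarith) (by linarith)
      rw [auxLoop, bind_val, pow_succ, mul_assoc]
      exact this
  have hfin := hloop p.K 0 D0 le_rfl (by have : 0 ≤ C3 / 2 ^ p.J := by positivity
                                         linarith) hD00
  set h := (auxLoop q p y p.K 0).val
  -- Four contractions halve the divergence, hence `K = 4J`.
  have hK' : (0.83 : ℝ) ^ p.K ≤ (2 ^ p.J)⁻¹ := by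
    rw [hK, hJ, show 164 * n = 4 * (41 * n) by ring]; exact pow_083_le _
  have hfin2 : auxBreg q y s h ≤ (D0 + 6 * C3) * (2 ^ p.J)⁻¹ := by
    have := mul_le_mul_of_nonneg_right hK' hD00
    rw [div_eq_mul_inv] at hfin
    linarith
  have hhR : nm (form q.B) h ≤ R2 := hclose h (by
    have h1 : (0.83 : ℝ) ^ p.K ≤ 1 := pow_le_one₀ (by norm_num) (by norm_num)
    have := mul_le_mul_of_nonneg_right h1 hD00
    linarith)
  refine ⟨hhR, fun z => ?_⟩
  have hsR : nm (form q.B) s ≤ R2 := by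
    rw [hR2]; have : 0 ≤ 12 * (D0 + 1) / q.L := by positivity
    linarith
  have h1 := auxD_sub hq hy hC0 hhR hsR z
  rw [hcrit, sub_zero, ← hC5] at h1
  refine h1.trans (mul_le_mul_of_nonneg_right ?_ (nm_nonneg _))
  have h2 := (refBreg_ge hb hH hL.le s h).trans hfin2
  rw [nm_sub_comm] at h2
  have nn : 0 ≤ nm (form q.B) (h - s) := nm_nonneg _
  refine le_of_pow_le_pow_left₀ (n := 4) (by norm_num) (by positivity) ?_
  have h3 : nm (form q.B) (h - s) ^ 4 ≤ 12 / q.L * ((D0 + 6 * C3) * (2 ^ p.J)⁻¹) := by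
    have : nm (form q.B) (h - s) ^ 4 = 12 / q.L * (q.L / 12 * nm (form q.B) (h - s) ^ 4) := by
      field_simp
    rw [this]
    gcongr
  -- The divergence controls only the fourth power of the distance, so accuracy `2^(-10n)` needs
  -- `40n` bits; the extra `n` bits absorb the constants.
  have h4 : (2 : ℝ) ^ p.J = 2 ^ n * 2 ^ (40 * n) := by
    rw [hJ, ← pow_add]; congr 1; ring
  calc (C5 * nm (form q.B) (h - s)) ^ 4 = C5 ^ 4 * nm (form q.B) (h - s) ^ 4 := by ring
    _ ≤ C5 ^ 4 * (12 / q.L * ((D0 + 6 * C3) * (2 ^ p.J)⁻¹)) := by gcongr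
    _ = C6 * (2 ^ p.J)⁻¹ := by rw [hC6]; ring
    _ ≤ 2 ^ n * (2 ^ p.J)⁻¹ := by gcongr; linarith
    _ = (2 ^ (40 * n))⁻¹ := by rw [h4]; field_simp
    _ = ((2 ^ (10 * n))⁻¹) ^ 4 := by rw [inv_pow, ← pow_mul]; congr 2; ring

end Aux

/-! ### Derivative bounds on compact sets. -/

section Bounds

variable {E : Type*} [NormedAddCommGroup E] [NormedSpace ℝ E]

set_option maxSynthPendingDepth 3 in
lemma exists_fderiv_bounds {f : E → ℝ} (hf : ContDiff ℝ 3 f) {s : Set E} (hs : IsCompact s) :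
    ∃ C1 C2 C3 : ℝ, ∀ y ∈ s, ‖fderiv ℝ f y‖ ≤ C1 ∧ ‖fderiv ℝ (fderiv ℝ f) y‖ ≤ C2 ∧
      ‖fderiv ℝ (fderiv ℝ (fderiv ℝ f)) y‖ ≤ C3 := by
  have c1 : ContDiff ℝ 2 (fderiv ℝ f) := hf.fderiv_right (by norm_num)
  have c2 : ContDiff ℝ 1 (fderiv ℝ (fderiv ℝ f)) := c1.fderiv_right (by norm_num)
  have c3 : ContDiff ℝ 0 (fderiv ℝ (fderiv ℝ (fderiv ℝ f))) := c2.fderiv_right (by norm_num)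
  obtain ⟨C1, h1⟩ := hs.exists_bound_of_continuousOn c1.continuous.continuousOn
  obtain ⟨C2, h2⟩ := hs.exists_bound_of_continuousOn c2.continuous.continuousOn
  obtain ⟨C3, h3⟩ := hs.exists_bound_of_continuousOn c3.continuous.continuousOn
  exact ⟨C1, C2, C3, fun y hy => ⟨h1 y hy, h2 y hy, h3 y hy⟩⟩

end Bounds

/-! ### The level set, first-order conditions, and dependence of the step on its center. -/

section Level

variable {d : ℕ} {q : Problem d}

/-- Sublevel sets of a convex function with a bounded nonempty set of minimizers are bounded. -/
lemma isBounded_sublevel {f : (Fin d → ℝ) → ℝ} (hc : ConvexOn ℝ univ f) (hf : Continuous f)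
    {m : Fin d → ℝ} (hm : ∀ x, f m ≤ f x) (hbd : Bornology.IsBounded {z | ∀ x, f z ≤ f x}) (a : ℝ) :
    Bornology.IsBounded {x | f x ≤ a} := by
  obtain ⟨r, hr0, hr⟩ := hbd.subset_ball_lt 0 m
  by_cases hne : (Metric.sphere m r).Nonempty
  · obtain ⟨w, hw, hmin⟩ := (isCompact_sphere m r).exists_isMinOn hne hf.continuousOn
    -- On a sphere enclosing all minimizers the function exceeds its minimum by a fixed gap;
    -- convexity propagates this as linear growth outside.
    have hgap : 0 < f w - f m := by
      rw [sub_pos]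
      refine lt_of_le_of_ne (hm w) fun h => ?_
      have : w ∈ Metric.ball m r := hr (fun x => h ▸ hm x)
      rw [Metric.mem_ball] at this
      rw [Metric.mem_sphere] at hw
      linarith
    refine (Metric.isBounded_closedBall (x := m) (r := r + r * (|a - f m|) / (f w - f m))).subset ?_
    intro z hz
    rw [Metric.mem_closedBall]
    by_contra! hlt
    have h0 : 0 ≤ r * (|a - f m|) / (f w - f m) := by positivity
    have hs : r < dist z m := by linarith
    have hs0 : 0 < dist z m := by linarith
    have ht1 : r / dist z m ≤ 1 := (div_le_one hs0).2 hs.le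
    have ht0 : 0 < r / dist z m := by positivity
    have hmem : (1 - r / dist z m) • m + (r / dist z m) • z ∈ Metric.sphere m r := by
      rw [Metric.mem_sphere, dist_eq_norm]
      rw [show (1 - r / dist z m) • m + (r / dist z m) • z - m = (r / dist z m) • (z - m) by
        rw [sub_smul, smul_sub, one_smul]; abel]
      rw [norm_smul, Real.norm_of_nonneg ht0.le, ← dist_eq_norm]
      field_simp
    have h1 : f w ≤ f ((1 - r / dist z m) • m + (r / dist z m) • z) := hmin hmem
    have h2 := hc.2 (mem_univ m) (mem_univ z) (sub_nonneg.2 ht1) ht0.le (by ring)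
    rw [smul_eq_mul, smul_eq_mul] at h2
    have hz' : f z ≤ a := hz
    have h3 : f w - f m ≤ r / dist z m * (f z - f m) := by linarith
    have h4 : (f w - f m) * dist z m ≤ r * (f z - f m) := by
      have := mul_le_mul_of_nonneg_right h3 hs0.le
      rwa [mul_right_comm, div_mul_cancel₀ _ hs0.ne'] at this
    have h5 : r * (f z - f m) ≤ r * |a - f m| :=
      mul_le_mul_of_nonneg_left ((by linarith : f z - f m ≤ a - f m).trans (le_abs_self _)) hr0.le
    have h6 : dist z m ≤ r * |a - f m| / (f w - f m) := by
      rw [le_div_iff₀ hgap]; linarith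
    linarith
  · refine (Metric.isBounded_ball (x := m) (r := r)).subset fun z _ => ?_
    by_contra hz
    rw [Metric.mem_ball, not_lt] at hz
    have hs0 : 0 < dist z m := lt_of_lt_of_le hr0 hz
    refine hne ⟨m + (r / dist z m) • (z - m), ?_⟩
    rw [Metric.mem_sphere, dist_eq_norm, add_sub_cancel_left, norm_smul, Real.norm_of_nonneg
      (by positivity), ← dist_eq_norm]
    field_simp

/-- A good problem with a minimizer and bounded set of minimizers. -/
structure Problem.Solvable {d : ℕ} (q : Problem d) : Prop extends q.Good where
  min : ∀ x, q.f q.xs ≤ q.f x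
  bdd : Bornology.IsBounded {z | ∀ x, q.f z ≤ q.f x}

lemma Problem.P_nonneg (q : Problem d) : 0 ≤ q.P := by
  refine Real.sSup_nonneg ?_
  rintro r ⟨x, _, y, _, rfl⟩
  positivity

lemma Problem.G_nonneg (q : Problem d) : 0 ≤ q.G := by
  refine Real.sSup_nonneg ?_
  rintro r ⟨x, _, rfl⟩
  positivity

namespace Problem.Solvable

lemma continuous (hq : q.Solvable) : Continuous q.f := hq.smooth.1.continuous

lemma le_F (hq : q.Solvable) {x : Fin d → ℝ}
    (hx : nm (form q.B) (x - q.x0) ≤ 2 * nm (form q.B) (q.x0 - q.xs)) : q.f x ≤ q.F := by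
  have hball : q.ball = {u | nm (form q.B) (u - q.x0) ≤ 2 * nm (form q.B) (q.x0 - q.xs)} := by
    ext u
    simp only [Problem.ball, bNorm_eq_nm, mem_ofPred_eq]
    have h1 : 0 ≤ nm (form q.B) (u - q.x0) := nm_nonneg _
    have h2 : 0 ≤ nm (form q.B) (q.x0 - q.xs) := nm_nonneg _
    rw [show 4 * nm (form q.B) (q.x0 - q.xs) ^ 2 = (2 * nm (form q.B) (q.x0 - q.xs)) ^ 2 by ring]
    exact pow_le_pow_iff_left₀ h1 (by positivity) (by norm_num)
  refine le_csSup ?_ ⟨x, by rw [hball]; exact hx, rfl⟩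
  rw [hball]
  exact ((isCompact_nm_ball hq.pos _ _).image hq.continuous).bddAbove

lemma mem_level (hq : q.Solvable) {x : Fin d → ℝ}
    (hx : nm (form q.B) (x - q.x0) ≤ 2 * nm (form q.B) (q.x0 - q.xs)) : x ∈ q.level := hq.le_F hx

lemma x0_mem (hq : q.Solvable) : q.x0 ∈ q.level :=
  hq.mem_level (by rw [sub_self, nm_zero]; have : 0 ≤ nm (form q.B) (q.x0 - q.xs) := nm_nonneg _
                   linarith)

lemma xs_mem (hq : q.Solvable) : q.xs ∈ q.level :=
  hq.mem_level (by rw [nm_sub_comm]; have : 0 ≤ nm (form q.B) (q.x0 - q.xs) := nm_nonneg _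
                   linarith)

lemma isCompact_level (hq : q.Solvable) : IsCompact q.level :=
  Metric.isCompact_of_isClosed_isBounded (isClosed_le hq.continuous continuous_const)
    (isBounded_sublevel hq.convex hq.continuous hq.min hq.bdd _)

lemma convex_level (hq : q.Solvable) : Convex ℝ q.level := by
  have := hq.convex.convex_le q.F
  simpa [Problem.level] using this

lemma nm_sub_sq_le (hq : q.Solvable) {x y : Fin d → ℝ} (hx : x ∈ q.level) (hy : y ∈ q.level) :
    nm (form q.B) (x - y) ^ 2 ≤ q.P := by
  refine le_csSup ?_ ⟨x, hx, y, hy, by rw [bNorm_eq_nm]⟩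
  have hc : Continuous fun z : (Fin d → ℝ) × (Fin d → ℝ) => nm (form q.B) (z.1 - z.2) ^ 2 :=
    ((continuous_nm q.B).comp (continuous_fst.sub continuous_snd)).pow 2
  refine (((hq.isCompact_level.prod hq.isCompact_level).image hc).bddAbove).mono ?_
  rintro r ⟨x, hx, y, hy, rfl⟩
  exact ⟨(x, y), ⟨hx, hy⟩, by simp only [bNorm_eq_nm]⟩

lemma nm_sub_le_sqrt (hq : q.Solvable) {x y : Fin d → ℝ} (hx : x ∈ q.level) (hy : y ∈ q.level) :
    nm (form q.B) (x - y) ≤ Real.sqrt q.P := Real.le_sqrt_of_sq_le (hq.nm_sub_sq_le hx hy)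

set_option maxSynthPendingDepth 3 in
lemma exists_derivBound (hq : q.Solvable) :
    ∃ C, 0 ≤ C ∧ ∀ y ∈ q.level, DerivBound q.f q.B C y := by
  obtain ⟨c, hc, hcv⟩ := exists_norm_le_nm hq.pos
  have hf := hq.smooth.1
  obtain ⟨C1, C2, C3, hC⟩ := exists_fderiv_bounds hf hq.isCompact_level
  have h1 := fun y hy => (hC y hy).1
  have h2 := fun y hy => (hC y hy).2.1
  have h3 := fun y hy => (hC y hy).2.2
  refine ⟨|C1| * c + |C2| * c ^ 2 + |C3| * c ^ 3, by positivity, fun y hy => ⟨?_, ?_, ?_⟩⟩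
  · intro z
    have nz : 0 ≤ nm (form q.B) z := nm_nonneg _
    have a1 : ‖fderiv ℝ q.f y z‖ ≤ ‖fderiv ℝ q.f y‖ * ‖z‖ := ContinuousLinearMap.le_opNorm _ _
    have a2 := (h1 y hy).trans (le_abs_self C1)
    have a3 := hcv z
    calc |der1 q.f y z| ≤ ‖fderiv ℝ q.f y‖ * ‖z‖ := a1
      _ ≤ |C1| * (c * nm (form q.B) z) := by gcongr
      _ = (|C1| * c) * nm (form q.B) z := by ring
      _ ≤ _ := by
        gcongr
        have : 0 ≤ |C2| * c ^ 2 + |C3| * c ^ 3 := by positivity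
        linarith
  · intro u z
    have nz : 0 ≤ nm (form q.B) z := nm_nonneg _
    have nu : 0 ≤ nm (form q.B) u := nm_nonneg _
    have a1 : ‖fderiv ℝ (fderiv ℝ q.f) y u z‖ ≤ ‖fderiv ℝ (fderiv ℝ q.f) y‖ * ‖u‖ * ‖z‖ :=
      ContinuousLinearMap.le_opNorm₂ _ _ _
    have a2 := (h2 y hy).trans (le_abs_self C2)
    have a3 := hcv z
    have a4 := hcv u
    rw [form_hess]
    calc _ ≤ ‖fderiv ℝ (fderiv ℝ q.f) y‖ * ‖u‖ * ‖z‖ := a1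
      _ ≤ |C2| * (c * nm (form q.B) u) * (c * nm (form q.B) z) := by gcongr
      _ = (|C2| * c ^ 2) * nm (form q.B) u * nm (form q.B) z := by ring
      _ ≤ _ := by
        gcongr
        have : 0 ≤ |C1| * c := by positivity
        have : 0 ≤ |C3| * c ^ 3 := by positivity
        linarith
  · intro u v z
    have nz : 0 ≤ nm (form q.B) z := nm_nonneg _
    have nu : 0 ≤ nm (form q.B) u := nm_nonneg _
    have nv : 0 ≤ nm (form q.B) v := nm_nonneg _
    have a1 : ‖fderiv ℝ (fderiv ℝ (fderiv ℝ q.f)) y u v z‖ ≤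
        ‖fderiv ℝ (fderiv ℝ (fderiv ℝ q.f)) y‖ * ‖u‖ * ‖v‖ * ‖z‖ :=
      (ContinuousLinearMap.le_opNorm _ _).trans
        (mul_le_mul_of_nonneg_right (ContinuousLinearMap.le_opNorm₂ _ _ _) (norm_nonneg _))
    have a2 := (h3 y hy).trans (le_abs_self C3)
    have a3 := hcv z
    have a4 := hcv u
    have a5 := hcv v
    rw [der3_apply]
    calc _ ≤ ‖fderiv ℝ (fderiv ℝ (fderiv ℝ q.f)) y‖ * ‖u‖ * ‖v‖ * ‖z‖ := a1
      _ ≤ |C3| * (c * nm (form q.B) u) * (c * nm (form q.B) v) * (c * nm (form q.B) z) := by gcongr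
      _ = (|C3| * c ^ 3) * nm (form q.B) u * nm (form q.B) v * nm (form q.B) z := by ring
      _ ≤ _ := by
        gcongr
        have : 0 ≤ |C1| * c + |C2| * c ^ 2 := by positivity
        linarith

end Problem.Solvable

/-- The first-order condition at an approximate minimizer of the model, in terms of `f`. -/
lemma Problem.Good.abs_der1_add_le (hq : q.Good) {y h : Fin d → ℝ} {η : ℝ}
    (hres : ∀ z, |auxD q y h z| ≤ η * nm (form q.B) z) (z : Fin d → ℝ) :
    |der1 q.f (y + h) z + q.L * nm (form q.B) h ^ 2 * form q.B h z| ≤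
      (q.L * nm (form q.B) h ^ 3 / 6 + η) * nm (form q.B) z := by
  have h1 := abs_der1_taylor_le hq.pos hq.smooth y h z
  have h2 := hres z
  have e : der1 q.f (y + h) z + q.L * nm (form q.B) h ^ 2 * form q.B h z =
      (der1 q.f (y + h) z - der1 q.f y z - form (hess q.f y) h z - der3 q.f y h h z / 2) +
      auxD q y h z := by
    rw [auxD, modelD, hq.form_psd.nm_sq]; ring
  rw [e]
  refine (abs_add_le _ _).trans ?_
  linarith

/-- An approximate minimizer of the model does not increase `f`. -/
lemma Problem.Good.f_add_le (hq : q.Good) {y h : Fin d → ℝ} {η : ℝ}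
    (hres : ∀ z, |auxD q y h z| ≤ η * nm (form q.B) z)
    (hη : η ≤ q.L * nm (form q.B) h ^ 3 / 2) : q.f (y + h) ≤ q.f y := by
  have h1 := le_of_convexOn hq.smooth.1 hq.convex (y + h) y
  have h2 := (abs_le.1 (hq.abs_der1_add_le hres h)).2
  rw [show y - (y + h) = -h by abel, map_neg] at h1
  rw [← hq.form_psd.nm_sq h] at h2
  have nh : 0 ≤ nm (form q.B) h := nm_nonneg _
  have h3 := mul_le_mul_of_nonneg_right hη nh
  have h4 : 0 ≤ q.L * nm (form q.B) h ^ 4 := mul_nonneg hq.L_pos.le (by positivity)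
  nlinarith

/-- The gradient and Hessian terms use the derivative bounds along the segment between the centers,
which stays in the convex level set; the cubic term uses smoothness. The quartic term does not
involve the center. -/
lemma abs_auxD_center_sub_le (hq : q.Solvable) {C R : ℝ}
    (hC : ∀ y ∈ q.level, DerivBound q.f q.B C y) (hC0 : 0 ≤ C) {y y' h : Fin d → ℝ}
    (hy : y ∈ q.level) (hy' : y' ∈ q.level) (hh : nm (form q.B) h ≤ R) (z : Fin d → ℝ) :
    |auxD q y' h z - auxD q y h z| ≤
      (C + C * R + q.L * R ^ 2) * nm (form q.B) (y' - y) * nm (form q.B) z := by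
  have nz : 0 ≤ nm (form q.B) z := nm_nonneg _
  have nh : 0 ≤ nm (form q.B) h := nm_nonneg _
  have nw : 0 ≤ nm (form q.B) (y' - y) := nm_nonneg _
  have hL := hq.L_pos
  have hf := hq.smooth.1
  have hseg : ∀ t ∈ Icc (0 : ℝ) 1, y + t • (y' - y) ∈ q.level := fun t ht =>
    hq.convex_level.add_smul_sub_mem hy hy' ht
  have h1 : |der1 q.f y' z - der1 q.f y z| ≤ C * nm (form q.B) (y' - y) * nm (form q.B) z := by
    have := Convex.norm_image_sub_le_of_norm_hasDerivWithin_le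
      (fun t _ => (hasDerivAt_line_one hf y (y' - y) z t).hasDerivWithinAt)
      (fun t ht => (hC _ (hseg t ht)).two (y' - y) z) (convex_Icc (0 : ℝ) 1)
      (left_mem_Icc.2 zero_le_one) (right_mem_Icc.2 zero_le_one)
    simpa using this
  have h2 : |form (hess q.f y') h z - form (hess q.f y) h z| ≤
      C * nm (form q.B) (y' - y) * nm (form q.B) h * nm (form q.B) z := by
    have := Convex.norm_image_sub_le_of_norm_hasDerivWithin_le
      (fun t _ => (hasDerivAt_line_two hf y (y' - y) h z t).hasDerivWithinAt)
      (fun t ht => (hC _ (hseg t ht)).three (y' - y) h z) (convex_Icc (0 : ℝ) 1)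
      (left_mem_Icc.2 zero_le_one) (right_mem_Icc.2 zero_le_one)
    simpa using this
  have h3 := abs_der3_sub_le hq.pos hq.smooth y y' h z
  rw [(hq.symm3 y').left z, (hq.symm3 y').right h z, (hq.symm3 y).left z,
    (hq.symm3 y).right h z] at h3
  have e : auxD q y' h z - auxD q y h z = (der1 q.f y' z - der1 q.f y z) +
      (form (hess q.f y') h z - form (hess q.f y) h z) +
      1 / 2 * (der3 q.f y' h h z - der3 q.f y h h z) := by
    simp only [auxD, modelD]; ring
  have h4 : C * nm (form q.B) (y' - y) * nm (form q.B) h * nm (form q.B) z ≤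
      C * nm (form q.B) (y' - y) * R * nm (form q.B) z := by gcongr
  have h5 : q.L * nm (form q.B) (y' - y) * nm (form q.B) z * nm (form q.B) h ^ 2 ≤
      q.L * nm (form q.B) (y' - y) * nm (form q.B) z * R ^ 2 := by gcongr
  have h6 : 0 ≤ q.L * nm (form q.B) (y' - y) * nm (form q.B) z * R ^ 2 := by positivity
  rw [e, abs_le]
  rw [abs_le] at h1 h2 h3
  constructor <;> linarith

/-- Hölder continuity of approximate minimizers of the model in its center. -/
lemma nm_sub_pow_three_le (hq : q.Solvable) {C R η : ℝ}
    (hC : ∀ y ∈ q.level, DerivBound q.f q.B C y) (hC0 : 0 ≤ C) (hη : 0 ≤ η) {y y' h h' : Fin d → ℝ}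
    (hy : y ∈ q.level) (hy' : y' ∈ q.level) (hh' : nm (form q.B) h' ≤ R)
    (hres : ∀ z, |auxD q y h z| ≤ η * nm (form q.B) z)
    (hres' : ∀ z, |auxD q y' h' z| ≤ η * nm (form q.B) z) :
    q.L / 24 * nm (form q.B) (h' - h) ^ 3 ≤
      (C + C * R + q.L * R ^ 2) * nm (form q.B) (y' - y) + 2 * η := by
  have nw : 0 ≤ nm (form q.B) (h' - h) := nm_nonneg _
  have ny : 0 ≤ nm (form q.B) (y' - y) := nm_nonneg _
  have nh' : 0 ≤ nm (form q.B) h' := nm_nonneg _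
  have hR := nh'.trans hh'
  have hL := hq.L_pos
  have h1 := modelD_monotone (g := der1 q.f y) hq.form_psd (hq.hess_psd y) (hq.symm3 y)
    (hq.cubic y) hL.le h' h
  change _ ≤ auxD q y h' (h' - h) - auxD q y h (h' - h) at h1
  have h2 := (abs_le.1 (hres (h' - h))).1
  have h3 := (abs_le.1 (hres' (h' - h))).2
  have h4 := (abs_le.1 (abs_auxD_center_sub_le hq hC hC0 hy hy' hh' (h' - h))).1
  rcases nw.eq_or_lt with h0 | h0
  · rw [← h0]
    have h5 : 0 ≤ (C + C * R + q.L * R ^ 2) * nm (form q.B) (y' - y) := by positivity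
    simp only [ne_eq, OfNat.ofNat_ne_zero, not_false_eq_true, zero_pow, mul_zero]
    linarith
  · refine le_of_mul_le_mul_right ?_ h0
    nlinarith

end Level

/-! ### Growth of the weights by Hölder's inequality. -/

section Growth

/-- Weighted AM–GM, obtained from Bernoulli's inequality at `(p/q - 1)/5`. -/
lemma le_of_pow_five_le {u p q : ℝ} (hp : 0 ≤ p) (hq : 0 ≤ q) (h : u ^ 5 ≤ p * q ^ 4) :
    u ≤ 1 / 5 * p + 4 / 5 * q := by
  have h0 : 0 ≤ 1 / 5 * p + 4 / 5 * q := by positivity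
  by_contra! hlt
  have h1 : (1 / 5 * p + 4 / 5 * q) ^ 5 < u ^ 5 := pow_lt_pow_left₀ hlt h0 (by norm_num)
  have h2 : p * q ^ 4 ≤ (1 / 5 * p + 4 / 5 * q) ^ 5 := by
    rcases hq.eq_or_lt with rfl | hq
    · simp; positivity
    · have := one_add_mul_le_pow (a := (p / q - 1) / 5) (by
        have : 0 ≤ p / q := by positivity
        linarith) 5
      have e1 : 1 + ((5 : ℕ) : ℝ) * ((p / q - 1) / 5) = p / q := by push_cast; ring
      rw [e1] at this
      have h3 := mul_le_mul_of_nonneg_right this (by positivity : 0 ≤ q ^ 5)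
      calc p * q ^ 4 = p / q * q ^ 5 := by field_simp
        _ ≤ _ := h3
        _ = (q * (1 + (p / q - 1) / 5)) ^ 5 := by ring
        _ = _ := by congr 1; field_simp; ring
  linarith

/-- Hölder's inequality for two terms, with exponents `5` and `5/4`. -/
lemma add_pow_five_le {X y e x W w : ℝ} (hx : 0 < x) (hw : 0 < w) (he : 0 ≤ e) (hW : 0 ≤ W)
    (h1 : X ^ 5 ≤ e * W ^ 4) (h2 : y ^ 5 ≤ x * w ^ 4) :
    (X + y) ^ 5 ≤ (e + x) * (W + w) ^ 4 := by
  have hD : 0 < (e + x) * (W + w) ^ 4 := by positivity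
  obtain ⟨Z, hZ⟩ : ∃ Z, Z = ((e + x) * (W + w) ^ 4) ^ (1 / 5 : ℝ) := ⟨_, rfl⟩
  have hZ0 : 0 < Z := by rw [hZ]; exact Real.rpow_pos_of_pos hD _
  have hZ5 : Z ^ 5 = (e + x) * (W + w) ^ 4 := by
    rw [hZ, ← Real.rpow_natCast, ← Real.rpow_mul hD.le]; norm_num
  have key : ∀ {u p r : ℝ}, 0 ≤ p → 0 ≤ r → u ^ 5 ≤ p * r ^ 4 →
      u / Z ≤ 1 / 5 * (p / (e + x)) + 4 / 5 * (r / (W + w)) := by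
    intro u p r hp hr hu
    refine le_of_pow_five_le (by positivity) (by positivity) ?_
    rw [div_pow, div_pow, hZ5, div_mul_div_comm]
    gcongr
  have k1 := key he hW h1
  have k2 := key hx.le hw.le h2
  have k3 : (X + y) / Z ≤ 1 := by
    have e1 : e / (e + x) + x / (e + x) = 1 := by
      rw [← add_div, div_self (by positivity)]
    have e2 : W / (W + w) + w / (W + w) = 1 := by
      rw [← add_div, div_self (by positivity)]
    rw [add_div]; linarith
  rw [div_le_one hZ0] at k3
  rw [← hZ5]
  exact (Odd.strictMono_pow (by decide : Odd 5)).monotone k3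

/-- Lower bound on the growth of the weights after `k` accelerated steps, `E` being the accumulated
progress. -/
def Grows (L γ : ℝ) (k : ℕ) (A E : ℝ) : Prop :=
  ∃ ξ : ℝ, γ * k / 2 ≤ ξ ∧ 0 ≤ ξ ∧ ξ ^ 10 ≤ 64 * L * E * A ^ 2

lemma grows_zero (L γ : ℝ) : Grows L γ 0 0 0 := ⟨0, by simp, le_rfl, by simp⟩

/-- Here `ξ²` plays the role of `∑ A_i^{1/5}`. Hölder with weights `A_i L² ρ_i²` and `(Lρ_i)^{-1/2}`
carries the upper bound over; inserting `E' ≤ R2/2` makes the newest term `A'^{1/5}` at least `γξ'`,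
so `ξ` grows by at least `γ/2`. -/
lemma Grows.succ {L γ R2 A E A' E' ρ : ℝ} {k : ℕ} (h : Grows L γ k A E) (hL : 0 < L)
    (hγ0 : 0 < γ) (hγ : γ ^ 10 * (32 * L * R2) = 1) (hA : 0 ≤ A) (hE : 0 ≤ E) (hρ : 0 < ρ)
    (hA' : 0 < A') (hAA : 2 * Real.sqrt A + Real.sqrt (1 / (L * ρ)) ≤ 2 * Real.sqrt A')
    (hE' : E' = E + A' * L * ρ ^ 2 / 4) (hER : E' ≤ R2 / 2) : Grows L γ (k + 1) A' E' := by
  obtain ⟨ξ, h1, h2, h3⟩ := h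
  obtain ⟨y, hy⟩ : ∃ y, y = A' ^ (1 / 5 : ℝ) := ⟨_, rfl⟩
  have hy0 : 0 < y := by rw [hy]; exact Real.rpow_pos_of_pos hA' _
  have hy5 : y ^ 5 = A' := by
    rw [hy, ← Real.rpow_natCast, ← Real.rpow_mul hA'.le]; norm_num
  have hE'0 : 0 ≤ E' := by rw [hE']; positivity
  have key : (ξ ^ 2 + y) ^ 5 ≤ 64 * L * E' * A' ^ 2 := by
    have hl : Real.sqrt (1 / (L * ρ)) ^ 4 = (1 / (L * ρ)) ^ 2 := by
      rw [show 4 = 2 * 2 by norm_num, pow_mul, Real.sq_sqrt (by positivity)]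
    have hs : ∀ t : ℝ, 0 ≤ t → (2 * Real.sqrt t) ^ 4 = 16 * t ^ 2 := fun t ht => by
      rw [mul_pow, show Real.sqrt t ^ 4 = (Real.sqrt t ^ 2) ^ 2 by ring, Real.sq_sqrt ht]; norm_num
    have := add_pow_five_le (X := ξ ^ 2) (y := y) (e := 4 * L * E) (x := A' * L ^ 2 * ρ ^ 2)
      (W := 2 * Real.sqrt A) (w := Real.sqrt (1 / (L * ρ))) (by positivity) (by positivity)
      (by positivity) (by positivity) (by rw [hs A hA]; calc
        (ξ ^ 2) ^ 5 = ξ ^ 10 := by ring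
        _ ≤ _ := h3
        _ = _ := by ring) (by rw [hl, hy5]; apply le_of_eq; field_simp)
    refine this.trans ?_
    have h4 : 4 * L * E + A' * L ^ 2 * ρ ^ 2 = 4 * L * E' := by rw [hE']; ring
    rw [h4]
    calc 4 * L * E' * (2 * Real.sqrt A + Real.sqrt (1 / (L * ρ))) ^ 4 ≤
        4 * L * E' * (2 * Real.sqrt A') ^ 4 := by gcongr
      _ = _ := by rw [hs A' hA'.le]; ring
  have hX : 0 < ξ ^ 2 + y := by positivity
  have hξ' := Real.sq_sqrt hX.le
  have hξ'0 : 0 < Real.sqrt (ξ ^ 2 + y) := Real.sqrt_pos.2 hX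
  refine ⟨Real.sqrt (ξ ^ 2 + y), ?_, hξ'0.le, ?_⟩
  · generalize Real.sqrt (ξ ^ 2 + y) = ξ' at *
    have h5 : (γ ^ 2 * (ξ ^ 2 + y)) ^ 5 ≤ (y ^ 2) ^ 5 := by
      have h6 : (ξ ^ 2 + y) ^ 5 ≤ 32 * L * R2 * A' ^ 2 := by
        refine key.trans ?_
        have : 0 ≤ L * A' ^ 2 := by positivity
        nlinarith
      calc (γ ^ 2 * (ξ ^ 2 + y)) ^ 5 = γ ^ 10 * (ξ ^ 2 + y) ^ 5 := by ring
        _ ≤ γ ^ 10 * (32 * L * R2 * A' ^ 2) := by gcongr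
        _ = (γ ^ 10 * (32 * L * R2)) * A' ^ 2 := by ring
        _ = (y ^ 2) ^ 5 := by rw [hγ, ← hy5]; ring
    have h6 : γ ^ 2 * (ξ ^ 2 + y) ≤ y ^ 2 :=
      le_of_pow_le_pow_left₀ (by norm_num) (by positivity) h5
    have h7 : γ * ξ' ≤ y := by
      rw [← hξ', ← mul_pow] at h6
      exact le_of_pow_le_pow_left₀ (by norm_num) hy0.le h6
    have h8 : ξ ≤ ξ' := by
      refine le_of_pow_le_pow_left₀ (n := 2) (by norm_num) hξ'0.le ?_
      rw [hξ']; linarith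
    -- The new term `y` equals `ξ'² - ξ²`, which is at most `2ξ'(ξ' - ξ)`.
    have h9 : γ * ξ' ≤ (ξ' - ξ) * 2 * ξ' := by nlinarith
    have h10 := le_of_mul_le_mul_right h9 hξ'0
    push_cast
    linarith
  · calc Real.sqrt (ξ ^ 2 + y) ^ 10 = (Real.sqrt (ξ ^ 2 + y) ^ 2) ^ 5 := by ring
      _ ≤ _ := by rw [hξ']; exact key

lemma Grows.le {L γ R2 A E : ℝ} {k : ℕ} (h : Grows L γ k A E) (hL : 0 < L) (hR : 0 < R2)
    (hγ0 : 0 < γ) (hγ : γ ^ 10 * (32 * L * R2) = 1) (hA : 0 ≤ A) (hER : E ≤ R2 / 2) :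
    (k : ℝ) ^ 5 ≤ 1024 * L * R2 * A := by
  obtain ⟨ξ, h1, h2, h3⟩ := h
  have h4 : (γ * k / 2) ^ 10 ≤ 32 * L * R2 * A ^ 2 := by
    refine (pow_le_pow_left₀ (by positivity) h1 10).trans (h3.trans ?_)
    have : 0 ≤ L * A ^ 2 := by positivity
    nlinarith
  have h5 : (k : ℝ) ^ 10 ≤ (1024 * L * R2 * A) ^ 2 := by
    have := mul_le_mul_of_nonneg_right h4 (by positivity : 0 ≤ 2 ^ 10 * (32 * L * R2))
    calc (k : ℝ) ^ 10 = γ ^ 10 * (32 * L * R2) * k ^ 10 := by rw [hγ, one_mul]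
      _ = (γ * k / 2) ^ 10 * (2 ^ 10 * (32 * L * R2)) := by ring
      _ ≤ _ := this
      _ = _ := by ring
  refine le_of_pow_le_pow_left₀ (n := 2) (by norm_num) (by positivity) ?_
  rw [← pow_mul]; exact h5

end Growth

/-! ### The step size equation and the mixing weight. -/

section StepSize

variable {d : ℕ} {q : Problem d} {A ρ : ℝ}

lemma stepSize_pos (hL : 0 < q.L) (hρ : 0 < ρ) : 0 < stepSize q A ρ := by
  rw [stepSize]; positivity

lemma stepSize_eq (hL : 0 < q.L) (hA : 0 ≤ A) (hρ : 0 < ρ) :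
    q.L * ρ * stepSize q A ρ ^ 2 = A + stepSize q A ρ := by
  have h := Real.sq_sqrt (by positivity : 0 ≤ 1 + 4 * q.L * A * ρ)
  rw [stepSize]
  generalize Real.sqrt (1 + 4 * q.L * A * ρ) = r at *
  field_simp
  linear_combination h

lemma sqrt_add_stepSize_ge (hL : 0 < q.L) (hA : 0 ≤ A) (hρ : 0 < ρ) :
    2 * Real.sqrt A + Real.sqrt (1 / (q.L * ρ)) ≤ 2 * Real.sqrt (A + stepSize q A ρ) := by
  have h1 := stepSize_eq hL hA hρ
  have h2 : 0 < stepSize q A ρ := stepSize_pos hL hρ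
  generalize stepSize q A ρ = a at *
  have hu := Real.sq_sqrt hA
  have hl := Real.sq_sqrt (by positivity : 0 ≤ 1 / (q.L * ρ))
  have hu0 := Real.sqrt_nonneg A
  have hl0 : 0 < Real.sqrt (1 / (q.L * ρ)) := by positivity
  generalize Real.sqrt A = u at *
  generalize Real.sqrt (1 / (q.L * ρ)) = l at *
  have h3 : a ^ 2 = l ^ 2 * (u ^ 2 + a) := by
    rw [hu, ← h1, hl]; field_simp
  have h4 : l ^ 2 ≤ a := by
    have : 0 ≤ l ^ 2 * u ^ 2 := by positivity
    have : l ^ 2 * a ≤ a * a := by nlinarith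
    exact le_of_mul_le_mul_right this h2
  have h5 : l * u ≤ a - l ^ 2 / 2 := by
    refine abs_le_of_sq_le_sq' ?_ (by nlinarith) |>.2
    nlinarith [sq_nonneg (l ^ 2)]
  have h6 : (u + l / 2) ≤ Real.sqrt (A + a) := by
    refine Real.le_sqrt_of_sq_le ?_
    nlinarith [sq_nonneg l]
  linarith

/-- The mixing weight `a / (A + a)`. -/
lemma mixWeight_spec (hL : 0 < q.L) (hA : 0 ≤ A) (hρ : 0 < ρ) :
    let τ := stepSize q A ρ / (A + stepSize q A ρ)
    0 < τ ∧ τ ≤ 1 ∧ q.L * A * ρ * τ ^ 2 = 1 - τ := by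
  have h1 := stepSize_eq hL hA hρ
  have h2 : 0 < stepSize q A ρ := stepSize_pos hL hρ
  generalize stepSize q A ρ = a at *
  have h3 : 0 < A + a := by positivity
  refine ⟨by positivity, (div_le_one h3).2 (by linarith), ?_⟩
  field_simp
  linear_combination A * h1

/-- Eliminating `LA` between the two equations `LAρτ² = 1 - τ` gives a Lipschitz constant
independent of `A`, which may be arbitrarily large. -/
lemma mixWeight_sub_le (hL : 0 < q.L) (hA : 0 ≤ A) {ρ' : ℝ} (hρ : 0 < ρ) (hle : ρ ≤ ρ') :
    |stepSize q A ρ' / (A + stepSize q A ρ') - stepSize q A ρ / (A + stepSize q A ρ)| ≤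
      (ρ' - ρ) / ρ := by
  obtain ⟨a1, a2, a3⟩ := mixWeight_spec (q := q) hL hA hρ
  obtain ⟨b1, b2, b3⟩ := mixWeight_spec (q := q) hL hA (hρ.trans_le hle)
  generalize stepSize q A ρ' / (A + stepSize q A ρ') = t' at *
  generalize stepSize q A ρ / (A + stepSize q A ρ) = t at *
  have e : ρ * (t - t') * (t + t' - t * t') = (ρ' - ρ) * t' ^ 2 * (1 - t) := by
    rcases hA.eq_or_lt with rfl | hA
    · have : t = 1 := by linarith
      have : t' = 1 := by linarith
      subst_vars; ring
    · have hLA : q.L * A ≠ 0 := by positivity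
      refine mul_left_cancel₀ hLA ?_
      linear_combination (1 - t') * a3 - (1 - t) * b3
  have hm : t' ≤ t + t' - t * t' := by nlinarith
  have hd : 0 ≤ ρ' - ρ := sub_nonneg.2 hle
  have h0 : t' ≤ t := by
    by_contra! hlt
    have : ρ * (t - t') * (t + t' - t * t') < 0 :=
      mul_neg_of_neg_of_pos (mul_neg_of_pos_of_neg hρ (by linarith)) (by linarith)
    have : 0 ≤ (ρ' - ρ) * t' ^ 2 * (1 - t) :=
      mul_nonneg (mul_nonneg hd (sq_nonneg _)) (by linarith)
    linarith
  rw [abs_sub_comm, abs_of_nonneg (sub_nonneg.2 h0), le_div_iff₀ hρ]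
  have h1 : (t - t') * ρ * t' ≤ (ρ' - ρ) * t' := by
    calc (t - t') * ρ * t' ≤ (t - t') * ρ * (t + t' - t * t') :=
          mul_le_mul_of_nonneg_left hm (mul_nonneg (sub_nonneg.2 h0) hρ.le)
      _ = (ρ' - ρ) * t' ^ 2 * (1 - t) := by rw [← e]; ring
      _ ≤ (ρ' - ρ) * t' ^ 2 * 1 := by
        refine mul_le_mul_of_nonneg_left (by linarith) (by positivity)
      _ = (ρ' - ρ) * t' * t' := by ring
      _ ≤ (ρ' - ρ) * t' * 1 := by
        refine mul_le_mul_of_nonneg_left b2 (by positivity)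
      _ = _ := by ring
  exact le_of_mul_le_mul_right h1 b1

end StepSize

/-! ### The estimate-sequence potential. -/

section Potential

variable {d : ℕ} {q : Problem d}

/-- The minimizer `v_k` of the estimate function of a state. -/
def center (q : Problem d) (s : State d) : Fin d → ℝ := q.x0 - (callSolve q.B s.S).val

/-- The estimate-sequence certificate of a state, `E` being the accumulated progress. -/
structure Cert (q : Problem d) (s : State d) (E : ℝ) : Prop where
  A_nonneg : 0 ≤ s.A
  E_nonneg : 0 ≤ E
  exists_const : ∃ c, (∀ z, s.S ⬝ᵥ z + c ≤ s.A * q.f z) ∧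
    ∀ z, s.A * q.f s.x + E + 1 / 2 * nm (form q.B) (z - center q s) ^ 2 ≤
      1 / 2 * nm (form q.B) (z - q.x0) ^ 2 + s.S ⬝ᵥ z + c

lemma cert_zero (q : Problem d) : Cert q ⟨q.x0, 0, 0⟩ 0 where
  A_nonneg := le_rfl
  E_nonneg := le_rfl
  exists_const := ⟨0, by simp, by simp [center, callSolve_zero]⟩

lemma Cert.bound {s : State d} {E : ℝ} (h : Cert q s E) :
    s.A * (q.f s.x - q.f q.xs) + E + 1 / 2 * nm (form q.B) (q.xs - center q s) ^ 2 ≤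
      1 / 2 * nm (form q.B) (q.x0 - q.xs) ^ 2 := by
  obtain ⟨c, h1, h2⟩ := h.exists_const
  have h3 := h1 q.xs
  have h4 := h2 q.xs
  rw [nm_sub_comm q.xs q.x0] at h4
  linarith

lemma Cert.E_le (hq : q.Solvable) {s : State d} {E : ℝ} (h : Cert q s E) :
    E ≤ nm (form q.B) (q.x0 - q.xs) ^ 2 / 2 := by
  have h1 := h.bound
  have h2 := mul_nonneg h.A_nonneg (sub_nonneg.2 (hq.min s.x))
  have h3 := sq_nonneg (nm (form q.B) (q.xs - center q s))
  linarith

/-- The potential keeps the center no farther from the minimizer than the start was, hence within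
twice that distance of the start. This explains the factor `4` in `𝒦`. -/
lemma Cert.center_mem (hq : q.Solvable) {s : State d} {E : ℝ} (h : Cert q s E) :
    center q s ∈ q.level := by
  refine hq.mem_level ?_
  have h1 := h.bound
  have h2 := mul_nonneg h.A_nonneg (sub_nonneg.2 (hq.min s.x))
  have h4 := h.E_nonneg
  have h5 : nm (form q.B) (q.xs - center q s) ≤ nm (form q.B) (q.x0 - q.xs) := by
    refine le_of_pow_le_pow_left₀ (n := 2) (by norm_num) (nm_nonneg _) ?_
    linarith
  have h6 := hq.form_psd.nm_add_le (center q s - q.xs) (q.xs - q.x0)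
  rw [sub_add_sub_cancel, nm_sub_comm _ q.xs, nm_sub_comm q.xs q.x0] at h6
  linarith

lemma add_smul_mixPoint (x v : Fin d → ℝ) {A a : ℝ} (h : A + a ≠ 0) :
    (A + a) • mixPoint x v A a = A • x + a • v := by
  rw [mixPoint, smul_add, smul_smul, smul_smul]
  congr 2 <;> field_simp
  ring

lemma Cert.step (hq : q.Solvable) {s : State d} {E ρ : ℝ} (hs : Cert q s E) (hρ : 0 < ρ)
    {h : Fin d → ℝ} {y x' : Fin d → ℝ}
    (hy : y = mixPoint s.x (center q s) s.A (stepSize q s.A ρ)) (hx' : x' = y + h)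
    (hres : ∀ z, |der1 q.f x' z + q.L * ρ * form q.B h z| ≤
      1 / 2 * (q.L * ρ) * nm (form q.B) h * nm (form q.B) z)
    (hζ : 2 / 3 * ρ ≤ nm (form q.B) h ^ 2) :
    Cert q ⟨x', s.A + stepSize q s.A ρ, s.S + stepSize q s.A ρ • grad q.f x'⟩
      (E + (s.A + stepSize q s.A ρ) * q.L * ρ ^ 2 / 4) := by
  have hL := hq.L_pos
  have hA := hs.A_nonneg
  have hb := hq.form_psd
  have ha := stepSize_pos (A := s.A) hL hρ
  have haeq := stepSize_eq hL hA hρ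
  set a := stepSize q s.A ρ
  have hA' : 0 < s.A + a := by linarith
  set v := center q s with hv
  set w := (callSolve q.B (grad q.f x')).val with hw
  have hwz : ∀ z, form q.B w z = der1 q.f x' z := fun z => by
    rw [hw, form_callSolve hq.pos, grad_dot]
  obtain ⟨c, h1, h2⟩ := hs.exists_const
  refine ⟨hA'.le, ?_, c + a * (q.f x' - der1 q.f x' x'), fun z => ?_, fun z => ?_⟩
  · have := hs.E_nonneg; positivity
  · have h3 := le_of_convexOn hq.smooth.1 hq.convex x' z
    have h4 := mul_le_mul_of_nonneg_left h3 ha.le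
    rw [map_sub] at h4
    simp only [add_dotProduct, smul_dotProduct, grad_dot, smul_eq_mul]
    linarith [h1 z]
  · have hc : center q ⟨x', s.A + a, s.S + a • grad q.f x'⟩ = v - a • w := by
      simp only [center, hv, hw, callSolve, Matrix.mulVec_add, Matrix.mulVec_smul]
      abel
    rw [hc]
    simp only [add_dotProduct, smul_dotProduct, grad_dot, smul_eq_mul]
    have e1 : nm (form q.B) (z - (v - a • w)) ^ 2 = nm (form q.B) (z - v) ^ 2 +
        2 * a * der1 q.f x' (z - v) + a ^ 2 * form q.B w w := by
      rw [show z - (v - a • w) = (z - v) + a • w by abel, hb.nm_sq, hb.nm_sq]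
      simp only [map_add, LinearMap.add_apply, map_smul, LinearMap.smul_apply, smul_eq_mul,
        hb.symm (z - v) w, hwz]
      ring
    have h3 := le_of_convexOn hq.smooth.1 hq.convex x' s.x
    have h4 := mul_le_mul_of_nonneg_left h3 hA
    have e2 : s.A * der1 q.f x' (s.x - x') + a * der1 q.f x' (v - x') =
        -((s.A + a) * der1 q.f x' h) := by
      have := congrArg (der1 q.f x') (add_smul_mixPoint s.x v hA'.ne')
      rw [← hy] at this
      simp only [map_add, map_smul, smul_eq_mul] at this
      have e3 : h = x' - y := by rw [hx']; abel
      rw [e3]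
      simp only [map_sub]
      linarith
    -- With `l = Lρ` and defect `e = w + l h`, the difference `-⟨w,h⟩ - ‖w‖²/(2l)` equals `l‖h‖²/2 -
    -- ‖e‖²/(2l)`, at least `(3/8) l‖h‖²`. The hypothesis `‖h‖² ≥ (2/3)ρ` yields the gain; the term
    -- in `w` pays for the move of the center.
    have key : q.L * ρ ^ 2 / 4 + form q.B w w / (2 * (q.L * ρ)) ≤ - der1 q.f x' h := by
      set l := q.L * ρ with hl
      have hl0 : 0 < l := by positivity
      set e := w + l • h with he
      have k1 : nm (form q.B) e ≤ 1 / 2 * l * nm (form q.B) h := by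
        have k2 := hres e
        rw [← hwz] at k2
        have k3 : form q.B w e + l * form q.B h e = nm (form q.B) e ^ 2 := by
          rw [hb.nm_sq]
          have : form q.B (w + l • h) e = form q.B w e + l * form q.B h e := by simp
          rw [← this, ← he]
        rw [k3, abs_of_nonneg (sq_nonneg _)] at k2
        have k4 : 0 ≤ nm (form q.B) e := nm_nonneg _
        have k5 : 0 ≤ nm (form q.B) h := nm_nonneg _
        rcases k4.eq_or_lt with k4 | k4
        · rw [← k4]; positivity
        · nlinarith
      have k2 : form q.B e e ≤ 1 / 4 * l ^ 2 * form q.B h h := by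
        rw [← hb.nm_sq, ← hb.nm_sq]
        have := pow_le_pow_left₀ (nm_nonneg e) k1 2
        linarith
      rw [hb.nm_sq] at hζ
      have k3 : form q.B e e = form q.B w w + 2 * l * form q.B w h + l ^ 2 * form q.B h h := by
        simp only [he, map_add, LinearMap.add_apply, map_smul, LinearMap.smul_apply, smul_eq_mul,
          hb.symm h w]
        ring
      rw [← hwz]
      have k4 : q.L * ρ ^ 2 / 4 ≤ 3 / 8 * l * form q.B h h := by
        rw [hl]
        have : 0 ≤ q.L * ρ := by positivity
        nlinarith
      have k5 : form q.B w w / (2 * l) = form q.B e e / (2 * l) - form q.B w h -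
          l * form q.B h h / 2 := by
        rw [k3]; field_simp; ring
      have k6 : form q.B e e / (2 * l) ≤ l * form q.B h h / 8 := by
        rw [div_le_iff₀ (by positivity)]
        nlinarith
      linarith
    have key2 := mul_le_mul_of_nonneg_left key hA'.le
    have e4 : (s.A + a) * (form q.B w w / (2 * (q.L * ρ))) = 1 / 2 * a ^ 2 * form q.B w w := by
      rw [← haeq]; field_simp
    rw [mul_add, e4] at key2
    rw [e1]
    have h5 := h2 z
    simp only [map_sub] at e2 h4 ⊢
    linarith

end Potential

/-! ### Success of the search for `ρ`, and the run of the method. -/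

section Search

variable {d : ℕ} {q : Problem d} {p : Init}

/-- The squared length of the step of `ApproxAuxMin` at `y`. -/
def stepSq (q : Problem d) (p : Init) (y : Fin d → ℝ) : ℝ :=
  nm (form q.B) (auxLoop q p y p.K 0).val ^ 2

lemma approxAuxMin_val (y : Fin d → ℝ) :
    (approxAuxMin q p y).val = y + (auxLoop q p y p.K 0).val := rfl

lemma bNorm_approxAuxMin_sub (y : Fin d → ℝ) :
    bNorm q.B ((approxAuxMin q p y).val - y) ^ 2 = stepSq q p y := by
  rw [approxAuxMin_val, add_sub_cancel_left, bNorm_eq_nm, stepSq]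

/-- The point `y(ρ)`. -/
def proxCenter (q : Problem d) (x v : Fin d → ℝ) (A ρ : ℝ) : Fin d → ℝ :=
  mixPoint x v A (stepSize q A ρ)

/-- The bisection preserves a strict disagreement at its ends. The end `P` is never tested, so it
enters as a separate alternative. -/
lemma rhoLoop_spec {x v : Fin d → ℝ} {A ρ0 P W : ℝ}
    (hgo : ∀ lo hi, ρ0 ≤ lo → lo ≤ hi → hi ≤ P → hi - lo ≤ W →
      lo + delta q p ≤ stepSq q p (proxCenter q x v A lo) →
      (hi = P ∨ stepSq q p (proxCenter q x v A hi) + delta q p ≤ hi) → False) (n : ℕ) :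
    ∀ (lo hi : ℝ) (last : (Fin d → ℝ) × ℝ), ρ0 ≤ lo → lo ≤ hi → hi ≤ P → (hi - lo) / 2 ^ n ≤ W →
      lo + delta q p ≤ stepSq q p (proxCenter q x v A lo) →
      (hi = P ∨ stepSq q p (proxCenter q x v A hi) + delta q p ≤ hi) →
      ∃ ρ, ρ0 ≤ ρ ∧ ρ ≤ P ∧ |stepSq q p (proxCenter q x v A ρ) - ρ| ≤ delta q p ∧
        (rhoLoop q p x v A n lo hi last).val =
          (ρ, (approxAuxMin q p (proxCenter q x v A ρ)).val, stepSize q A ρ) := by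
  induction n with
  | zero =>
    intro lo hi last h1 h2 h3 h4 h5 h6
    -- Exhausting the iterations would leave a forbidden bracket, so the fallback value is never
    -- returned.
    exact (hgo lo hi h1 h2 h3 (by simpa using h4) h5 h6).elim
  | succ n ih =>
    intro lo hi last h1 h2 h3 h4 h5 h6
    have hw1 : ((lo + hi) / 2 - lo) / 2 ^ n ≤ W := by
      refine le_trans (le_of_eq ?_) h4
      rw [pow_succ]; field_simp; ring
    have hw2 : (hi - (lo + hi) / 2) / 2 ^ n ≤ W := by
      refine le_trans (le_of_eq ?_) h4
      rw [pow_succ]; field_simp; ring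
    have e := bNorm_approxAuxMin_sub (q := q) (p := p)
      (mixPoint x v A (stepSize q A ((lo + hi) / 2)))
    rw [rhoLoop, bind_val]
    simp only [e]
    split_ifs with c1 c2
    · exact ih _ _ _ h1 (by linarith) (by linarith) hw1 h5 (Or.inr c1.le)
    · refine ih _ _ _ (by linarith) (by linarith) h3 hw2 ?_ h6
      rw [proxCenter]; linarith
    · refine ⟨(lo + hi) / 2, by linarith, by linarith, ?_, rfl⟩
      rw [proxCenter, abs_le]
      constructor <;> linarith

/-- Parameters of the method that are small enough, at scale `e`, for the problem. -/
structure Tuned (q : Problem d) (p : Init) (C R e : ℝ) : Prop where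
  e_pos : 0 < e
  rho_eq : p.rho = e ^ 2
  C_nonneg : 0 ≤ C
  deriv : ∀ y ∈ q.level, DerivBound q.f q.B C y
  aux : ∀ y ∈ q.level, nm (form q.B) (auxLoop q p y p.K 0).val ≤ R ∧
    ∀ z, |auxD q y (auxLoop q p y p.K 0).val z| ≤ e ^ 10 * nm (form q.B) z
  delta_le : delta q p ≤ e ^ 2 / 10
  delta_le_Q : delta q p ≤ q.Q * p.eps ^ (1 / 4 : ℝ)
  Q_le : q.Q * p.eps ^ (1 / 4 : ℝ) ≤ e ^ 2
  eta_le : e ^ 10 ≤ q.L * e ^ 3 / 100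
  stop_le : (10 * q.L * e ^ 3 + e ^ 10) * (2 * e + Real.sqrt q.P) ≤ e
  modulus : ∀ t : ℝ, 0 ≤ t →
    q.L / 24 * t ^ 3 ≤ (C + C * R + q.L * R ^ 2) * (q.P * e ^ 11 * Real.sqrt q.P) + 2 * e ^ 10 →
    2 * R * t ≤ delta q p
  width : q.P * e ^ 13 < delta q p
  M_eq : ((2 : ℝ) ^ p.M)⁻¹ = e ^ 13

namespace Tuned

variable {C R e : ℝ}

lemma R_nonneg (ht : Tuned q p C R e) (hq : q.Solvable) : 0 ≤ R :=
  (nm_nonneg _).trans (ht.aux _ hq.x0_mem).1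

/-- A step that is not too short does not increase `f`. -/
lemma f_le (ht : Tuned q p C R e) (hq : q.Solvable) {y : Fin d → ℝ} (hy : y ∈ q.level)
    (hr : 0.81 * e ^ 2 ≤ stepSq q p y) : (approxAuxMin q p y).val ∈ q.level := by
  have he := ht.e_pos
  have h1 : q.f (y + (auxLoop q p y p.K 0).val) ≤ q.f y := by
    refine hq.f_add_le (ht.aux y hy).2 (ht.eta_le.trans ?_)
    rw [stepSq] at hr
    have nh : 0 ≤ nm (form q.B) (auxLoop q p y p.K 0).val := nm_nonneg _
    generalize nm (form q.B) (auxLoop q p y p.K 0).val = r at *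
    have h2 : 0.9 * e ≤ r := by
      refine le_of_pow_le_pow_left₀ (n := 2) (by norm_num) nh ?_
      linarith
    have h3 : (0.9 * e) ^ 3 ≤ r ^ 3 := pow_le_pow_left₀ (by positivity) h2 3
    have h4 := mul_le_mul_of_nonneg_left h3 hq.L_pos.le
    have h5 : 0 ≤ q.L * e ^ 3 := mul_nonneg hq.L_pos.le (by positivity)
    linarith
  exact h1.trans hy

lemma stepSq_le (ht : Tuned q p C R e) (hq : q.Solvable) {y : Fin d → ℝ} (hy : y ∈ q.level)
    (hr : 0.81 * e ^ 2 ≤ stepSq q p y) : stepSq q p y ≤ q.P := by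
  have := hq.nm_sub_sq_le (ht.f_le hq hy hr) hy
  rwa [approxAuxMin_val, add_sub_cancel_left] at this

lemma proxCenter_mem (hq : q.Solvable) {x v : Fin d → ℝ} {A ρ : ℝ} (hx : x ∈ q.level)
    (hv : v ∈ q.level) (hA : 0 ≤ A) (hρ : 0 < ρ) : proxCenter q x v A ρ ∈ q.level := by
  obtain ⟨h1, h2, _⟩ := mixWeight_spec (q := q) hq.L_pos hA hρ
  exact hq.convex_level hx hv (sub_nonneg.2 h2) h1.le (by ring)

/-- The two tests put the squared step lengths at least `2δ̃ - (hi - lo) > δ̃` apart, whereas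
continuity of the step allows at most `δ̃`. -/
lemma no_gap (ht : Tuned q p C R e) (hq : q.Solvable) {x v : Fin d → ℝ} {A : ℝ}
    (hx : x ∈ q.level) (hv : v ∈ q.level) (hA : 0 ≤ A) (lo hi : ℝ) (h1 : p.rho ≤ lo) (h2 : lo ≤ hi)
    (h4 : hi - lo ≤ q.P * e ^ 13)
    (h5 : lo + delta q p ≤ stepSq q p (proxCenter q x v A lo))
    (h6 : hi = q.P ∨ stepSq q p (proxCenter q x v A hi) + delta q p ≤ hi) : False := by
  have he := ht.e_pos
  have hP := q.P_nonneg
  have hwidth := ht.width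
  have hδ : 0 < delta q p := lt_of_le_of_lt (by positivity) hwidth
  rw [ht.rho_eq] at h1
  have he2 : 0 < e ^ 2 := by positivity
  have hlo : 0 < lo := he2.trans_le h1
  have hylo := proxCenter_mem hq hx hv hA hlo
  have hyhi := proxCenter_mem hq hx hv hA (hlo.trans_le h2)
  -- At the untested end `𝒫`: the step from the lower center stays in the level set, so its squared
  -- length is at most `𝒫`, too little for the test at `lo` so close to `𝒫`.
  rcases h6 with rfl | h6
  · have := ht.stepSq_le hq hylo (by linarith)
    linarith
  · obtain ⟨a1, a2⟩ := ht.aux _ hylo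
    obtain ⟨b1, b2⟩ := ht.aux _ hyhi
    have hR := ht.R_nonneg hq
    have hy : nm (form q.B) (proxCenter q x v A lo - proxCenter q x v A hi) ≤
        q.P * e ^ 11 * Real.sqrt q.P := by
      have e1 : proxCenter q x v A lo - proxCenter q x v A hi =
          (stepSize q A hi / (A + stepSize q A hi) - stepSize q A lo / (A + stepSize q A lo)) •
            (x - v) := by
        simp only [proxCenter, mixPoint, sub_smul, smul_sub, one_smul]; abel
      rw [e1, nm_smul]
      refine mul_le_mul ?_ (hq.nm_sub_le_sqrt hx hv) (nm_nonneg _) (by positivity)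
      refine (mixWeight_sub_le hq.L_pos hA hlo h2).trans ?_
      rw [div_le_iff₀ hlo]
      calc hi - lo ≤ q.P * e ^ 13 := h4
        _ = q.P * e ^ 11 * e ^ 2 := by ring
        _ ≤ _ := by gcongr
    have h7 := nm_sub_pow_three_le hq ht.deriv ht.C_nonneg (by positivity) hyhi hylo a1 b2 a2
    have hC := ht.C_nonneg
    have hL := hq.L_pos
    have h8 := ht.modulus _ (nm_nonneg _) (h7.trans (by gcongr))
    have h9 := (abs_le.1 (hq.form_psd.abs_nm_sub_le
      (auxLoop q p (proxCenter q x v A lo) p.K 0).val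
      (auxLoop q p (proxCenter q x v A hi) p.K 0).val)).2
    simp only [stepSq] at h5 h6
    have nn : 0 ≤ nm (form q.B) ((auxLoop q p (proxCenter q x v A lo) p.K 0).val -
      (auxLoop q p (proxCenter q x v A hi) p.K 0).val) := nm_nonneg _
    have n1 : 0 ≤ nm (form q.B) (auxLoop q p (proxCenter q x v A lo) p.K 0).val := nm_nonneg _
    have n2 : 0 ≤ nm (form q.B) (auxLoop q p (proxCenter q x v A hi) p.K 0).val := nm_nonneg _
    generalize nm (form q.B) (auxLoop q p (proxCenter q x v A lo) p.K 0).val = r1 at *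
    generalize nm (form q.B) (auxLoop q p (proxCenter q x v A hi) p.K 0).val = r2 at *
    have h10 : r1 ^ 2 - r2 ^ 2 ≤ delta q p := by
      refine le_trans ?_ h8
      have : (r1 - r2) * (r1 + r2) ≤ _ * (r1 + r2) :=
        mul_le_mul_of_nonneg_right h9 (by linarith)
      nlinarith
    linarith

/-- The outcome of `RhoSearch`. -/
lemma rhoSearch_spec (ht : Tuned q p C R e) (hq : q.Solvable) {x v : Fin d → ℝ} {A : ℝ}
    (hx : x ∈ q.level) (hv : v ∈ q.level) (hA : 0 ≤ A)
    (hstart : p.rho + q.Q * p.eps ^ (1 / 4 : ℝ) ≤ stepSq q p (proxCenter q x v A p.rho)) :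
    ∃ ρ, p.rho ≤ ρ ∧ |stepSq q p (proxCenter q x v A ρ) - ρ| ≤ delta q p ∧
      (rhoSearch q p x v A).val =
        (ρ, (approxAuxMin q p (proxCenter q x v A ρ)).val, stepSize q A ρ) := by
  have he := ht.e_pos
  have hP := q.P_nonneg
  have he2 : 0 < e ^ 2 := by positivity
  have hrho : 0 < p.rho := by rw [ht.rho_eq]; exact he2
  have hδ : 0 < delta q p := lt_of_le_of_lt (by positivity) ht.width
  have h0 : p.rho + delta q p ≤ stepSq q p (proxCenter q x v A p.rho) := by
    linarith [ht.delta_le_Q]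
  have h1 := ht.stepSq_le hq (proxCenter_mem hq hx hv hA hrho) (by
    rw [← ht.rho_eq]; linarith)
  obtain ⟨ρ, r1, _, r3, r4⟩ := rhoLoop_spec (q := q) (p := p) (x := x) (v := v) (A := A)
    (ρ0 := p.rho) (P := q.P) (W := q.P * e ^ 13)
    (fun lo hi a1 a2 _ a4 a5 a6 => ht.no_gap hq hx hv hA lo hi a1 a2 a4 a5 a6) p.M p.rho q.P (x, 0)
    le_rfl (by linarith) le_rfl (by
      rw [div_eq_mul_inv, ht.M_eq]
      refine mul_le_mul_of_nonneg_right (by linarith) (by positivity)) h0 (Or.inl rfl)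
  exact ⟨ρ, r1, r3, r4⟩

/-- A short step certifies near-optimality. -/
lemma stop_gap_le (ht : Tuned q p C R e) (hq : q.Solvable) {y : Fin d → ℝ} (hy : y ∈ q.level)
    (hr : stepSq q p y ≤ 2 * e ^ 2) : q.f (approxAuxMin q p y).val - q.f q.xs ≤ e := by
  have he := ht.e_pos
  have hL := hq.L_pos
  have hb := hq.form_psd
  rw [approxAuxMin_val]
  obtain ⟨_, h1⟩ := ht.aux y hy
  rw [stepSq] at hr
  set h := (auxLoop q p y p.K 0).val
  have nh : 0 ≤ nm (form q.B) h := nm_nonneg _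
  have h2 : nm (form q.B) h ≤ 2 * e := by
    refine le_of_pow_le_pow_left₀ (n := 2) (by norm_num) (by positivity) ?_
    nlinarith [sq_nonneg e]
  have h3 := le_of_convexOn hq.smooth.1 hq.convex (y + h) q.xs
  have h4 := hq.abs_der1_add_le h1 (q.xs - (y + h))
  have h5 := hb.abs_apply_le h (q.xs - (y + h))
  have h6 : nm (form q.B) (q.xs - (y + h)) ≤ 2 * e + Real.sqrt q.P := by
    have := hb.nm_sub_le (q.xs - y) h
    rw [show q.xs - y - h = q.xs - (y + h) by abel] at this
    linarith [hq.nm_sub_le_sqrt hq.xs_mem hy]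
  have nz : 0 ≤ nm (form q.B) (q.xs - (y + h)) := nm_nonneg _
  set z := q.xs - (y + h)
  have h7 : nm (form q.B) h ^ 3 ≤ (2 * e) ^ 3 := pow_le_pow_left₀ nh h2 3
  have h8 : q.L * nm (form q.B) h ^ 2 * |form q.B h z| ≤
      q.L * nm (form q.B) h ^ 3 * nm (form q.B) z := by
    calc _ ≤ q.L * nm (form q.B) h ^ 2 * (nm (form q.B) h * nm (form q.B) z) := by gcongr
      _ = _ := by ring
  have h9 : -(der1 q.f (y + h) z) ≤ (7 / 6 * (q.L * nm (form q.B) h ^ 3) + e ^ 10) *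
      nm (form q.B) z := by
    have h10 := (abs_le.1 h4).1
    have h11 : q.L * nm (form q.B) h ^ 2 * form q.B h z ≤
      q.L * nm (form q.B) h ^ 2 * |form q.B h z| :=
        mul_le_mul_of_nonneg_left (le_abs_self _) (by positivity)
    linarith
  have h10 : (7 / 6 * (q.L * nm (form q.B) h ^ 3) + e ^ 10) * nm (form q.B) z ≤
      (10 * q.L * e ^ 3 + e ^ 10) * (2 * e + Real.sqrt q.P) := by
    refine mul_le_mul ?_ h6 nz (by positivity)
    have := mul_le_mul_of_nonneg_left h7 hL.le
    have : 0 ≤ q.L * e ^ 3 := by positivity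
    linarith
  linarith [ht.stop_le]

/-- An accepted step satisfies the first-order condition of the accelerated scheme. -/
lemma accepted_residual (ht : Tuned q p C R e) (hq : q.Solvable) {y : Fin d → ℝ} {ρ : ℝ}
    (hy : y ∈ q.level) (hρ : e ^ 2 ≤ ρ) (hz : |stepSq q p y - ρ| ≤ delta q p) (z : Fin d → ℝ) :
    |der1 q.f (approxAuxMin q p y).val z +
        q.L * ρ * form q.B (auxLoop q p y p.K 0).val z| ≤
      1 / 2 * (q.L * ρ) * nm (form q.B) (auxLoop q p y p.K 0).val * nm (form q.B) z := by
  have he := ht.e_pos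
  have hL := hq.L_pos
  have hb := hq.form_psd
  rw [approxAuxMin_val]
  obtain ⟨_, h1⟩ := ht.aux y hy
  rw [stepSq] at hz
  set h := (auxLoop q p y p.K 0).val
  have nh : 0 ≤ nm (form q.B) h := nm_nonneg _
  have nz : 0 ≤ nm (form q.B) z := nm_nonneg _
  have hz2 : |nm (form q.B) h ^ 2 - ρ| ≤ ρ / 10 := by linarith [ht.delta_le]
  have hρ0 : 0 < ρ := lt_of_lt_of_le (by positivity) hρ
  have h2 := hq.abs_der1_add_le h1 z
  have h3 := hb.abs_apply_le h z
  have h4 : |q.L * (ρ - nm (form q.B) h ^ 2) * form q.B h z| ≤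
      q.L * (ρ / 10) * (nm (form q.B) h * nm (form q.B) z) := by
    rw [abs_mul, abs_mul, abs_of_pos hL, abs_sub_comm]
    gcongr
  have e1 : der1 q.f (y + h) z + q.L * ρ * form q.B h z =
      (der1 q.f (y + h) z + q.L * nm (form q.B) h ^ 2 * form q.B h z) +
        q.L * (ρ - nm (form q.B) h ^ 2) * form q.B h z := by ring
  rw [e1]
  refine (abs_add_le _ _).trans ((add_le_add h2 h4).trans ?_)
  -- Taylor error and model residual use `0.4` of the allowed relative error `1/2`; the mismatch
  -- between `ρ` and `‖h‖²` uses the other `0.1`.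
  have h5 : q.L * nm (form q.B) h ^ 3 / 6 + e ^ 10 ≤ 0.4 * (q.L * ρ) * nm (form q.B) h := by
    rw [abs_le] at hz2
    have h6 : 0.9 * e ≤ nm (form q.B) h := by
      refine le_of_pow_le_pow_left₀ (n := 2) (by norm_num) nh ?_
      nlinarith
    have h7 : q.L * nm (form q.B) h ^ 3 ≤ q.L * (1.1 * ρ) * nm (form q.B) h := by
      calc q.L * nm (form q.B) h ^ 3 = q.L * nm (form q.B) h ^ 2 * nm (form q.B) h := by ring
        _ ≤ _ := by gcongr; linarith
    have h8 : q.L * e ^ 3 ≤ q.L * ρ * (10 / 9 * nm (form q.B) h) := by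
      calc q.L * e ^ 3 = q.L * e ^ 2 * e := by ring
        _ ≤ _ := by gcongr; linarith
    have h9 := ht.eta_le
    have h10 : 0 ≤ q.L * ρ * nm (form q.B) h := by positivity
    linarith
  have h6 := mul_le_mul_of_nonneg_right h5 nz
  linarith

end Tuned

/-- One iteration either stops at an `e`-minimizer or makes an accelerated step. -/
lemma iteration_spec {C R e E : ℝ} (ht : Tuned q p C R e) (hq : q.Solvable) {s : State d}
    (hs : Cert q s E) (hx : s.x ∈ q.level) :
    (∃ x, (iteration q p s).val = Sum.inl x ∧ q.f x - q.f q.xs ≤ e) ∨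
    ∃ s' ρ, (iteration q p s).val = Sum.inr s' ∧ s'.x ∈ q.level ∧ 0 < ρ ∧
      s'.A = s.A + stepSize q s.A ρ ∧ Cert q s' (E + s'.A * q.L * ρ ^ 2 / 4) := by
  have he := ht.e_pos
  have he2 : 0 < e ^ 2 := by positivity
  have hrho_eq := ht.rho_eq
  have hv := hs.center_mem hq
  have hA := hs.A_nonneg
  have hrho : 0 < p.rho := by rw [ht.rho_eq]; exact he2
  have hy := Tuned.proxCenter_mem hq hx hv hA hrho
  have e1 : bNorm q.B ((approxAuxMin q p (mixPoint s.x (q.x0 - (callSolve q.B s.S).val) s.A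
      (stepSize q s.A p.rho))).val - mixPoint s.x (q.x0 - (callSolve q.B s.S).val) s.A
      (stepSize q s.A p.rho)) ^ 2 = stepSq q p (proxCenter q s.x (center q s) s.A p.rho) :=
    bNorm_approxAuxMin_sub _
  rw [iteration]
  simp only [bind_val, e1]
  split_ifs with c1 c2
  -- Either stopping test forces `‖h‖² ≤ 2e²`; for the first, only nonnegativity of `ε̃_fs` is
  -- needed.
  · have hfs : 0 ≤ epsFs q p := by
      have := q.P_nonneg
      have := q.G_nonneg
      rw [epsFs]
      exact le_min (by positivity) (by norm_num)
    have : 0 ≤ stepSq q p (proxCenter q s.x (center q s) s.A p.rho) := sq_nonneg _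
    have := mul_nonneg hfs this
    have hst : stepSq q p (proxCenter q s.x (center q s) s.A p.rho) ≤ 2 * e ^ 2 := by linarith
    exact Or.inl ⟨_, rfl, ht.stop_gap_le hq hy hst⟩
  · have := ht.Q_le
    have hst : stepSq q p (proxCenter q s.x (center q s) s.A p.rho) ≤ 2 * e ^ 2 := by linarith
    exact Or.inl ⟨_, rfl, ht.stop_gap_le hq hy hst⟩
  · right
    obtain ⟨ρ, r1, r2, r3⟩ := ht.rhoSearch_spec hq hx hv hA (by linarith)
    have r3' : (rhoSearch q p s.x (q.x0 - (callSolve q.B s.S).val) s.A).val =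
        (ρ, (approxAuxMin q p (proxCenter q s.x (center q s) s.A ρ)).val, stepSize q s.A ρ) := r3
    rw [ht.rho_eq] at r1
    have hρ : 0 < ρ := he2.trans_le r1
    have hy' := Tuned.proxCenter_mem hq hx hv hA hρ
    have hz := abs_le.1 (r2.trans ht.delta_le)
    refine ⟨_, ρ, rfl, ?_, hρ, ?_, ?_⟩
    · simp only [r3']
      exact ht.f_le hq hy' (by linarith)
    · simp only [r3']
    · simp only [r3']
      exact hs.step hq hρ rfl (approxAuxMin_val _) (ht.accepted_residual hq hy' r1 r2)
        (by rw [stepSq] at hz; linarith)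

/-- The run from a certified state. -/
lemma mainLoop_spec {C R e γ : ℝ} (ht : Tuned q p C R e) (hq : q.Solvable)
    (hγ0 : 0 < γ) (hγ : γ ^ 10 * (32 * q.L * nm (form q.B) (q.x0 - q.xs) ^ 2) = 1)
    {G : ℝ} (n : ℕ) : ∀ (k : ℕ) (s : State d) (E : ℝ), Cert q s E → s.x ∈ q.level →
      Grows q.L γ k s.A E →
      512 * q.L * nm (form q.B) (q.x0 - q.xs) ^ 4 < G * ((k + n : ℕ) : ℝ) ^ 5 →
      q.f (mainLoop q p n s).output - q.f q.xs ≤ max e G := by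
  have hL := hq.L_pos
  set R2 := nm (form q.B) (q.x0 - q.xs) ^ 2 with hR2
  have hR20 : 0 < R2 := by
    refine lt_of_le_of_ne (by positivity) fun h => ?_
    rw [← h] at hγ; norm_num at hγ
  induction n with
  | zero =>
    intro k s E hs _ hg hG
    refine le_trans ?_ (le_max_right _ _)
    rw [mainLoop]
    have h1 := hg.le hL hR20 hγ0 hγ hs.A_nonneg (hs.E_le hq)
    have h2 := hs.bound
    have h3 := hs.E_nonneg
    have h4 := sq_nonneg (nm (form q.B) (q.xs - center q s))
    have hA := hs.A_nonneg
    have hgap := sub_nonneg.2 (hq.min s.x)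
    rw [add_zero] at hG
    have hk : 0 < G * (k : ℝ) ^ 5 := lt_of_le_of_lt (by
      have : 0 ≤ nm (form q.B) (q.x0 - q.xs) := nm_nonneg _
      positivity) hG
    have hk5 : (0 : ℝ) < (k : ℝ) ^ 5 := by
      refine lt_of_le_of_ne (by positivity) fun h => ?_
      rw [← h, mul_zero] at hk; exact lt_irrefl _ hk
    have h5 : (k : ℝ) ^ 5 * (q.f s.x - q.f q.xs) ≤ (k : ℝ) ^ 5 * G := by
      calc (k : ℝ) ^ 5 * (q.f s.x - q.f q.xs) ≤
          1024 * q.L * R2 * s.A * (q.f s.x - q.f q.xs) := by gcongr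
        _ = 1024 * q.L * R2 * (s.A * (q.f s.x - q.f q.xs)) := by ring
        _ ≤ 1024 * q.L * R2 * (1 / 2 * R2) :=
          mul_le_mul_of_nonneg_left (by linarith) (by positivity)
        _ = 512 * q.L * nm (form q.B) (q.x0 - q.xs) ^ 4 := by rw [hR2]; ring
        _ ≤ _ := by linarith
    exact le_of_mul_le_mul_left h5 hk5
  | succ n ih =>
    intro k s E hs hx hg hG
    rcases iteration_spec ht hq hs hx with ⟨x, h1, h2⟩ | ⟨s', ρ, h1, h2, h3, h4, h5⟩
    · have : (mainLoop q p (n + 1) s).output = x := by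
        rw [mainLoop]; simp only [h1]
      rw [this]
      exact h2.trans (le_max_left _ _)
    · have : (mainLoop q p (n + 1) s).output = (mainLoop q p n s').output := by
        rw [mainLoop]; simp only [h1]
      rw [this]
      have hA' : 0 < s'.A := by
        rw [h4]; have := stepSize_pos (A := s.A) hL h3
        linarith [hs.A_nonneg]
      refine ih (k + 1) s' _ h5 h2 (hg.succ hL hγ0 hγ hs.A_nonneg hs.E_nonneg h3 hA' ?_ rfl
        (h5.E_le hq)) (by rwa [show k + 1 + n = k + (n + 1) by ring])
      rw [h4]
      exact sqrt_add_stepSize_ge hL hs.A_nonneg h3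

end Search

/-! ### Counting oracle calls. -/

section Calls

variable {d : ℕ} (q : Problem d) (p : Init)

lemma callSolve_total (A : Matrix (Fin d) (Fin d) ℝ) (c : Fin d → ℝ) :
    (callSolve A c).total = 1 := rfl

lemma callGrad_total (f : (Fin d → ℝ) → ℝ) (x : Fin d → ℝ) : (callGrad f x).total = 1 := rfl

lemma callHess_total (f : (Fin d → ℝ) → ℝ) (x h : Fin d → ℝ) : (callHess f x h).total = 1 := rfl

lemma callThird_total (f : (Fin d → ℝ) → ℝ) (x h : Fin d → ℝ) : (callThird f x h).total = 1 := rfl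

lemma dualSearch_total (y c : Fin d → ℝ) (n : ℕ) :
    ∀ lo hi, (dualSearch q y c n lo hi).total = n := by
  induction n with
  | zero => intro lo hi; rw [dualSearch, pure_total]
  | succ n ih =>
    intro lo hi
    rw [dualSearch, bind_total, callSolve_total]
    split_ifs <;> rw [ih] <;> ring

lemma quarticStep_total (y c : Fin d → ℝ) : (quarticStep q p y c).total = p.J + 2 := by
  simp only [quarticStep, bind_total, callSolve_total, dualSearch_total, pure_total]
  ring

lemma auxStep_total (y h : Fin d → ℝ) : (auxStep q p y h).total = p.J + 5 := by
  simp only [auxStep, bind_total, callGrad_total, callHess_total, callThird_total,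
    quarticStep_total]
  ring

lemma auxLoop_total (y : Fin d → ℝ) (n : ℕ) :
    ∀ h, (auxLoop q p y n h).total = n * (p.J + 5) := by
  induction n with
  | zero => intro h; rw [auxLoop, pure_total, zero_mul]
  | succ n ih => intro h; rw [auxLoop, bind_total, auxStep_total, ih]; ring

lemma approxAuxMin_total (y : Fin d → ℝ) : (approxAuxMin q p y).total = p.K * (p.J + 5) := by
  rw [approxAuxMin, bind_total, auxLoop_total, pure_total, add_zero]

lemma rhoLoop_total_le (x v : Fin d → ℝ) (A : ℝ) (n : ℕ) :
    ∀ lo hi last, (rhoLoop q p x v A n lo hi last).total ≤ n * (p.K * (p.J + 5)) := by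
  induction n with
  | zero => intro lo hi last; rw [rhoLoop, pure_total]; exact Nat.zero_le _
  | succ n ih =>
    intro lo hi last
    rw [rhoLoop, bind_total, approxAuxMin_total, add_mul, one_mul, add_comm]
    refine Nat.add_le_add_right ?_ _
    simp only
    split_ifs
    · exact ih _ _ _
    · exact ih _ _ _
    · rw [pure_total]; exact Nat.zero_le _

lemma iteration_total_le (s : State d) :
    (iteration q p s).total ≤ 2 + (p.M + 1) * (p.K * (p.J + 5)) := by
  rw [iteration, bind_total, callSolve_total, bind_total, approxAuxMin_total]
  split_ifs
  · rw [pure_total, add_mul, one_mul]; omega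
  · rw [pure_total, add_mul, one_mul]; omega
  · simp only [bind_total, callGrad_total, pure_total]
    have h : (rhoSearch q p s.x (q.x0 - (callSolve q.B s.S).val) s.A).total ≤
      p.M * (p.K * (p.J + 5)) := rhoLoop_total_le _ _ _ _ _ _ _ _ _
    rw [add_mul, one_mul]; omega

lemma mainLoop_calls (n : ℕ) : ∀ s : State d, (mainLoop q p n s).calls.length ≤ n ∧
    ∀ m ∈ (mainLoop q p n s).calls, m.1 + m.2 ≤ 2 + (p.M + 1) * (p.K * (p.J + 5)) := by
  induction n with
  | zero => intro s; simp [mainLoop]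
  | succ n ih =>
    intro s
    have h := iteration_total_le q p s
    rw [mainLoop]
    simp only
    split
    · simpa [Counted.total] using h
    · next s' _ =>
      obtain ⟨h1, h2⟩ := ih s'
      refine ⟨by simpa using h1, fun m hm => ?_⟩
      rcases List.mem_cons.1 hm with rfl | hm
      · exact h
      · exact h2 m hm

end Calls

/-! ### Choice of parameters as powers of the scale. -/

section Tuning

variable {d : ℕ} {q : Problem d}

/-- The parameters at scale `2⁻ⁿ`. -/
def tuning (n N : ℕ) : Init where
  -- With `e = 2⁻ⁿ`, `ε̃ = e¹²` makes `δ̃` of order `e³`, below `ρ⁻ = e²`. A final bracket of width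
  -- `𝒫e¹³` moves the center by order `e¹¹`, the model residual is `e¹⁰`, and the cube root of `e¹⁰`
  -- is below order `e³`.
  rho := (((2 : ℝ) ^ n)⁻¹) ^ 2
  eps := (((2 : ℝ) ^ n)⁻¹) ^ 12
  K := 164 * n
  J := 41 * n
  M := 13 * n
  N := N

lemma rpow_natMul_inv {e : ℝ} (he : 0 ≤ e) (a k : ℕ) (hk : k ≠ 0) :
    (e ^ (a * k)) ^ (1 / (k : ℝ)) = e ^ a := by
  rw [pow_mul, one_div, Real.pow_rpow_inv_natCast (by positivity) hk]

lemma eps_rpow {e : ℝ} (he : 0 ≤ e) : (e ^ 12) ^ (1 / 4 : ℝ) = e ^ 3 := by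
  simpa using rpow_natMul_inv he 3 4 (by norm_num)

lemma delta_bounds (hL : 0 < q.L) {p : Init} {e : ℝ} (he0 : 0 ≤ e) (he1 : e ≤ 1)
    (hp : p.eps = e ^ 12) :
    6 * q.P ^ (1 / 2 : ℝ) / q.L ^ (1 / 4 : ℝ) * e ^ 3 ≤ delta q p ∧ delta q p ≤ q.Q * e ^ 3 := by
  have hP := q.P_nonneg
  have e1 : (e ^ 12 / q.L) ^ (1 / 4 : ℝ) = e ^ 3 / q.L ^ (1 / 4 : ℝ) := by
    rw [Real.div_rpow (by positivity) hL.le, eps_rpow he0]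
  have e2 : (12 * e ^ 12 / q.L) ^ (1 / 2 : ℝ) ≤ 5 / q.L ^ (1 / 2 : ℝ) * e ^ 6 := by
    have h1 : (e ^ 12) ^ (1 / 2 : ℝ) = e ^ 6 := by
      simpa using rpow_natMul_inv he0 6 2 (by norm_num)
    have h2 : (12 : ℝ) ^ (1 / 2 : ℝ) ≤ 5 := by
      rw [← Real.sqrt_eq_rpow, Real.sqrt_le_iff]; norm_num
    rw [Real.div_rpow (by positivity) hL.le, Real.mul_rpow (by norm_num) (by positivity), h1,
      div_mul_eq_mul_div]
    gcongr
  have e3 : 0 ≤ (12 * e ^ 12 / q.L) ^ (1 / 2 : ℝ) := by positivity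
  have e4 : e ^ 6 ≤ e ^ 3 := pow_le_pow_of_le_one he0 he1 (by norm_num)
  have e5 : 5 / q.L ^ (1 / 2 : ℝ) * e ^ 6 ≤ 5 / q.L ^ (1 / 2 : ℝ) * e ^ 3 := by gcongr
  have e6 : 6 * (e ^ 3 / q.L ^ (1 / 4 : ℝ)) * q.P ^ (1 / 2 : ℝ) =
      6 * q.P ^ (1 / 2 : ℝ) / q.L ^ (1 / 4 : ℝ) * e ^ 3 := by ring
  rw [delta, Problem.Q, hp, e1, e6, add_mul]
  constructor <;> linarith

lemma modulus_aux {L R t c κ e : ℝ} (hL : 0 < L) (hR : 0 ≤ R) (hκ : 0 < κ) (he : 0 ≤ e)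
    (hc : 192 * R ^ 3 * c / (L * κ ^ 3) * e ≤ 1) (h : L / 24 * t ^ 3 ≤ c * e ^ 10) :
    2 * R * t ≤ κ * e ^ 3 := by
  refine le_of_pow_le_pow_left₀ (n := 3) (by norm_num) (by positivity) ?_
  rw [div_mul_eq_mul_div, div_le_one (by positivity)] at hc
  have h1 : L * (2 * R * t) ^ 3 ≤ 192 * R ^ 3 * c * e * e ^ 9 := by
    calc L * (2 * R * t) ^ 3 = 192 * R ^ 3 * (L / 24 * t ^ 3) := by ring
      _ ≤ 192 * R ^ 3 * (c * e ^ 10) := by gcongr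
      _ = _ := by ring
  have h2 : 192 * R ^ 3 * c * e * e ^ 9 ≤ L * κ ^ 3 * e ^ 9 := by gcongr
  have h3 : L * (2 * R * t) ^ 3 ≤ L * (κ * e ^ 3) ^ 3 := by
    calc _ ≤ L * κ ^ 3 * e ^ 9 := h1.trans h2
      _ = _ := by ring
  exact le_of_mul_le_mul_left h3 hL

/-- At small scales the tuning satisfies all requirements. -/
lemma exists_tuned (hq : q.Solvable) (hP : 0 < q.P) :
    ∃ (C R : ℝ) (n0 : ℕ), 1 ≤ n0 ∧ ∀ n, n0 ≤ n → ∀ N,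
      Tuned q (tuning n N) C R ((2 : ℝ) ^ n)⁻¹ ∧
      2 * q.L * q.P * (tuning n N).rho ≤ ((2 : ℝ) ^ n)⁻¹ := by
  have hL := hq.L_pos
  obtain ⟨C, hC0, hC⟩ := hq.exists_derivBound
  obtain ⟨R, m0, hR0, hR⟩ := exists_auxLoop_bound hL hC0
  obtain ⟨κ, hκ⟩ : ∃ κ, κ = 6 * q.P ^ (1 / 2 : ℝ) / q.L ^ (1 / 4 : ℝ) := ⟨_, rfl⟩
  have hκ0 : 0 < κ := by rw [hκ]; positivity
  have hQ0 : 0 ≤ q.Q := by rw [Problem.Q]; positivity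
  obtain ⟨c, hc⟩ : ∃ c, c = (C + C * R + q.L * R ^ 2) * (q.P * Real.sqrt q.P) + 2 := ⟨_, rfl⟩
  have hc0 : 0 ≤ c := by rw [hc]; positivity
  -- Each summand is the constant of one smallness requirement; `s1` to `s6` below say that the
  -- scale beats it.
  obtain ⟨m1, hm1⟩ := exists_nat_ge (10 * q.Q + 100 / q.L + (10 * q.L + 1) * (2 + Real.sqrt q.P) +
    192 * R ^ 3 * c / (q.L * κ ^ 3) + 2 * q.P / κ + 2 * q.L * q.P)
  have p1 : 0 ≤ 100 / q.L := by positivity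
  have p2 : 0 ≤ (10 * q.L + 1) * (2 + Real.sqrt q.P) := by positivity
  have p3 : 0 ≤ 192 * R ^ 3 * c / (q.L * κ ^ 3) := by positivity
  have p4 : 0 ≤ 2 * q.P / κ := by positivity
  have p5 : 0 ≤ 2 * q.L * q.P := by positivity
  refine ⟨C, R, m0 + m1 + 1, by omega, fun n hn N => ?_⟩
  have h2n : (m1 : ℝ) ≤ 2 ^ n := by
    have h1 : (n : ℝ) ≤ 2 ^ n := by exact_mod_cast Nat.lt_two_pow_self.le
    have h2 : (m1 : ℝ) ≤ n := by exact_mod_cast (by omega : m1 ≤ n)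
    linarith
  have haux : ∀ y ∈ q.level, nm (form q.B) (auxLoop q (tuning n N) y (tuning n N).K 0).val ≤ R ∧
      ∀ z, |auxD q y (auxLoop q (tuning n N) y (tuning n N).K 0).val z| ≤
        (((2 : ℝ) ^ n)⁻¹) ^ 10 * nm (form q.B) z := by
    intro y hy
    have := hR d q hq.toGood rfl n (by omega) (tuning n N) rfl rfl y (hC y hy)
    rwa [show ((2 : ℝ) ^ (10 * n))⁻¹ = (((2 : ℝ) ^ n)⁻¹) ^ 10 by
      rw [inv_pow, ← pow_mul, mul_comm]] at this
  have hM : ((2 : ℝ) ^ (tuning n N).M)⁻¹ = (((2 : ℝ) ^ n)⁻¹) ^ 13 := by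
    rw [inv_pow, ← pow_mul, mul_comm]; rfl
  have hrho : (tuning n N).rho = (((2 : ℝ) ^ n)⁻¹) ^ 2 := rfl
  have heps : (tuning n N).eps = (((2 : ℝ) ^ n)⁻¹) ^ 12 := rfl
  generalize tuning n N = p at *
  have he0 : (0 : ℝ) < ((2 : ℝ) ^ n)⁻¹ := by positivity
  have he1 : ((2 : ℝ) ^ n)⁻¹ ≤ 1 := inv_le_one_of_one_le₀ (one_le_pow₀ (by norm_num))
  have hsmall : ∀ a : ℝ, a ≤ m1 → a * ((2 : ℝ) ^ n)⁻¹ ≤ 1 := fun a ha => by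
    rw [← div_eq_mul_inv, div_le_one (by positivity)]; linarith
  generalize ((2 : ℝ) ^ n)⁻¹ = e at *
  have hpw : ∀ k, 1 ≤ k → e ^ k ≤ e := fun k hk => by
    simpa using pow_le_pow_of_le_one he0.le he1 hk
  have s1 := hsmall (10 * q.Q) (by linarith)
  have s2 := hsmall (100 / q.L) (by linarith)
  have s3 := hsmall ((10 * q.L + 1) * (2 + Real.sqrt q.P)) (by linarith)
  have s4 := hsmall (192 * R ^ 3 * c / (q.L * κ ^ 3)) (by linarith)
  have s5 := hsmall (2 * q.P / κ) (by linarith)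
  have s6 := hsmall (2 * q.L * q.P) (by linarith)
  obtain ⟨d1, d2⟩ := delta_bounds (q := q) hL he0.le he1 heps
  rw [← hκ] at d1
  have heps4 : p.eps ^ (1 / 4 : ℝ) = e ^ 3 := by rw [heps, eps_rpow he0.le]
  have hQe : q.Q * e ^ 3 ≤ e ^ 2 / 10 := by
    have : 0 ≤ e ^ 2 := by positivity
    nlinarith
  refine ⟨⟨he0, hrho, hC0, hC, haux, d2.trans hQe, ?_, ?_, ?_, ?_, ?_, ?_, hM⟩, ?_⟩
  · rw [heps4]; exact d2
  · rw [heps4]; have : 0 ≤ e ^ 2 := by positivity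
    linarith
  · rw [div_mul_eq_mul_div, div_le_one hL] at s2
    have h7 := hpw 7 (by norm_num)
    have : 0 ≤ e ^ 3 := by positivity
    nlinarith
  · calc (10 * q.L * e ^ 3 + e ^ 10) * (2 * e + Real.sqrt q.P) ≤
        (10 * q.L * e ^ 2 + e ^ 2) * (2 * 1 + Real.sqrt q.P) := by
          have h3 : e ^ 3 ≤ e ^ 2 := pow_le_pow_of_le_one he0.le he1 (by norm_num)
          have h10 : e ^ 10 ≤ e ^ 2 := pow_le_pow_of_le_one he0.le he1 (by norm_num)
          gcongr
      _ = ((10 * q.L + 1) * (2 + Real.sqrt q.P) * e) * e := by ring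
      _ ≤ 1 * e := by gcongr
      _ = e := one_mul e
  · intro t ht h
    refine (modulus_aux hL hR0 hκ0 he0.le s4 (h.trans ?_)).trans d1
    have h11 : e ^ 11 ≤ e ^ 10 := pow_le_pow_of_le_one he0.le he1 (by norm_num)
    calc (C + C * R + q.L * R ^ 2) * (q.P * e ^ 11 * Real.sqrt q.P) + 2 * e ^ 10 ≤
        (C + C * R + q.L * R ^ 2) * (q.P * e ^ 10 * Real.sqrt q.P) + 2 * e ^ 10 := by gcongr
      _ = c * e ^ 10 := by rw [hc]; ring
  · refine lt_of_lt_of_le ?_ d1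
    rw [div_mul_eq_mul_div, div_le_one hκ0] at s5
    have h10 := hpw 10 (by norm_num)
    have h3 : 0 < e ^ 3 := by positivity
    have h4 : q.P * e ^ 10 ≤ q.P * e := by gcongr
    have h5 : q.P * e ^ 10 < κ := by linarith
    calc q.P * e ^ 13 = q.P * e ^ 10 * e ^ 3 := by ring
      _ < κ * e ^ 3 := by gcongr
  · rw [hrho]
    calc 2 * q.L * q.P * e ^ 2 = 2 * q.L * q.P * e * e := by ring
      _ ≤ 1 * e := by gcongr
      _ = e := one_mul e

end Tuning

/-! ### Extraction of the rate and the matching scale. -/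

section Rate

variable {d : ℕ} {q : Problem d}

/-- With no inner iterations the method returns the starting point at once. -/
lemma fastQuartic_of_K_eq_zero {p : Init} (hK : p.K = 0) (hrho : 0 < p.rho) :
    (fastQuartic q p).output = q.x0 ∧ (fastQuartic q p).calls.length ≤ 1 ∧
      ∀ m ∈ (fastQuartic q p).calls, m.1 + m.2 ≤ 1 := by
  have hy : mixPoint q.x0 (q.x0 - (callSolve q.B (0 : Fin d → ℝ)).val) 0 (stepSize q 0 p.rho) =
      q.x0 := by
    rw [callSolve_zero, sub_zero, mixPoint, ← add_smul, sub_add_cancel, one_smul]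
  have hA : ∀ y : Fin d → ℝ, approxAuxMin q p y = ⟨y, 0, 0⟩ := fun y => by
    rw [approxAuxMin, hK, auxLoop]
    show (⟨y + 0, 0, 0⟩ : Counted (Fin d → ℝ)) = _
    rw [add_zero]
  have hit : iteration q p ⟨q.x0, 0, 0⟩ = ⟨Sum.inl q.x0, 0, 1⟩ := by
    rw [iteration]
    show (callSolve q.B (0 : Fin d → ℝ) >>= _) = _
    have hnorm : bNorm q.B (q.x0 - q.x0) = 0 := by rw [bNorm_eq_nm, sub_self, nm_zero]
    simp only [Bind.bind, hy, hA, hnorm]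
    simp [hrho, callSolve, pure]
  rw [fastQuartic, mainLoop]
  simp [hit]

lemma nm_pos_of_lt (hq : q.Solvable) (h : q.f q.xs < q.f q.x0) :
    0 < nm (form q.B) (q.x0 - q.xs) := by
  refine lt_of_le_of_ne (nm_nonneg _) fun h0 => ?_
  have := form_definite hq.pos (q.x0 - q.xs) (by rw [← hq.form_psd.nm_sq, ← h0]; norm_num)
  rw [sub_eq_zero.1 this] at h
  exact lt_irrefl _ h

lemma output_gap_le (hq : q.Solvable) {C R e ε : ℝ} {p : Init} (ht : Tuned q p C R e)
    (h : q.f q.xs < q.f q.x0) (he : e ≤ ε)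
    (hN : 512 * q.L * nm (form q.B) (q.x0 - q.xs) ^ 4 < ε * ((p.N + 1 : ℕ) : ℝ) ^ 5) :
    q.f (fastQuartic q p).output - q.f q.xs ≤ ε := by
  have hL := hq.L_pos
  have hR := nm_pos_of_lt hq h
  have hpos : 0 < 1 / (32 * q.L * nm (form q.B) (q.x0 - q.xs) ^ 2) := by positivity
  have hγ : ((1 / (32 * q.L * nm (form q.B) (q.x0 - q.xs) ^ 2)) ^ (1 / 10 : ℝ)) ^ 10 *
      (32 * q.L * nm (form q.B) (q.x0 - q.xs) ^ 2) = 1 := by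
    rw [← Real.rpow_natCast, ← Real.rpow_mul hpos.le]
    norm_num
    field_simp
  have := mainLoop_spec ht hq (Real.rpow_pos_of_pos hpos _) hγ (G := ε) (p.N + 1) 0 ⟨q.x0, 0, 0⟩ 0
    (cert_zero q) hq.x0_mem (grows_zero _ _) (by simpa using hN)
  rwa [max_eq_right he] at this

lemma log_two_gt : (0.69 : ℝ) < Real.log 2 := by
  have := Real.log_two_gt_d9
  linarith

/-- The scale `2⁻ⁿ` that matches a target accuracy. -/
lemma exists_scale {Z ε : ℝ} (hZ : 1 ≤ Z) (hε : 0 < ε) {n0 : ℕ} (hn0 : 2 ^ n0 ≤ Z / ε) :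
    ∃ n, n0 ≤ n ∧ ((2 : ℝ) ^ n)⁻¹ ≤ ε ∧ (n : ℝ) ≤ 3 * Real.log (2 + Z / ε) := by
  have h1 : (1 : ℝ) ≤ Z / ε := le_trans (one_le_pow₀ (by norm_num)) hn0
  obtain ⟨m, hm1, hm2⟩ := exists_nat_pow_near h1 (by norm_num : (1 : ℝ) < 2)
  refine ⟨m + 1, ?_, ?_, ?_⟩
  · have : (2 : ℝ) ^ n0 < 2 ^ (m + 1) := hn0.trans_lt hm2
    exact ((pow_lt_pow_iff_right₀ (by norm_num)).1 this).le
  · rw [inv_le_comm₀ (by positivity) hε]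
    refine le_trans ?_ hm2.le
    rw [inv_eq_one_div]
    gcongr
  · have h2 : (m : ℝ) * Real.log 2 ≤ Real.log (2 + Z / ε) := by
      rw [← Real.log_pow]
      exact Real.log_le_log (by positivity) (by linarith)
    have h3 : Real.log 2 ≤ Real.log (2 + Z / ε) :=
      Real.log_le_log (by norm_num) (by linarith)
    have h4 := log_two_gt
    push_cast
    have h5 : (m + 1) * Real.log 2 ≤ 2 * Real.log (2 + Z / ε) := by linarith
    have h6 : ((m : ℝ) + 1) * 0.69 ≤ (m + 1) * Real.log 2 := by gcongr
    linarith

end Rate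

end FastQuartic

end

theorem mainTheorem2 :
    ∃ (C : ℝ) (c : ℕ), 0 < C ∧
      ∀ (d : ℕ) (q : FastQuartic.Problem d),
        q.B.PosDef → 0 < q.L → ConvexOn ℝ Set.univ q.f →
        FastQuartic.IsSmoothOfDegree 3 q.L q.B q.f →
        (∀ x, q.f q.xs ≤ q.f x) →
        Bornology.IsBounded {z | ∀ x, q.f z ≤ q.f x} →
        ∃ Z : ℝ, 0 < Z ∧ ∀ ε : ℝ, 0 < ε →
          ∃ p : FastQuartic.Init,
            (0 < p.rho ∧ p.rho < 1 / 2 ∧ 2 * q.L * q.P * p.rho ≤ ε ∧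
              0 < p.eps ∧ p.eps < 1 / 2 ∧ 1 ≤ p.M) ∧
            q.f (FastQuartic.fastQuartic q p).output - q.f q.xs ≤ ε ∧
            ((FastQuartic.fastQuartic q p).calls.length : ℝ) ≤
              C * (1 + (q.L * FastQuartic.bNorm q.B (q.x0 - q.xs) ^ 4 / ε) ^ (1 / 5 : ℝ)) ∧
            ∀ n ∈ (FastQuartic.fastQuartic q p).calls,
              ((n.1 + n.2 : ℕ) : ℝ) ≤ C * Real.log (2 + Z / ε) ^ c := by
  -- The exponent `3` comes from the nesting of the loops with `M`, `K` and `J` iterations, each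
  -- linear in `n`; `10⁷` exceeds `105618 · 3³`.
  refine ⟨10 ^ 7, 3, by norm_num, fun d q hB hL hc hs hmin hbd => ?_⟩
  have hq : q.Solvable := ⟨⟨hB, hL, hc, hs⟩, hmin, hbd⟩
  -- For large `ε` the starting point suffices. It must be returned cheaply, since the logarithmic
  -- bound does not pay for the minimal scale `n0` there; with `K = 0` the step is zero and the
  -- first stopping test fires.
  have hlarge : ∀ Z ε : ℝ, 0 < Z → 0 < ε → q.f q.x0 - q.f q.xs ≤ ε →
      ∃ p : FastQuartic.Init,
        (0 < p.rho ∧ p.rho < 1 / 2 ∧ 2 * q.L * q.P * p.rho ≤ ε ∧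
          0 < p.eps ∧ p.eps < 1 / 2 ∧ 1 ≤ p.M) ∧
        q.f (FastQuartic.fastQuartic q p).output - q.f q.xs ≤ ε ∧
        ((FastQuartic.fastQuartic q p).calls.length : ℝ) ≤
          10 ^ 7 * (1 + (q.L * FastQuartic.bNorm q.B (q.x0 - q.xs) ^ 4 / ε) ^ (1 / 5 : ℝ)) ∧
        ∀ n ∈ (FastQuartic.fastQuartic q p).calls,
          ((n.1 + n.2 : ℕ) : ℝ) ≤ 10 ^ 7 * Real.log (2 + Z / ε) ^ 3 := by
    intro Z ε hZ hε hgap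
    have hP := q.P_nonneg
    have hrho : 0 < min (1 / 4) (ε / (2 * q.L * q.P + 1)) := lt_min (by norm_num) (by positivity)
    obtain ⟨h1, h2, h3⟩ := FastQuartic.fastQuartic_of_K_eq_zero (q := q)
      (p := ⟨min (1 / 4) (ε / (2 * q.L * q.P + 1)), 1 / 4, 0, 0, 1, 0⟩) rfl hrho
    refine ⟨⟨min (1 / 4) (ε / (2 * q.L * q.P + 1)), 1 / 4, 0, 0, 1, 0⟩,
      ⟨hrho, lt_of_le_of_lt (min_le_left _ _) (by norm_num), ?_, by norm_num, by norm_num, le_rfl⟩,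
      by rw [h1]; exact hgap, ?_, fun n hn => ?_⟩
    · calc 2 * q.L * q.P * min (1 / 4) (ε / (2 * q.L * q.P + 1)) ≤
          (2 * q.L * q.P + 1) * (ε / (2 * q.L * q.P + 1)) := by
            gcongr
            · linarith
            · exact min_le_right _ _
        _ = ε := by field_simp
    · have h4 : ((FastQuartic.fastQuartic q
        ⟨min (1 / 4) (ε / (2 * q.L * q.P + 1)), 1 / 4, 0, 0, 1, 0⟩).calls.length : ℝ) ≤ 1 := by
        exact_mod_cast h2
      have h5 : 0 ≤ (q.L * FastQuartic.bNorm q.B (q.x0 - q.xs) ^ 4 / ε) ^ (1 / 5 : ℝ) := by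
        positivity
      linarith
    · have h4 : ((n.1 + n.2 : ℕ) : ℝ) ≤ 1 := by exact_mod_cast h3 n hn
      have h5 : Real.log 2 ≤ Real.log (2 + Z / ε) :=
        Real.log_le_log (by norm_num) (by have : 0 < Z / ε := by positivity
                                          linarith)
      have h6 : (0.69 : ℝ) ^ 3 ≤ Real.log (2 + Z / ε) ^ 3 :=
        pow_le_pow_left₀ (by norm_num) (by linarith [FastQuartic.log_two_gt]) 3
      linarith
  by_cases hgap : q.f q.xs < q.f q.x0
  swap
  · exact ⟨1, one_pos, fun ε hε => hlarge 1 ε one_pos hε (by linarith)⟩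
  have hR := FastQuartic.nm_pos_of_lt hq hgap
  have hP : 0 < q.P := lt_of_lt_of_le (by positivity) (hq.nm_sub_sq_le hq.x0_mem hq.xs_mem)
  obtain ⟨C, R, n0, hn01, htuned⟩ := FastQuartic.exists_tuned hq hP
  -- Chosen so that `Z/ε ≥ 2^n0` whenever `ε` is below the initial gap.
  obtain ⟨Z, hZ⟩ : ∃ Z : ℝ, Z = 2 ^ n0 * (1 + (q.f q.x0 - q.f q.xs)) := ⟨_, rfl⟩
  have hpow : (1 : ℝ) ≤ 2 ^ n0 := one_le_pow₀ (by norm_num)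
  have hZ1 : 1 ≤ Z := by rw [hZ]; nlinarith
  refine ⟨Z, by linarith, fun ε hε => ?_⟩
  by_cases hεgap : q.f q.x0 - q.f q.xs ≤ ε
  · exact hlarge Z ε (by linarith) hε hεgap
  push Not at hεgap
  obtain ⟨n, hn0, hnε, hnlog⟩ := FastQuartic.exists_scale hZ1 hε (n0 := n0) (by
    rw [le_div_iff₀ hε, hZ]
    gcongr
    linarith)
  have hn1 : 1 ≤ n := hn01.trans hn0
  set t := (q.L * FastQuartic.nm (FastQuartic.form q.B) (q.x0 - q.xs) ^ 4 / ε) ^ (1 / 5 : ℝ) with ht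
  have ht0 : 0 ≤ t := by rw [ht]; positivity
  have ht5 : t ^ 5 = q.L * FastQuartic.nm (FastQuartic.form q.B) (q.x0 - q.xs) ^ 4 / ε := by
    rw [ht, ← Real.rpow_natCast, ← Real.rpow_mul (by positivity)]; norm_num
  -- The factor `4` suffices because `4⁵ = 1024` exceeds the constant `512` of the rate.
  obtain ⟨hT, hrhoε⟩ := htuned n hn0 ⌈4 * t⌉₊
  have he : (0 : ℝ) < ((2 : ℝ) ^ n)⁻¹ := by positivity
  have he2 : ((2 : ℝ) ^ n)⁻¹ ≤ 1 / 2 := by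
    rw [one_div]
    refine inv_anti₀ (by norm_num) ?_
    simpa using pow_le_pow_right₀ (by norm_num : (1 : ℝ) ≤ 2) hn1
  obtain ⟨hlen, hcalls⟩ := FastQuartic.mainLoop_calls q (FastQuartic.tuning n ⌈4 * t⌉₊)
    (⌈4 * t⌉₊ + 1) ⟨q.x0, 0, 0⟩
  refine ⟨FastQuartic.tuning n ⌈4 * t⌉₊, ⟨?_, ?_, hrhoε.trans hnε, ?_, ?_, ?_⟩, ?_, ?_, ?_⟩
  · exact pow_pos he 2
  · calc (((2 : ℝ) ^ n)⁻¹) ^ 2 ≤ (1 / 2) ^ 2 := pow_le_pow_left₀ he.le he2 2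
      _ < 1 / 2 := by norm_num
  · exact pow_pos he 12
  · calc (((2 : ℝ) ^ n)⁻¹) ^ 12 ≤ (1 / 2) ^ 12 := pow_le_pow_left₀ he.le he2 12
      _ < 1 / 2 := by norm_num
  · show 1 ≤ 13 * n
    omega
  · refine FastQuartic.output_gap_le hq hT hgap hnε ?_
    have h1 : 4 * t < ((⌈4 * t⌉₊ + 1 : ℕ) : ℝ) := by
      push_cast; linarith [Nat.le_ceil (4 * t)]
    have h2 : (4 * t) ^ 5 < ((⌈4 * t⌉₊ + 1 : ℕ) : ℝ) ^ 5 :=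
      pow_lt_pow_left₀ h1 (by positivity) (by norm_num)
    have h3 : q.L * FastQuartic.nm (FastQuartic.form q.B) (q.x0 - q.xs) ^ 4 = ε * t ^ 5 := by
      rw [ht5]; field_simp
    calc 512 * q.L * FastQuartic.nm (FastQuartic.form q.B) (q.x0 - q.xs) ^ 4 =
        512 * (ε * t ^ 5) := by rw [← h3]; ring
      _ ≤ ε * (4 * t) ^ 5 := by
        have : 0 ≤ ε * t ^ 5 := by positivity
        linarith
      _ < _ := by
        exact mul_lt_mul_of_pos_left h2 hε
  · rw [FastQuartic.bNorm_eq_nm, ← ht]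
    have h1 : ((FastQuartic.fastQuartic q (FastQuartic.tuning n ⌈4 * t⌉₊)).calls.length : ℝ) ≤
        ((⌈4 * t⌉₊ + 1 : ℕ) : ℝ) := by exact_mod_cast hlen
    push_cast at h1
    have h2 := Nat.ceil_lt_add_one (by positivity : 0 ≤ 4 * t)
    linarith
  · intro m hm
    have h1 : ((m.1 + m.2 : ℕ) : ℝ) ≤ ((2 + (13 * n + 1) * (164 * n * (41 * n + 5)) : ℕ) : ℝ) := by
      exact_mod_cast hcalls m hm
    have h2 : 2 + (13 * n + 1) * (164 * n * (41 * n + 5)) ≤ 105618 * n ^ 3 := by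
      calc 2 + (13 * n + 1) * (164 * n * (41 * n + 5)) ≤
          2 * n ^ 3 + (13 * n + n) * (164 * n * (41 * n + 5 * n)) := by
            have : 1 ≤ n ^ 3 := Nat.one_le_pow _ _ hn1
            gcongr
            · omega
            · omega
        _ = 105618 * n ^ 3 := by ring
    have h3 : ((2 + (13 * n + 1) * (164 * n * (41 * n + 5)) : ℕ) : ℝ) ≤ 105618 * (n : ℝ) ^ 3 := by
      exact_mod_cast h2
    have h4 : (n : ℝ) ^ 3 ≤ (3 * Real.log (2 + Z / ε)) ^ 3 :=
      pow_le_pow_left₀ (by positivity) hnlog 3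
    have h5 : 0 ≤ Real.log (2 + Z / ε) ^ 3 := by
      have : (0 : ℝ) ≤ n := by positivity
      have : 0 ≤ Real.log (2 + Z / ε) := by linarith
      positivity
    calc ((m.1 + m.2 : ℕ) : ℝ) ≤ 105618 * (n : ℝ) ^ 3 := h1.trans h3
      _ ≤ 105618 * (3 * Real.log (2 + Z / ε)) ^ 3 := by gcongr
      _ ≤ 10 ^ 7 * Real.log (2 + Z / ε) ^ 3 := by rw [mul_pow]; linarith
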